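/- \textbf{Setting.} All Hilbert spaces are complex and finite-dimensional, all graphs finite. A \emph{span program} on a finite set $D$ is $\mathcal P=(\mathcal H,x\mapsto\mathcal H(x),\mathcal K,w_0)$ with $\mathcal H$ a Hilbert space, $\mathcal H(x),\mathcal K\subseteq\mathcal H$ subspaces ($x\in D$) and $0\neq w_0\in\mathcal K^\perp$. An input $x$ is positive if $w_0\in\mathcal K+\mathcal H(x)$ and negative otherwise; $\mathcal P$ evaluates $f:D\to\{0,1\}$ if $f(x)=1$ exactly for the positive $x$. Let $w_+(x,\mathcal P)=\min\{\|w\|^2: w\in\mathcal H(x),\,w-w_0\in\mathcal K\}$, $w_-(x,\mathcal P)=\min\{\|w\|^2: w\in\mathcal K^\perp\cap\mathcal H(x)^\perp,\,\langle w,w_0\rangle=1\}$, let $W_+(\mathcal P)$ be the maximum of $w_+(x,\mathcal P)$ over positive $x$ and $W_-(\mathcal P)$ the maximum of $w_-(x,\mathcal P)$ over negative $x$ (the maximum of the empty set being $0$), and $C(\mathcal P)=\sqrt{W_+(\mathcal P)W_-(\mathcal P)}$. For $\alpha>0$, $\alpha\mathcal P$ is $\mathcal P$ with $w_0$ replaced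 by $\sqrt\alpha\,w_0$, and $\lnot\mathcal P=(\mathcal H,x\mapsto\mathcal H(x)^\perp,(\mathcal K+\mathrm{Span}\{w_0\})^\perp,w_0/\|w_0\|^2)$. Let $G=(V,E)$ be a connected undirected multigraph with arbitrarily directed edges, vertices $s\neq t$, and span programs $\mathcal P^e=(\mathcal H^e,x\mapsto\mathcal H^e(x),\mathcal K^e,w_0^e)$ on $D$ for $e\in E$. Put $r_e=\|w_0^e\|^2$, and for $f\in\mathbb C^E$ put $|f\rangle=\sum_e f_e\sqrt{r_e}\,|e\rangle\in\mathbb C^E$. The \emph{circulation space} is $\mathcal C_{G,r}=\{|f\rangle: f\text{ a circulation}\}$, and $f^{\min}$ is the unit $st$-flow minimising $\||f\rangle\|$. Let $\mathcal E$ be the isometry $|e\rangle\mapsto w_0^e/\|w_0^e\|$. The \emph{graph composition} is the span program $(\bigoplus_e\mathcal H^e,\;x\mapsto\bigoplus_e\mathcal H^e(x),\;\bigoplus_e\mathcal K^e\oplus\mathcal E(\mathcal C_{G,r}),\;\mathcal E|f^{\min}\rangle)$. \emph{Strategy.} Let $a,b,n\in\mathbb N$, $b\ge2$, $\Sigma$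 a finite alphabet, $\Lambda$ a finite set, $m_0\in\mathbb N$. For all $m\in\mathbb N$, $\lambda\in\Lambda$ let $f_m^\lambda,f_m^{\lambda,\mathrm{aux}}:\Sigma^n\to\{0,1\}$, $m_1,\dots,m_a\in\mathbb N$ and $\lambda_1,\dots,\lambda_a\in\Lambda$ (depending on $m,\lambda$), and let $\varphi_m^\lambda$ be a read-once boolean formula in $a+1$ variables, written as an AND-OR tree with gates of fan-in at least $2$ and negations, such that for all $m\ge m_0$, $x\in\Sigma^n$: $m_j<m$ for all $j$, and \[f_m^\lambda(x)=\varphi_m^\lambda\bigl(f_{m_1}^{\lambda_1}(x),\dots,f_{m_a}^{\lambda_a}(x),f_m^{\lambda,\mathrm{aux}}(x)\bigr).\] Moreover $m_j\in\Theta(m/b)$ with constants $0<c_1$, $c_2<b$ and $M\in\mathbb N$: $c_1m/b\le m_j\le c_2m/b$ for all $m\ge\max(M,m_0)$. Let $\delta$ bound the depths of the AND-OR trees of all $\varphi_m^\lambda$, negations not being counted (one may always take $\delta=a$). \emph{QROM model.} A circuit acts on a finite number of qubits. A QROM of $N$ bits holds a fixed bit string $x$; the read-only gate acts as $|j\rangle\mapsto(-1)^{x_j}|j\rangle$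 on an index register and has unit cost. An elementary gate, of unit cost, is a unitary $W\otimes I$, where $W$ acts on some of the qubits and is the identity on all but at most four of their computational basis states. An operator $R$ on $\mathbb C^E$ is implemented up to error $\varepsilon$ if, after identifying the $|e\rangle$, $e\in E$, with suitable distinct computational basis states, the circuit agrees with $R$ on $\mathbb C^E$ up to operator norm error $\varepsilon$. \textbf{Theorem.} For all $\delta,c_1,c_2,M$ as above there are a function $\varepsilon\mapsto C_\varepsilon$ and $k\in\mathbb N$, depending on $\delta,c_1,c_2,M$ only, such that the following holds for every strategy as above. Let $\mathcal P_m^{\lambda,\mathrm{aux}}$ be span programs on $\Sigma^n$ evaluating $f_m^{\lambda,\mathrm{aux}}$ for all $m$, and let $\mathcal P_m^\lambda$ be span programs evaluating $f_m^\lambda$ for $m<m_0$. Then there are span programs $\mathcal P_m^\lambda$ for all $m\ge m_0$ such that for all $m\ge m_0$ and $\lambda\in\Lambda$: \begin{enumerate} \item $\mathcal P_m^\lambda$ evaluates $f_m^\lambda$, and $C(\mathcal P_m^\lambda)^2\le\sum_{j=1}^aC(\mathcal P_{m_j}^{\lambda_j})^2+C(\mathcal P_m^{\lambda,\mathrm{aux}})^2$.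 \item $\mathcal P_m^\lambda$ is a graph composition whose edges carry positive scalar multiples of the given span programs, or of their negations, at the leaves of the recursion tree of $f_m^\lambda$ (the $\mathcal P_{m'}^{\lambda',\mathrm{aux}}$ with $m'\ge m_0$ and the $\mathcal P_{m'}^{\lambda'}$ with $m'<m_0$), every leaf being used on at most one edge. \item If $a\ge2$ and $m\ge M$, then for every $\varepsilon>0$ the reflection $2\Pi_{\mathcal C_{G,r}}-I$ through the circulation space of this graph composition can be implemented up to error $\varepsilon$ in the QROM model with a QROM of at most $C_\varepsilon\,(a^{\log m/\log b})^k$ bits and at most $C_\varepsilon\,g\,\log^k(2+g)$ gates, where $g=(\log m/\log b)^2\log a$; i.e.\ with a QROM of size $\mathrm{poly}(a^{\log m/\log b})$ and $\widetilde O((\log m/\log b)^2\log a)$ gates. \end{enumerate} -/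

import Mathlib

open scoped ENNReal

universe u v

noncomputable section

/-! ### Span programs -/

/-- A span program on the domain `D`: a finite-dimensional complex Hilbert space `H`, a subspace
`sub x` for every input `x`, an input-independent subspace `K`, and a nonzero initial vector
`w0` in the orthogonal complement of `K`. -/
structure SpanProgram (D : Type v) where
  H : Type u
  [instNormed : NormedAddCommGroup H]
  [instInner : InnerProductSpace ℂ H]
  [instFinDim : FiniteDimensional ℂ H]
  sub : D → Submodule ℂ H
  K : Submodule ℂ H
  w0 : H
  w0_mem : w0 ∈ Kᗮ
  w0_ne : w0 ≠ 0

attribute [instance] SpanProgram.instNormed SpanProgram.instInner SpanProgram.instFinDim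

namespace SpanProgram

variable {D : Type v}

/-- Positive inputs; all other inputs are negative. -/
def IsPositive (P : SpanProgram.{u} D) (x : D) : Prop := P.w0 ∈ P.K ⊔ P.sub x

/-- `P` computes (evaluates) `f`. -/
def Computes (P : SpanProgram.{u} D) (f : D → Bool) : Prop :=
  ∀ x, f x = true ↔ P.IsPositive x

def posWitnesses (P : SpanProgram.{u} D) (x : D) : Set P.H :=
  {w | w ∈ P.sub x ∧ w - P.w0 ∈ P.K}

def negWitnesses (P : SpanProgram.{u} D) (x : D) : Set P.H :=
  {w | w ∈ P.Kᗮ ∧ w ∈ (P.sub x)ᗮ ∧ inner ℂ w P.w0 = 1}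

/-- Positive witness complexity of `x`: the least norm squared of a positive witness,
`∞` if there is none. -/
def posComplexityAt (P : SpanProgram.{u} D) (x : D) : ℝ≥0∞ :=
  ⨅ w ∈ P.posWitnesses x, ENNReal.ofReal (‖w‖ ^ 2)

/-- Negative witness complexity of `x`. -/
def negComplexityAt (P : SpanProgram.{u} D) (x : D) : ℝ≥0∞ :=
  ⨅ w ∈ P.negWitnesses x, ENNReal.ofReal (‖w‖ ^ 2)

/-- `W₊(P)`: maximum over all positive inputs (`0` if there are none). -/
def posComplexity (P : SpanProgram.{u} D) : ℝ≥0∞ :=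
  ⨆ (x : D) (_ : P.IsPositive x), P.posComplexityAt x

/-- `W₋(P)`: maximum over all negative inputs (`0` if there are none). -/
def negComplexity (P : SpanProgram.{u} D) : ℝ≥0∞ :=
  ⨆ (x : D) (_ : ¬ P.IsPositive x), P.negComplexityAt x

/-- The span program complexity `C(P) = √(W₊(P) W₋(P))`. -/
def complexity (P : SpanProgram.{u} D) : ℝ≥0∞ :=
  (P.posComplexity * P.negComplexity) ^ (1 / 2 : ℝ)

/-- The scalar multiple `αP`, for `α > 0`: the initial vector is multiplied by `√α`. -/
def scale (P : SpanProgram.{u} D) (α : ℝ) (hα : 0 < α) : SpanProgram.{u} D where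
  H := P.H
  sub := P.sub
  K := P.K
  w0 := ((Real.sqrt α : ℝ) : ℂ) • P.w0
  w0_mem := Submodule.smul_mem _ _ P.w0_mem
  w0_ne := smul_ne_zero (by exact_mod_cast (Real.sqrt_pos.2 hα).ne') P.w0_ne

/-- The negation `¬P`. -/
def neg (P : SpanProgram.{u} D) : SpanProgram.{u} D where
  H := P.H
  sub := fun x => (P.sub x)ᗮ
  K := (P.K ⊔ Submodule.span ℂ {P.w0})ᗮ
  w0 := (((‖P.w0‖ ^ 2)⁻¹ : ℝ) : ℂ) • P.w0
  w0_mem := by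
    refine Submodule.smul_mem _ _ (Submodule.le_orthogonal_orthogonal _ ?_)
    exact Submodule.mem_sup_right (Submodule.mem_span_singleton_self _)
  w0_ne := by
    refine smul_ne_zero ?_ P.w0_ne
    have : ‖P.w0‖ ≠ 0 := norm_ne_zero_iff.2 P.w0_ne
    exact_mod_cast inv_ne_zero (pow_ne_zero 2 this)

end SpanProgram

/-! ### Electrical networks -/

/-- A finite connected undirected multigraph, every edge of which has a default direction from
`tail e` to `head e`, with distinct source and sink nodes `s` and `t`. -/
structure STGraph where
  V : Type
  E : Type
  [instFinV : Fintype V]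
  [instDecV : DecidableEq V]
  [instFinE : Fintype E]
  tail : E → V
  head : E → V
  s : V
  t : V
  s_ne_t : s ≠ t
  connected : ∀ x y : V, Relation.ReflTransGen
    (fun x y => ∃ e, (tail e = x ∧ head e = y) ∨ (tail e = y ∧ head e = x)) x y

attribute [instance] STGraph.instFinV STGraph.instDecV STGraph.instFinE

namespace STGraph

variable (G : STGraph)

/-- Net flow out of every vertex. -/
def netFlow : (G.E → ℂ) →ₗ[ℂ] (G.V → ℂ) where
  toFun f := fun x => (∑ e, if G.tail e = x then f e else 0) - ∑ e, if G.head e = x then f e else 0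
  map_add' f g := by
    funext x
    simp only [Pi.add_apply, ← Finset.sum_sub_distrib, ← Finset.sum_add_distrib]
    refine Finset.sum_congr rfl fun e _ => ?_
    split_ifs <;> ring
  map_smul' c f := by
    funext x
    simp only [Pi.smul_apply, smul_eq_mul, RingHom.id_apply, ← Finset.sum_sub_distrib,
      Finset.mul_sum]
    refine Finset.sum_congr rfl fun e _ => ?_
    split_ifs <;> ring

/-- The flow state `|f⟩ = ∑ₑ fₑ √rₑ |e⟩` in the flow space `ℂ^E`, linearly in `f`. -/
def flowState (r : G.E → ℝ) : (G.E → ℂ) →ₗ[ℂ] EuclideanSpace ℂ G.E where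
  toFun f := WithLp.toLp 2 fun e => f e * ((Real.sqrt (r e) : ℝ) : ℂ)
  map_add' f g := by ext e; simp [add_mul]
  map_smul' c f := by ext e; simp [mul_assoc]

/-- The circulation space: the flow states of all circulations. -/
def circulationSpace (r : G.E → ℝ) : Submodule ℂ (EuclideanSpace ℂ G.E) :=
  (LinearMap.ker G.netFlow).map (G.flowState r)

/-- The unit `st`-flows. -/
def unitFlows : Set (G.E → ℂ) :=
  {f | G.netFlow f = Pi.single G.s 1 - Pi.single G.t 1}

/-- `f` is a unit `st`-flow of least energy. -/
def IsMinFlow (r : G.E → ℝ) (f : G.E → ℂ) : Prop :=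
  f ∈ G.unitFlows ∧ ∀ g ∈ G.unitFlows, ‖G.flowState r f‖ ^ 2 ≤ ‖G.flowState r g‖ ^ 2

theorem netFlow_single [DecidableEq G.E] (e : G.E) :
    G.netFlow (Pi.single e 1) = Pi.single (G.tail e) 1 - Pi.single (G.head e) 1 := by
  funext x
  simp only [netFlow, LinearMap.coe_mk, AddHom.coe_mk, Pi.sub_apply, Pi.single_apply]
  congr 1
  · rw [Finset.sum_eq_single e]
    · simp [eq_comm]
    · intro b _ hb; simp [hb]
    · simp
  · rw [Finset.sum_eq_single e]
    · simp [eq_comm]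
    · intro b _ hb; simp [hb]
    · simp

theorem exists_flow (x y : G.V) :
    ∃ f, G.netFlow f = Pi.single x (1 : ℂ) - Pi.single y 1 := by
  classical
  induction G.connected x y with
  | refl => exact ⟨0, by simp⟩
  | tail _ h ih =>
    obtain ⟨f, hf⟩ := ih
    obtain ⟨e, ⟨h1, h2⟩ | ⟨h1, h2⟩⟩ := h
    · refine ⟨f + Pi.single e 1, ?_⟩
      rw [map_add, hf, netFlow_single, h1, h2]; abel
    · refine ⟨f - Pi.single e 1, ?_⟩
      rw [map_sub, hf, netFlow_single, h1, h2]; abel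

theorem exists_orthogonal_flow (r : G.E → ℝ) :
    ∃ f ∈ G.unitFlows, G.flowState r f ∈ (G.circulationSpace r)ᗮ := by
  obtain ⟨f, hf⟩ := G.exists_flow G.s G.t
  obtain ⟨c, hc, d, hd, hcd⟩ :=
    (G.circulationSpace r).exists_add_mem_mem_orthogonal (G.flowState r f)
  obtain ⟨g, hg, rfl⟩ := hc
  refine ⟨f - g, ?_, ?_⟩
  · change G.netFlow (f - g) = _
    rw [map_sub, hf, LinearMap.mem_ker.1 hg, sub_zero]
  · rw [map_sub, hcd, add_sub_cancel_left]
    exact hd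

theorem sub_mem_circulationSpace (r : G.E → ℝ) {f g : G.E → ℂ} (hf : f ∈ G.unitFlows)
    (hg : g ∈ G.unitFlows) : G.flowState r f - G.flowState r g ∈ G.circulationSpace r := by
  refine ⟨f - g, ?_, by rw [map_sub]⟩
  change G.netFlow (f - g) = 0
  rw [map_sub, show G.netFlow f = _ from hf, show G.netFlow g = _ from hg, sub_self]

theorem norm_sq_of_orthogonal (r : G.E → ℝ) {f g : G.E → ℂ} (hf : f ∈ G.unitFlows)
    (ho : G.flowState r f ∈ (G.circulationSpace r)ᗮ) (hg : g ∈ G.unitFlows) :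
    ‖G.flowState r g‖ ^ 2 =
      ‖G.flowState r f‖ ^ 2 + ‖G.flowState r g - G.flowState r f‖ ^ 2 := by
  have h := G.sub_mem_circulationSpace r hg hf
  have h2 := norm_add_sq_eq_norm_sq_add_norm_sq_of_inner_eq_zero (𝕜 := ℂ) _ _
    ((Submodule.mem_orthogonal' _ _).1 ho _ h)
  rw [add_sub_cancel] at h2
  rw [pow_two, pow_two, pow_two, h2]

theorem exists_isMinFlow (r : G.E → ℝ) : ∃ f, G.IsMinFlow r f := by
  obtain ⟨f, hf, ho⟩ := G.exists_orthogonal_flow r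
  refine ⟨f, hf, fun g hg => ?_⟩
  rw [G.norm_sq_of_orthogonal r hf ho hg]
  exact le_add_of_nonneg_right (by positivity)

/-- The minimum-energy unit `st`-flow. -/
def minFlow (r : G.E → ℝ) : G.E → ℂ := (G.exists_isMinFlow r).choose

theorem minFlow_isMinFlow (r : G.E → ℝ) : G.IsMinFlow r (G.minFlow r) :=
  (G.exists_isMinFlow r).choose_spec

theorem minFlow_orthogonal (r : G.E → ℝ) :
    G.flowState r (G.minFlow r) ∈ (G.circulationSpace r)ᗮ := by
  obtain ⟨f, hf, ho⟩ := G.exists_orthogonal_flow r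
  obtain ⟨hm, hle⟩ := G.minFlow_isMinFlow r
  have h1 := G.norm_sq_of_orthogonal r hf ho hm
  have h2 := hle f hf
  have h3 : ‖G.flowState r (G.minFlow r) - G.flowState r f‖ = 0 := by
    have : ‖G.flowState r (G.minFlow r) - G.flowState r f‖ ^ 2 ≤ 0 := by linarith
    exact pow_eq_zero_iff (two_ne_zero) |>.1 (le_antisymm this (by positivity))
  rwa [sub_eq_zero.1 (norm_eq_zero.1 h3)]

theorem minFlow_ne_zero (r : G.E → ℝ) (hr : ∀ e, 0 < r e) :
    G.flowState r (G.minFlow r) ≠ 0 := by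
  intro h
  have h0 : G.minFlow r = 0 := by
    funext e
    have he := congrArg (fun v : EuclideanSpace ℂ G.E => v e) h
    have hs : ((Real.sqrt (r e) : ℝ) : ℂ) ≠ 0 := by
      exact_mod_cast (Real.sqrt_pos.2 (hr e)).ne'
    simpa [flowState, hs] using he
  have hm := (G.minFlow_isMinFlow r).1
  rw [h0] at hm
  have hm' : G.netFlow 0 = Pi.single G.s (1 : ℂ) - Pi.single G.t 1 := hm
  rw [map_zero] at hm'
  have := congrFun hm' G.s
  simp [G.s_ne_t] at this

/-! ### Graph composition of span programs -/

variable {D : Type v} (Q : G.E → SpanProgram.{u} D)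

/-- The resistances `rₑ = ‖w₀ᵉ‖²`. -/
def resistance : G.E → ℝ := fun e => ‖(Q e).w0‖ ^ 2

/-- The direct sum of a family of subspaces inside the Hilbert space direct sum. -/
def blockSum (S : ∀ e, Submodule ℂ (Q e).H) : Submodule ℂ (PiLp 2 fun e => (Q e).H) where
  carrier := {v | ∀ e, v e ∈ S e}
  add_mem' hv hw e := (S e).add_mem (hv e) (hw e)
  zero_mem' e := (S e).zero_mem
  smul_mem' c _ hv e := (S e).smul_mem c (hv e)

/-- The isometric embedding of the flow space that maps `|e⟩` to `w₀ᵉ / ‖w₀ᵉ‖`. -/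
def flowEmbedding : EuclideanSpace ℂ G.E →ₗ[ℂ] PiLp 2 fun e => (Q e).H where
  toFun v := WithLp.toLp 2 fun e => v e • (((‖(Q e).w0‖⁻¹ : ℝ) : ℂ) • (Q e).w0)
  map_add' v w := by ext e; simp [add_smul]
  map_smul' c v := by ext e; simp [mul_smul]

theorem inner_flowEmbedding (v w : EuclideanSpace ℂ G.E) :
    inner ℂ (G.flowEmbedding Q v) (G.flowEmbedding Q w) = inner ℂ v w := by
  simp only [PiLp.inner_apply, flowEmbedding, LinearMap.coe_mk, AddHom.coe_mk, inner_smul_left,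
    inner_smul_right, inner_self_eq_norm_sq_to_K, RCLike.inner_apply, Complex.conj_ofReal]
  refine Finset.sum_congr rfl fun e _ => ?_
  have h : ((‖(Q e).w0‖ : ℝ) : ℂ) ≠ 0 := by
    exact_mod_cast norm_ne_zero_iff.2 (Q e).w0_ne
  push_cast
  simp only [Complex.coe_algebraMap]
  field_simp

/-- The graph composition of `G` with the span programs `Q e` on its edges. -/
def compose : SpanProgram.{u} D where
  H := PiLp 2 fun e => (Q e).H
  sub := fun x => G.blockSum Q fun e => (Q e).sub x
  K := (G.blockSum Q fun e => (Q e).K) ⊔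
    (G.circulationSpace (G.resistance Q)).map (G.flowEmbedding Q)
  w0 := G.flowEmbedding Q (G.flowState (G.resistance Q) (G.minFlow (G.resistance Q)))
  w0_mem := by
    rw [← Submodule.inf_orthogonal]
    refine ⟨?_, ?_⟩
    · rw [SetLike.mem_coe, Submodule.mem_orthogonal]
      intro k hk
      rw [PiLp.inner_apply]
      refine Finset.sum_eq_zero fun e _ => ?_
      have h0 : inner ℂ (k e) (Q e).w0 = 0 :=
        (Submodule.mem_orthogonal _ _).1 (Q e).w0_mem _ (hk e)
      simp [flowEmbedding, inner_smul_right, h0]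
    · rw [SetLike.mem_coe, Submodule.mem_orthogonal]
      rintro _ ⟨c, hc, rfl⟩
      rw [inner_flowEmbedding]
      exact (Submodule.mem_orthogonal _ _).1 (G.minFlow_orthogonal _) _ hc
  w0_ne := by
    intro h
    refine G.minFlow_ne_zero (G.resistance Q)
      (fun e => pow_pos (norm_pos_iff.2 (Q e).w0_ne) 2) ?_
    rw [← inner_self_eq_zero (𝕜 := ℂ), ← G.inner_flowEmbedding Q, h, inner_zero_left]

end STGraph

/-! ### Boolean formulas -/

/-- Boolean formulas over the variables `ι`, as AND-OR trees (gates of fan-in at least two)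
with negations. -/
inductive BoolFormula (ι : Type) : Type where
  | var (i : ι) : BoolFormula ι
  | not (φ : BoolFormula ι) : BoolFormula ι
  | and (k : ℕ) (φ : Fin (k + 2) → BoolFormula ι) : BoolFormula ι
  | or (k : ℕ) (φ : Fin (k + 2) → BoolFormula ι) : BoolFormula ι

namespace BoolFormula

variable {ι : Type}

def eval (x : ι → Bool) : BoolFormula ι → Bool
  | var i => x i
  | not φ => !(eval x φ)
  | and _ φ => decide (∀ i, eval x (φ i) = true)
  | or _ φ => decide (∃ i, eval x (φ i) = true)

/-- The number of occurrences of the variable `i`. -/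
def occurrences [DecidableEq ι] (i : ι) : BoolFormula ι → ℕ
  | var j => if j = i then 1 else 0
  | not φ => occurrences i φ
  | and _ φ => ∑ j, occurrences i (φ j)
  | or _ φ => ∑ j, occurrences i (φ j)

/-- Every variable appears exactly once. -/
def ReadOnce [DecidableEq ι] (φ : BoolFormula ι) : Prop := ∀ i, occurrences i φ = 1

/-- The depth of the AND-OR tree; negations are not counted. -/
def depth : BoolFormula ι → ℕ
  | var _ => 0
  | not φ => depth φ
  | and _ φ => 1 + Finset.univ.sup fun j => depth (φ j)
  | or _ φ => 1 + Finset.univ.sup fun j => depth (φ j)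

end BoolFormula

/-! ### Quantum divide and conquer -/

/-- A quantum divide and conquer strategy for the functions `f m p`, of size `m` and parameter
`p`, with `a` subproblems of sizes `size m p j` and parameters `param m p j`. The last of the
`a + 1` variables of the formula `φ m p` stands for the auxiliary function. -/
structure DivideAndConquer (a n : ℕ) (A Λ : Type*) where
  f : ℕ → Λ → (Fin n → A) → Bool
  faux : ℕ → Λ → (Fin n → A) → Bool
  size : ℕ → Λ → Fin a → ℕ
  param : ℕ → Λ → Fin a → Λ
  φ : ℕ → Λ → BoolFormula (Fin (a + 1))
  readOnce : ∀ m p, (φ m p).ReadOnce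
  m₀ : ℕ
  size_lt : ∀ m, m₀ ≤ m → ∀ p j, size m p j < m
  f_eq : ∀ m, m₀ ≤ m → ∀ p x, f m p x =
    (φ m p).eval (Fin.snoc (α := fun _ => Bool)
      (fun j => f (size m p j) (param m p j) x) (faux m p x))

namespace DivideAndConquer

variable {a n : ℕ} {A Λ : Type*} (S : DivideAndConquer a n A Λ)

/-- `m_j ∈ Θ(m/b)`, with explicit constants `c₁`, `c₂` and threshold `M`; only the sizes
`m ≥ m₀`, to which the recursion applies, are constrained. -/
def SizeTheta (b : ℕ) (c₁ c₂ : ℝ) (M : ℕ) : Prop :=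
  ∀ m, M ≤ m → S.m₀ ≤ m → ∀ p j,
    c₁ * ((m : ℝ) / b) ≤ S.size m p j ∧ (S.size m p j : ℝ) ≤ c₂ * ((m : ℝ) / b)

/-- The leaves of the fully unfolded recursion for `f m p`: base cases of size less than `m₀`, and
auxiliary functions. -/
inductive Leaf : ℕ → Λ → Type _ where
  | base {m : ℕ} {p : Λ} (h : m < S.m₀) : Leaf m p
  | aux {m : ℕ} {p : Λ} (h : S.m₀ ≤ m) : Leaf m p
  | step {m : ℕ} {p : Λ} (h : S.m₀ ≤ m) (j : Fin a) (l : Leaf (S.size m p j) (S.param m p j)) :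
      Leaf m p

/-- The given span program that belongs to a leaf. -/
def Leaf.program (P₀ Paux : ℕ → Λ → SpanProgram.{u} (Fin n → A)) :
    {m : ℕ} → {p : Λ} → S.Leaf m p → SpanProgram.{u} (Fin n → A)
  | m, p, .base _ => P₀ m p
  | m, p, .aux _ => Paux m p
  | _, _, .step _ _ l => Leaf.program P₀ Paux l

end DivideAndConquer

/-! ### Circuits with quantum read-only memory -/

namespace QROM

/-- The computational basis of `w` qubits. -/
abbrev Basis (w : ℕ) : Type := Fin w → Bool

/-- Elementary gates on `w` qubits: a unitary of the form `W ⊗ I`, where `W` acts on a set `S` of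
the qubits, and is the identity on all but at most four of the computational basis states
of those qubits. In particular, all two-qubit gates are elementary. -/
def IsElementary {w : ℕ} (U : Matrix (Basis w) (Basis w) ℂ) : Prop :=
  U ∈ Matrix.unitaryGroup (Basis w) ℂ ∧
  ∃ (S : Finset (Fin w)) (W : Matrix (S → Bool) (S → Bool) ℂ) (B : Finset (S → Bool)),
    B.card ≤ 4 ∧
    (∀ y z, y ∉ B ∨ z ∉ B → W y z = (1 : Matrix (S → Bool) (S → Bool) ℂ) y z) ∧
    ∀ y z, U y z = if ∀ i, i ∉ S → y i = z i then W (fun i => y i) (fun i => z i) else 0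

/-- The quantum read-only gate `|j⟩ ↦ (-1)^{x_j} |j⟩` for a memory `x` of `2 ^ q` bits, where the
index `j` is held in the qubits `addr 0, …, addr (q - 1)`. -/
def readGate {w q : ℕ} (x : Basis q → Bool) (addr : Fin q ↪ Fin w) :
    Matrix (Basis w) (Basis w) ℂ :=
  Matrix.diagonal fun z => if x (fun i => z (addr i)) = true then -1 else 1

/-- The isometry that sends the basis state `|e⟩` to the computational basis state `|enc e⟩`. -/
def encode {E : Type} [Fintype E] {w : ℕ} (enc : E ↪ Basis w) (ψ : EuclideanSpace ℂ E) :
    EuclideanSpace ℂ (Basis w) :=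
  WithLp.toLp 2 fun z => ∑ e, if enc e = z then ψ e else 0

/-- The operator `R` on `ℂ^E` can be implemented up to operator norm error `ε` with a read-only
memory of at most `N` bits and at most `T` gates (elementary gates and read-only gates), where
the basis states of `ℂ^E` are identified with distinct computational basis states. -/
def Implementable {E : Type} [Fintype E] (R : EuclideanSpace ℂ E → EuclideanSpace ℂ E)
    (ε N T : ℝ) : Prop :=
  ∃ (w q : ℕ) (x : Basis q → Bool) (enc : E ↪ Basis w)
    (gates : List (Matrix (Basis w) (Basis w) ℂ)),
    (2 : ℝ) ^ q ≤ N ∧ (gates.length : ℝ) ≤ T ∧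
    (∀ U ∈ gates, IsElementary U ∨ ∃ addr : Fin q ↪ Fin w, U = readGate x addr) ∧
    ∀ ψ : EuclideanSpace ℂ E,
      ‖Matrix.toEuclideanLin gates.prod (encode enc ψ) - encode enc (R ψ)‖ ≤ ε * ‖ψ‖

end QROM

end

/-! Every composition built here is series-parallel and is recorded as a binary tree (`SPTree`)
whose leaves carry positive multiples of given programs or of their negations. The tree controls
both the witness sizes and the circuit for the reflection.

Witnesses. A positive witness of a graph composition consists of a unit flow `f` and, on each edge,
a vector of the edge program that witnesses `f e` times its initial vector. A negative witness
consists of vectors on the edges, each orthogonal to `K` and `sub x`, whose inner products with the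
initial vectors are the differences of a potential that drops by one from `s` to `t`. Along the tree
both notions become recursive (`Pos`, `Neg`): a parallel node splits the flow and shares the
potential, a series node does the opposite. Negating the leaves and exchanging series and parallel
therefore exchanges positive and negative witnesses. A parallel node computes OR: a positive witness
may use one branch only, so the bound on positive witnesses is a maximum, while the bounds on
negative witnesses add. After both branches are rescaled to positive bound 1, the products of the
two bounds add (`Achievable.or`). AND follows by De Morgan duality, and a read-once formula gives
the sum over its variables (`Achievable.formula`), which is the recurrence for the squared
complexity. A gate of fan-in at most `a + 1` is replaced by a balanced binary tree, so one step of
the recursion adds at most `δ * Nat.clog 2 (a + 1)` to the depth. Since the sizes shrink by the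
factor `c₂ / b < 1` above `M`, the total depth `T` is of order `(log m / log b) * log a`.

Reflection. An edge is encoded in `T` qubits by the path to its leaf. If `φ₁` and `φ₂` are the
normalised minimal flow states of the children of a node, then for a suitable angle `θ` the vector
`(cos θ φ₁, sin θ φ₂)` is that of the node, and `(-sin θ φ₁, cos θ φ₂)` is a circulation at a
parallel node and orthogonal to all flows at a series node. Hence a product of `T` rotations, one
per qubit with angles depending on the other qubits, maps some of the basis states to vectors that
span the flow space, each of them in the circulation space or orthogonal to it. The reflection is a
diagonal sign operator conjugated by these rotations (`FlowCircuit.exists_reflection`).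

Resources. Each angle is rounded to a sum of `B` terms `± 2 ^ (-k)`. The rotation by one such term
is a fixed one-qubit rotation conjugated by a sign that is read from the memory, so `6 * T * B + 1`
gates suffice; the memory stores the signs and the diagonal. Taking `B` of order `log (T / ε)` gives
the stated bounds. They are uniform in `b`, because an integer above `c₂` stays away from `c₂`. -/

noncomputable section

/-! ### Series-parallel trees -/

/-- Binary series-parallel trees with labels at the leaves. -/
inductive SPTree (α : Type*) where
  | leaf (a : α) : SPTree α
  | par (l r : SPTree α) : SPTree α
  | ser (l r : SPTree α) : SPTree α

namespace SPTree

variable {α : Type*}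

/-- The edges of the series-parallel graph of a tree: the leaves. -/
def Edge : SPTree α → Type
  | leaf _ => Unit
  | par l r => Edge l ⊕ Edge r
  | ser l r => Edge l ⊕ Edge r

/-- The inner vertices of the series-parallel graph of a tree. -/
def Mid : SPTree α → Type
  | leaf _ => Empty
  | par l r => Mid l ⊕ Mid r
  | ser l r => Option (Mid l ⊕ Mid r)

instance instFintypeEdge : (τ : SPTree α) → Fintype τ.Edge
  | leaf _ => inferInstanceAs (Fintype Unit)
  | par l r =>
    letI := instFintypeEdge l
    letI := instFintypeEdge r
    inferInstanceAs (Fintype (l.Edge ⊕ r.Edge))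
  | ser l r =>
    letI := instFintypeEdge l
    letI := instFintypeEdge r
    inferInstanceAs (Fintype (l.Edge ⊕ r.Edge))

instance instFintypeMid : (τ : SPTree α) → Fintype τ.Mid
  | leaf _ => inferInstanceAs (Fintype Empty)
  | par l r =>
    letI := instFintypeMid l
    letI := instFintypeMid r
    inferInstanceAs (Fintype (l.Mid ⊕ r.Mid))
  | ser l r =>
    letI := instFintypeMid l
    letI := instFintypeMid r
    inferInstanceAs (Fintype (Option (l.Mid ⊕ r.Mid)))

/-- The label of an edge. -/
def label : (τ : SPTree α) → τ.Edge → α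
  | leaf a => fun _ => a
  | par l r => Sum.elim l.label r.label
  | ser l r => Sum.elim l.label r.label

/-- Tail and head of the edges, for given terminals `p`, `q` and inner vertices `m`. -/
def ends {X : Type*} : (τ : SPTree α) → (p q : X) → (m : τ.Mid → X) → τ.Edge → X × X
  | leaf _ => fun p q _ _ => (p, q)
  | par l r => fun p q m =>
    Sum.elim (l.ends p q fun i => m (Sum.inl i)) (r.ends p q fun i => m (Sum.inr i))
  | ser l r => fun p q m =>
    Sum.elim (l.ends p (m none) fun i => m (some (Sum.inl i)))
      (r.ends (m none) q fun i => m (some (Sum.inr i)))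

/-- Naturality in the vertex type. It lets one recursion serve both for the vertices of the graph
and for potentials, which are maps from the vertices to `ℂ`. -/
theorem ends_map {X Z : Type*} (φ : X → Z) (τ : SPTree α) (p q : X) (m : τ.Mid → X)
    (e : τ.Edge) :
    τ.ends (φ p) (φ q) (fun i => φ (m i)) e = Prod.map φ φ (τ.ends p q m e) := by
  induction τ generalizing p q with
  | leaf a => rfl
  | par l r hl hr => cases e with
    | inl e => exact hl p q _ e
    | inr e => exact hr p q _ e
  | ser l r hl hr => cases e with
    | inl e => exact hl p (m none) _ e
    | inr e => exact hr (m none) q _ e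

/-- Potential differences along the edges. -/
def diff (τ : SPTree α) (p q : ℂ) (m : τ.Mid → ℂ) (e : τ.Edge) : ℂ :=
  (τ.ends p q m e).1 - (τ.ends p q m e).2

theorem diff_affine (τ : SPTree α) (p q : ℂ) (e : τ.Edge) :
    τ.diff p q (fun _ => q) e = (p - q) * τ.diff 1 0 (fun _ => 0) e := by
  have h := ends_map (fun x : ℂ => (p - q) * x + q) τ 1 0 (fun _ => 0) e
  simp only [mul_one, sub_add_cancel, mul_zero, zero_add] at h
  simp only [diff, h, Prod.map_fst, Prod.map_snd]
  ring

theorem diff_const (τ : SPTree α) (q : ℂ) (e : τ.Edge) : τ.diff q q (fun _ => q) e = 0 := by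
  rw [diff_affine, sub_self, zero_mul]

/-- `f` is a flow of value `c` from the first to the second terminal. -/
def IsFlow : (τ : SPTree α) → ℂ → (τ.Edge → ℂ) → Prop
  | leaf _ => fun c f => f () = c
  | par l r => fun c f => ∃ c₁ c₂, c₁ + c₂ = c ∧ l.IsFlow c₁ (fun e => f (Sum.inl e)) ∧
      r.IsFlow c₂ (fun e => f (Sum.inr e))
  | ser l r => fun c f => l.IsFlow c (fun e => f (Sum.inl e)) ∧
      r.IsFlow c (fun e => f (Sum.inr e))

theorem sum_par {M : Type*} [AddCommMonoid M] (l r : SPTree α) (g : (par l r).Edge → M) :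
    ∑ e, g e = ∑ e, g (Sum.inl e : l.Edge ⊕ r.Edge) + ∑ e, g (Sum.inr e : l.Edge ⊕ r.Edge) :=
  Fintype.sum_sum_type (α₁ := l.Edge) (α₂ := r.Edge) g

theorem sum_ser {M : Type*} [AddCommMonoid M] (l r : SPTree α) (g : (ser l r).Edge → M) :
    ∑ e, g e = ∑ e, g (Sum.inl e : l.Edge ⊕ r.Edge) + ∑ e, g (Sum.inr e : l.Edge ⊕ r.Edge) :=
  Fintype.sum_sum_type (α₁ := l.Edge) (α₂ := r.Edge) g

theorem sum_leaf {M : Type*} [AddCommMonoid M] (a : α) (g : (leaf a).Edge → M) :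
    ∑ e, g e = g () :=
  Fintype.sum_unique (ι := Unit) g

/-- Kirchhoff's law in weak form: a flow is tested against all potentials, and for potentials on a
tree the recursion can be followed. This is the bridge between the recursive `IsFlow` and the
vertex-wise `netFlow`. -/
theorem isFlow_iff (τ : SPTree α) (c : ℂ) (f : τ.Edge → ℂ) :
    τ.IsFlow c f ↔ ∀ p q m, ∑ e, f e * τ.diff p q m e = c * (p - q) := by
  induction τ generalizing c with
  | leaf a =>
    have h : ∀ p q m, ∑ e, f e * (leaf a).diff p q m e = f () * (p - q) :=
      fun p q m => sum_leaf a _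
    simp only [h]
    exact ⟨fun h p q _ => by rw [show f () = c from h],
      fun h => (by simpa using h 1 0 (fun _ => 0) : f () = c)⟩
  | par l r hl hr =>
    have hs : ∀ p q m, ∑ e, f e * (par l r).diff p q m e =
        ∑ e, f (Sum.inl e) * l.diff p q (fun i => m (Sum.inl i)) e +
        ∑ e, f (Sum.inr e) * r.diff p q (fun i => m (Sum.inr i)) e :=
      fun p q m => sum_par l r _
    simp only [hs]
    constructor
    · rintro ⟨c₁, c₂, rfl, h₁, h₂⟩ p q m
      rw [(hl _ _).1 h₁, (hr _ _).1 h₂, add_mul]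
    · intro h
      -- The inner potentials of the two branches vary independently; freezing one of them at the
      -- constant `q` isolates the other branch.
      have hc : ∀ m₁ m₂ p q, ∑ e, f (Sum.inl e) * l.diff p q m₁ e +
          ∑ e, f (Sum.inr e) * r.diff p q m₂ e = c * (p - q) :=
        fun m₁ m₂ p q => h p q (Sum.elim m₁ m₂)
      have aff : ∀ (τ : SPTree α) (g : τ.Edge → ℂ) p q, ∑ e, g e * τ.diff p q (fun _ => q) e =
          (∑ e, g e * τ.diff 1 0 (fun _ => 0) e) * (p - q) := by
        intro τ g p q
        rw [Finset.sum_mul]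
        refine Finset.sum_congr rfl fun e _ => ?_
        rw [diff_affine τ p q]; ring
      refine ⟨∑ e, f (Sum.inl e) * l.diff 1 0 (fun _ => 0) e,
        ∑ e, f (Sum.inr e) * r.diff 1 0 (fun _ => 0) e, ?_, (hl _ _).2 ?_, (hr _ _).2 ?_⟩
      · simpa using hc (fun _ => 0) (fun _ => 0) 1 0
      · intro p q m
        have h1 := hc m (fun _ => q) p q
        have h2 := hc (fun _ => q) (fun _ => q) p q
        rw [← aff l (fun e => f (Sum.inl e))]
        exact add_right_cancel (h1.trans h2.symm)
      · intro p q m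
        have h1 := hc (fun _ => q) m p q
        have h2 := hc (fun _ => q) (fun _ => q) p q
        rw [← aff r (fun e => f (Sum.inr e))]
        exact add_left_cancel (h1.trans h2.symm)
  | ser l r hl hr =>
    have hs : ∀ p q m, ∑ e, f e * (ser l r).diff p q m e =
        ∑ e, f (Sum.inl e) * l.diff p (m none) (fun i => m (some (Sum.inl i))) e +
        ∑ e, f (Sum.inr e) * r.diff (m none) q (fun i => m (some (Sum.inr i))) e :=
      fun p q m => sum_ser l r _
    simp only [hs]
    constructor
    · rintro ⟨h₁, h₂⟩ p q m
      rw [(hl _ _).1 h₁, (hr _ _).1 h₂]; ring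
    · intro h
      have hc : ∀ m₁ m₂ p q x, ∑ e, f (Sum.inl e) * l.diff p x m₁ e +
          ∑ e, f (Sum.inr e) * r.diff x q m₂ e = c * (p - q) :=
        fun m₁ m₂ p q x => h p q (fun i => i.elim x (Sum.elim m₁ m₂))
      refine ⟨(hl _ _).2 fun p q m => ?_, (hr _ _).2 fun p q m => ?_⟩
      -- Give the middle vertex and the right part the potential `q`: then the right part
      -- contributes nothing.
      · simpa [diff_const] using hc m (fun _ => q) p q q
      · simpa [diff_const] using hc (fun _ => p) m p q p

/-- An equivalence relation that contains all edges relates all vertices. Applied to reachability,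
this is the connectedness of the graph. -/
theorem ends_related {X : Type*} (R : X → X → Prop) (hR : Equivalence R) (τ : SPTree α)
    (p q : X) (m : τ.Mid → X) (h : ∀ e, R (τ.ends p q m e).1 (τ.ends p q m e).2) :
    R p q ∧ ∀ i, R p (m i) := by
  induction τ generalizing p q with
  | leaf a => exact ⟨h (), fun i => i.elim⟩
  | par l r hl hr =>
    have h1 := hl p q _ fun e => h (Sum.inl e)
    have h2 := hr p q _ fun e => h (Sum.inr e)
    exact ⟨h1.1, fun i => i.rec h1.2 h2.2⟩
  | ser l r hl hr =>
    have h1 := hl p (m none) _ fun e => h (Sum.inl e)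
    have h2 := hr (m none) q _ fun e => h (Sum.inr e)
    refine ⟨hR.trans h1.1 h2.1, fun i => ?_⟩
    rcases i with _ | i | i
    · exact h1.1
    · exact h1.2 i
    · exact hR.trans h1.1 (h2.2 i)

open Classical in
/-- The series-parallel graph of a tree. -/
def graph (τ : SPTree α) : STGraph where
  V := Bool ⊕ τ.Mid
  E := τ.Edge
  tail e := (τ.ends (Sum.inl false) (Sum.inl true) Sum.inr e).1
  head e := (τ.ends (Sum.inl false) (Sum.inl true) Sum.inr e).2
  s := Sum.inl false
  t := Sum.inl true
  s_ne_t := by simp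
  connected := by
    set r : Bool ⊕ τ.Mid → Bool ⊕ τ.Mid → Prop := fun x y => ∃ e,
      ((τ.ends (Sum.inl false) (Sum.inl true) Sum.inr e).1 = x ∧
        (τ.ends (Sum.inl false) (Sum.inl true) Sum.inr e).2 = y) ∨
      ((τ.ends (Sum.inl false) (Sum.inl true) Sum.inr e).1 = y ∧
        (τ.ends (Sum.inl false) (Sum.inl true) Sum.inr e).2 = x) with hr
    have hsymm : Std.Symm r := ⟨fun x y ⟨e, he⟩ => ⟨e, he.symm⟩⟩
    have hR : Equivalence (Relation.ReflTransGen r) :=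
      ⟨fun _ => .refl, fun h => Std.Symm.symm _ _ h, fun h h' => h.trans h'⟩
    have h := ends_related _ hR τ (Sum.inl false) (Sum.inl true) Sum.inr
      fun e => .single ⟨e, Or.inl ⟨rfl, rfl⟩⟩
    have key : ∀ x, Relation.ReflTransGen r (Sum.inl false) x := by
      rintro ((_ | _) | i)
      · exact .refl
      · exact h.1
      · exact h.2 i
    exact fun x y => hR.trans (hR.symm (key x)) (key y)

end SPTree

/-! ### Flows tested against potentials -/

theorem STGraph.sum_mul_netFlow (G : STGraph) (f : G.E → ℂ) (φ : G.V → ℂ) :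
    ∑ x, φ x * G.netFlow f x = ∑ e, f e * (φ (G.tail e) - φ (G.head e)) := by
  simp only [netFlow, LinearMap.coe_mk, AddHom.coe_mk, mul_sub, Finset.sum_sub_distrib,
    Finset.mul_sum]
  congr 1 <;>
  · rw [Finset.sum_comm]
    refine Finset.sum_congr rfl fun e _ => ?_
    simp [mul_comm]

theorem STGraph.netFlow_eq_iff (G : STGraph) (f : G.E → ℂ) (c : ℂ) :
    G.netFlow f = c • (Pi.single G.s 1 - Pi.single G.t 1) ↔
      ∀ φ : G.V → ℂ, ∑ e, f e * (φ (G.tail e) - φ (G.head e)) = c * (φ G.s - φ G.t) := by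
  simp only [← sum_mul_netFlow]
  constructor
  · intro h φ
    rw [h]
    simp [mul_sub, Finset.sum_sub_distrib, Pi.single_apply, mul_comm]
  · intro h
    funext x
    have := h (Pi.single x 1)
    simp only [Pi.single_apply, ite_mul, one_mul, zero_mul, Finset.sum_ite_eq',
      Finset.mem_univ, if_true] at this
    rw [this]
    simp [Pi.single_apply, eq_comm]

namespace SPTree

variable {α : Type*}

theorem netFlow_graph_iff (τ : SPTree α) (c : ℂ) (f : τ.Edge → ℂ) :
    τ.graph.netFlow f = c • (Pi.single τ.graph.s 1 - Pi.single τ.graph.t 1) ↔ τ.IsFlow c f := by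
  refine (STGraph.netFlow_eq_iff τ.graph f c).trans (Iff.trans ?_ (isFlow_iff τ c f).symm)
  have key : ∀ (φ : Bool ⊕ τ.Mid → ℂ) (e : τ.Edge),
      φ (τ.ends (Sum.inl false) (Sum.inl true) Sum.inr e).1 -
        φ (τ.ends (Sum.inl false) (Sum.inl true) Sum.inr e).2 =
      τ.diff (φ (Sum.inl false)) (φ (Sum.inl true)) (fun i => φ (Sum.inr i)) e := by
    intro φ e
    rw [diff, ends_map φ]
    rfl
  constructor
  · intro h p q m
    have := h (Sum.elim (fun b => cond b q p) m : Bool ⊕ τ.Mid → ℂ)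
    refine Eq.trans (Finset.sum_congr rfl fun e _ => ?_) this
    exact congrArg _ (key (Sum.elim (fun b => cond b q p) m) e).symm
  · intro h φ
    refine Eq.trans (Finset.sum_congr rfl fun e _ => ?_)
      (h (φ (Sum.inl false)) (φ (Sum.inl true)) fun i => φ (Sum.inr i))
    exact congrArg _ (key φ e)

theorem mem_unitFlows_graph (τ : SPTree α) (f : τ.Edge → ℂ) :
    f ∈ τ.graph.unitFlows ↔ τ.IsFlow 1 f := by
  rw [← netFlow_graph_iff, one_smul]; rfl

theorem mem_ker_netFlow_graph (τ : SPTree α) (f : τ.Edge → ℂ) :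
    f ∈ LinearMap.ker τ.graph.netFlow ↔ τ.IsFlow 0 f := by
  rw [← netFlow_graph_iff, zero_smul]; rfl

end SPTree

/-! ### Witnesses of graph compositions -/

namespace STGraph

variable {D : Type v} (G : STGraph) (Q : G.E → SpanProgram.{u} D)

theorem mem_orthogonal_blockSum {S : ∀ e, Submodule ℂ (Q e).H} {w : PiLp 2 fun e => (Q e).H} :
    w ∈ (G.blockSum Q S)ᗮ ↔ ∀ e, w e ∈ (S e)ᗮ := by
  classical
  constructor
  · intro h e
    rw [Submodule.mem_orthogonal]
    intro u hu
    have h1 : WithLp.toLp 2 (Pi.single e u) ∈ G.blockSum Q S := by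
      intro e'
      by_cases he : e' = e
      · subst he; simpa using hu
      · simp [he]
    have h2 := (Submodule.mem_orthogonal _ _).1 h _ h1
    rw [PiLp.inner_apply, Finset.sum_eq_single e] at h2
    · simpa using h2
    · intro e' _ he; simp [he]
    · simp
  · intro h
    rw [Submodule.mem_orthogonal]
    intro u hu
    rw [PiLp.inner_apply]
    exact Finset.sum_eq_zero fun e _ => (Submodule.mem_orthogonal _ _).1 (h e) _ (hu e)

theorem flowEmbedding_flowState (f : G.E → ℂ) (e : G.E) :
    G.flowEmbedding Q (G.flowState (G.resistance Q) f) e = f e • (Q e).w0 := by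
  have h : ((‖(Q e).w0‖ : ℝ) : ℂ) ≠ 0 := by exact_mod_cast norm_ne_zero_iff.2 (Q e).w0_ne
  have h2 : Real.sqrt (G.resistance Q e) = ‖(Q e).w0‖ := Real.sqrt_sq (norm_nonneg _)
  simp only [flowEmbedding, flowState, LinearMap.coe_mk, AddHom.coe_mk, h2, smul_smul]
  congr 1
  push_cast
  field_simp

/-- The minimal flow plus a circulation is an arbitrary unit flow, so the condition modulo `K` of
the composition decouples into one condition per edge once the flow is fixed. Minimality plays no
role for the set of witnesses. -/
theorem mem_posWitnesses_compose {x : D} {w : PiLp 2 fun e => (Q e).H} :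
    w ∈ (G.compose Q).posWitnesses x ↔ (∀ e, w e ∈ (Q e).sub x) ∧
      ∃ f ∈ G.unitFlows, ∀ e, w e - f e • (Q e).w0 ∈ (Q e).K := by
  have hm := (G.minFlow_isMinFlow (G.resistance Q)).1
  refine and_congr Iff.rfl ?_
  change w - G.flowEmbedding Q (G.flowState (G.resistance Q) (G.minFlow (G.resistance Q))) ∈
    (G.blockSum Q fun e => (Q e).K) ⊔
    (G.circulationSpace (G.resistance Q)).map (G.flowEmbedding Q) ↔ _
  rw [Submodule.mem_sup]
  constructor
  · rintro ⟨k, hk, _, ⟨_, ⟨c, hc, rfl⟩, rfl⟩, h⟩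
    refine ⟨G.minFlow (G.resistance Q) + c, ?_, fun e => ?_⟩
    · change G.netFlow _ = _
      rw [map_add, LinearMap.mem_ker.1 hc, add_zero]
      exact hm
    · have he := congrArg (fun v : PiLp 2 fun e => (Q e).H => v e) h
      simp only [PiLp.add_apply, PiLp.sub_apply, flowEmbedding_flowState] at he
      have : w e - (G.minFlow (G.resistance Q) + c) e • (Q e).w0 = k e := by
        rw [Pi.add_apply, add_smul, ← sub_sub, ← he, add_sub_cancel_right]
      rw [this]
      exact hk e
  · rintro ⟨f, hf, h⟩
    refine ⟨w - G.flowEmbedding Q (G.flowState (G.resistance Q) f), fun e => ?_,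
      G.flowEmbedding Q (G.flowState (G.resistance Q) (f - G.minFlow (G.resistance Q))),
      ⟨_, ⟨_, ?_, rfl⟩, rfl⟩, ?_⟩
    · rw [PiLp.sub_apply, flowEmbedding_flowState]
      exact h e
    · change G.netFlow _ = _
      rw [map_sub, show G.netFlow f = _ from hf, show G.netFlow _ = _ from hm, sub_self]
    · rw [map_sub, map_sub]; abel

/-- Orthogonality to the embedded circulations together with inner product 1 with the minimal flow
means taking the value 1 on every unit flow, as unit flows differ by circulations. -/
theorem mem_negWitnesses_compose {x : D} {w : PiLp 2 fun e => (Q e).H} :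
    w ∈ (G.compose Q).negWitnesses x ↔
      (∀ e, w e ∈ (Q e).Kᗮ ∧ w e ∈ ((Q e).sub x)ᗮ) ∧
      (∀ f ∈ LinearMap.ker G.netFlow, ∑ e, f e * inner ℂ (w e) (Q e).w0 = 0) ∧
      ∀ f ∈ G.unitFlows, ∑ e, f e * inner ℂ (w e) (Q e).w0 = 1 := by
  have hm := (G.minFlow_isMinFlow (G.resistance Q)).1
  have hin : ∀ f, inner ℂ w (G.flowEmbedding Q (G.flowState (G.resistance Q) f)) =
      ∑ e, f e * inner ℂ (w e) (Q e).w0 := by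
    intro f
    rw [PiLp.inner_apply]
    exact Finset.sum_congr rfl fun e _ => by rw [flowEmbedding_flowState, inner_smul_right]
  have hK : w ∈ (G.compose Q).Kᗮ ↔ (∀ e, w e ∈ (Q e).Kᗮ) ∧
      ∀ f ∈ LinearMap.ker G.netFlow, ∑ e, f e * inner ℂ (w e) (Q e).w0 = 0 := by
    change w ∈ ((G.blockSum Q fun e => (Q e).K) ⊔
      (G.circulationSpace (G.resistance Q)).map (G.flowEmbedding Q))ᗮ ↔ _
    rw [← Submodule.inf_orthogonal, Submodule.mem_inf, mem_orthogonal_blockSum]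
    refine and_congr Iff.rfl ?_
    rw [Submodule.mem_orthogonal']
    constructor
    · intro h f hf
      rw [← hin]
      exact h _ ⟨_, ⟨f, hf, rfl⟩, rfl⟩
    · rintro h _ ⟨_, ⟨f, hf, rfl⟩, rfl⟩
      rw [hin]
      exact h f hf
  have hsub : w ∈ ((G.compose Q).sub x)ᗮ ↔ ∀ e, w e ∈ ((Q e).sub x)ᗮ :=
    G.mem_orthogonal_blockSum Q
  change w ∈ (G.compose Q).Kᗮ ∧ w ∈ ((G.compose Q).sub x)ᗮ ∧
    inner ℂ w (G.flowEmbedding Q (G.flowState (G.resistance Q)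
      (G.minFlow (G.resistance Q)))) = 1 ↔ _
  rw [hK, hsub, hin]
  constructor
  · rintro ⟨⟨h1, h2⟩, h3, h4⟩
    refine ⟨fun e => ⟨h1 e, h3 e⟩, h2, fun f hf => ?_⟩
    have h5 := h2 (f - G.minFlow (G.resistance Q)) (by
      change G.netFlow _ = _
      rw [map_sub, show G.netFlow f = _ from hf, show G.netFlow _ = _ from hm, sub_self])
    simp only [Pi.sub_apply, sub_mul, Finset.sum_sub_distrib, h4] at h5
    exact sub_eq_zero.1 h5
  · rintro ⟨h1, h2, h3⟩
    exact ⟨⟨fun e => (h1 e).1, h2⟩, fun e => (h1 e).2, h3 _ hm⟩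

end STGraph

/-! ### Witnesses of series-parallel compositions -/

namespace SPTree

variable {α : Type*} {D : Type v}

/-- `d` gives the potential differences along the edges of a potential that drops by `c` between
the terminals. -/
def IsPot : (τ : SPTree α) → ℂ → (τ.Edge → ℂ) → Prop
  | leaf _ => fun c d => d () = c
  | par l r => fun c d => l.IsPot c (fun e => d (Sum.inl e)) ∧ r.IsPot c (fun e => d (Sum.inr e))
  | ser l r => fun c d => ∃ c₁ c₂, c₁ + c₂ = c ∧ l.IsPot c₁ (fun e => d (Sum.inl e)) ∧
      r.IsPot c₂ (fun e => d (Sum.inr e))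

theorem IsPot.sum_flow {τ : SPTree α} {v c : ℂ} {d f : τ.Edge → ℂ} (hd : τ.IsPot v d)
    (hf : τ.IsFlow c f) : ∑ e, f e * d e = c * v := by
  induction τ generalizing v c with
  | leaf a =>
    rw [sum_leaf, show d () = v from hd, show f () = c from hf]
  | par l r hl hr =>
    obtain ⟨c₁, c₂, rfl, h1, h2⟩ := hf
    rw [sum_par, hl hd.1 h1, hr hd.2 h2, add_mul]
  | ser l r hl hr =>
    obtain ⟨v₁, v₂, rfl, h1, h2⟩ := hd
    rw [sum_ser, hl h1 hf.1, hr h2 hf.2, mul_add]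

theorem exists_isFlow (τ : SPTree α) (c : ℂ) : ∃ f, τ.IsFlow c f := by
  induction τ generalizing c with
  | leaf a => exact ⟨fun _ => c, rfl⟩
  | par l r hl hr =>
    obtain ⟨f, hf⟩ := hl c
    obtain ⟨g, hg⟩ := hr 0
    exact ⟨Sum.elim f g, c, 0, add_zero c, hf, hg⟩
  | ser l r hl hr =>
    obtain ⟨f, hf⟩ := hl c
    obtain ⟨g, hg⟩ := hr c
    exact ⟨Sum.elim f g, hf, hg⟩

theorem isFlow_zero (τ : SPTree α) : τ.IsFlow 0 fun _ => 0 := by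
  simp [isFlow_iff]

/-- Converse of `IsPot.sum_flow`: a functional on flows that depends on the flow value only comes
from a potential. At a series node the drop across each part is read off from one fixed unit flow
through that part. -/
theorem isPot_of_forall_flow {τ : SPTree α} {v : ℂ} {d : τ.Edge → ℂ}
    (h : ∀ c f, τ.IsFlow c f → ∑ e, f e * d e = c * v) : τ.IsPot v d := by
  induction τ generalizing v with
  | leaf a =>
    have := h 1 (fun _ => 1) rfl
    rw [sum_leaf] at this
    exact (by simpa using this : d () = v)
  | par l r hl hr =>
    refine ⟨hl fun c f hf => ?_, hr fun c f hf => ?_⟩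
    · have h1 := h c (Sum.elim f fun _ => 0) ⟨c, 0, add_zero c, hf, r.isFlow_zero⟩
      rw [sum_par] at h1
      simpa using h1
    · have h1 := h c (Sum.elim (fun _ => 0) f) ⟨0, c, zero_add c, l.isFlow_zero, hf⟩
      rw [sum_par] at h1
      simpa using h1
  | ser l r hl hr =>
    have hs : ∀ c f g, l.IsFlow c f → r.IsFlow c g →
        ∑ e, f e * d (Sum.inl e) + ∑ e, g e * d (Sum.inr e) = c * v := by
      intro c f g hf hg
      have h1 := h c (Sum.elim f g) ⟨hf, hg⟩
      rwa [sum_ser] at h1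
    have hsmul : ∀ (τ : SPTree α) (c : ℂ) (f : τ.Edge → ℂ), τ.IsFlow 1 f →
        τ.IsFlow c (fun e => c * f e) := by
      intro τ c f hf
      rw [isFlow_iff] at hf ⊢
      intro p q m
      simp only [mul_assoc, ← Finset.mul_sum, hf p q m, one_mul]
    obtain ⟨f₁, hf₁⟩ := l.exists_isFlow 1
    obtain ⟨g₁, hg₁⟩ := r.exists_isFlow 1
    refine ⟨∑ e, f₁ e * d (Sum.inl e), ∑ e, g₁ e * d (Sum.inr e), ?_, hl fun c f hf => ?_,
      hr fun c g hg => ?_⟩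
    · rw [hs 1 f₁ g₁ hf₁ hg₁, one_mul]
    · have h1 := hs c f _ hf (hsmul r c g₁ hg₁)
      have h2 := hs c _ _ (hsmul l c f₁ hf₁) (hsmul r c g₁ hg₁)
      rw [Finset.mul_sum]
      simp only [← mul_assoc]
      exact add_right_cancel (h1.trans h2.symm)
    · have h1 := hs c _ g (hsmul l c f₁ hf₁) hg
      have h2 := hs c _ _ (hsmul l c f₁ hf₁) (hsmul r c g₁ hg₁)
      rw [Finset.mul_sum]
      simp only [← mul_assoc]
      exact add_left_cancel (h1.trans h2.symm)

variable (P : α → SpanProgram.{u} D) (x : D)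

/-- There is a positive witness, of flow value `c` and norm squared `B`, for the series-parallel
composition of the programs at the leaves. -/
def Pos : (τ : SPTree α) → ℂ → ℝ → Prop
  | leaf a => fun c B => ∃ w ∈ (P a).sub x, w - c • (P a).w0 ∈ (P a).K ∧ ‖w‖ ^ 2 = B
  | par l r => fun c B => ∃ c₁ c₂ B₁ B₂, c₁ + c₂ = c ∧ B₁ + B₂ = B ∧ Pos l c₁ B₁ ∧ Pos r c₂ B₂
  | ser l r => fun c B => ∃ B₁ B₂, B₁ + B₂ = B ∧ Pos l c B₁ ∧ Pos r c B₂

/-- There is a negative witness, of potential difference `c` and norm squared `B`, for the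
series-parallel composition of the programs at the leaves. -/
def Neg : (τ : SPTree α) → ℂ → ℝ → Prop
  | leaf a => fun c B => ∃ w ∈ (P a).Kᗮ, w ∈ ((P a).sub x)ᗮ ∧ inner ℂ w (P a).w0 = c ∧
      ‖w‖ ^ 2 = B
  | par l r => fun c B => ∃ B₁ B₂, B₁ + B₂ = B ∧ Neg l c B₁ ∧ Neg r c B₂
  | ser l r => fun c B => ∃ c₁ c₂ B₁ B₂, c₁ + c₂ = c ∧ B₁ + B₂ = B ∧ Neg l c₁ B₁ ∧ Neg r c₂ B₂

theorem pos_iff (τ : SPTree α) (c : ℂ) (B : ℝ) :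
    τ.Pos P x c B ↔ ∃ f, τ.IsFlow c f ∧ ∃ w : ∀ e, (P (τ.label e)).H,
      (∀ e, w e ∈ (P (τ.label e)).sub x) ∧
      (∀ e, w e - f e • (P (τ.label e)).w0 ∈ (P (τ.label e)).K) ∧ ∑ e, ‖w e‖ ^ 2 = B := by
  induction τ generalizing c B with
  | leaf a =>
    constructor
    · rintro ⟨w, h1, h2, h3⟩
      exact ⟨fun _ => c, rfl, fun _ => w, fun _ => h1, fun _ => h2, (sum_leaf a _).trans h3⟩
    · rintro ⟨f, hf, w, h1, h2, h3⟩
      refine ⟨w (), h1 (), ?_, (sum_leaf a (fun e => ‖w e‖ ^ 2)).symm.trans h3⟩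
      have : f () = c := hf
      rw [← this]
      exact h2 ()
  | par l r hl hr =>
    constructor
    · rintro ⟨c₁, c₂, B₁, B₂, hc, hB, h1, h2⟩
      obtain ⟨f, hf, w, hw, hw', hwB⟩ := (hl _ _).1 h1
      obtain ⟨g, hg, v, hv, hv', hvB⟩ := (hr _ _).1 h2
      refine ⟨Sum.elim f g, ⟨c₁, c₂, hc, hf, hg⟩, fun e => Sum.rec w v e, ?_, ?_, ?_⟩
      · rintro (e | e)
        exacts [hw e, hv e]
      · rintro (e | e)
        exacts [hw' e, hv' e]
      · rw [sum_par, ← hB, ← hwB, ← hvB]; rfl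
    · rintro ⟨f, ⟨c₁, c₂, hc, hf, hg⟩, w, hw, hw', hwB⟩
      rw [sum_par] at hwB
      exact ⟨c₁, c₂, _, _, hc, hwB,
        (hl _ _).2 ⟨_, hf, fun e => w (Sum.inl e), fun e => hw (Sum.inl e),
          fun e => hw' (Sum.inl e), rfl⟩,
        (hr _ _).2 ⟨_, hg, fun e => w (Sum.inr e), fun e => hw (Sum.inr e),
          fun e => hw' (Sum.inr e), rfl⟩⟩
  | ser l r hl hr =>
    constructor
    · rintro ⟨B₁, B₂, hB, h1, h2⟩
      obtain ⟨f, hf, w, hw, hw', hwB⟩ := (hl _ _).1 h1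
      obtain ⟨g, hg, v, hv, hv', hvB⟩ := (hr _ _).1 h2
      refine ⟨Sum.elim f g, ⟨hf, hg⟩, fun e => Sum.rec w v e, ?_, ?_, ?_⟩
      · rintro (e | e)
        exacts [hw e, hv e]
      · rintro (e | e)
        exacts [hw' e, hv' e]
      · rw [sum_ser, ← hB, ← hwB, ← hvB]; rfl
    · rintro ⟨f, ⟨hf, hg⟩, w, hw, hw', hwB⟩
      rw [sum_ser] at hwB
      exact ⟨_, _, hwB,
        (hl _ _).2 ⟨_, hf, fun e => w (Sum.inl e), fun e => hw (Sum.inl e),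
          fun e => hw' (Sum.inl e), rfl⟩,
        (hr _ _).2 ⟨_, hg, fun e => w (Sum.inr e), fun e => hw (Sum.inr e),
          fun e => hw' (Sum.inr e), rfl⟩⟩

theorem neg_iff (τ : SPTree α) (c : ℂ) (B : ℝ) :
    τ.Neg P x c B ↔ ∃ w : ∀ e, (P (τ.label e)).H,
      (∀ e, w e ∈ (P (τ.label e)).Kᗮ ∧ w e ∈ ((P (τ.label e)).sub x)ᗮ) ∧
      τ.IsPot c (fun e => inner ℂ (w e) (P (τ.label e)).w0) ∧ ∑ e, ‖w e‖ ^ 2 = B := by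
  induction τ generalizing c B with
  | leaf a =>
    constructor
    · rintro ⟨w, h1, h2, h3, h4⟩
      exact ⟨fun _ => w, fun _ => ⟨h1, h2⟩, h3, (sum_leaf a _).trans h4⟩
    · rintro ⟨w, h1, h2, h3⟩
      exact ⟨w (), (h1 ()).1, (h1 ()).2, h2, (sum_leaf a (fun e => ‖w e‖ ^ 2)).symm.trans h3⟩
  | par l r hl hr =>
    constructor
    · rintro ⟨B₁, B₂, hB, h1, h2⟩
      obtain ⟨w, hw, hw', hwB⟩ := (hl _ _).1 h1
      obtain ⟨v, hv, hv', hvB⟩ := (hr _ _).1 h2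
      refine ⟨fun e => Sum.rec w v e, ?_, ⟨hw', hv'⟩, ?_⟩
      · rintro (e | e)
        exacts [hw e, hv e]
      · rw [sum_par, ← hB, ← hwB, ← hvB]; rfl
    · rintro ⟨w, hw, ⟨hf, hg⟩, hwB⟩
      rw [sum_par] at hwB
      exact ⟨_, _, hwB,
        (hl _ _).2 ⟨fun e => w (Sum.inl e), fun e => hw (Sum.inl e), hf, rfl⟩,
        (hr _ _).2 ⟨fun e => w (Sum.inr e), fun e => hw (Sum.inr e), hg, rfl⟩⟩
  | ser l r hl hr =>
    constructor
    · rintro ⟨c₁, c₂, B₁, B₂, hc, hB, h1, h2⟩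
      obtain ⟨w, hw, hw', hwB⟩ := (hl _ _).1 h1
      obtain ⟨v, hv, hv', hvB⟩ := (hr _ _).1 h2
      refine ⟨fun e => Sum.rec w v e, ?_, ⟨c₁, c₂, hc, hw', hv'⟩, ?_⟩
      · rintro (e | e)
        exacts [hw e, hv e]
      · rw [sum_ser, ← hB, ← hwB, ← hvB]; rfl
    · rintro ⟨w, hw, ⟨c₁, c₂, hc, hf, hg⟩, hwB⟩
      rw [sum_ser] at hwB
      exact ⟨c₁, c₂, _, _, hc, hwB,
        (hl _ _).2 ⟨fun e => w (Sum.inl e), fun e => hw (Sum.inl e), hf, rfl⟩,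
        (hr _ _).2 ⟨fun e => w (Sum.inr e), fun e => hw (Sum.inr e), hg, rfl⟩⟩

/-- The series-parallel composition of the programs at the leaves. -/
def program (τ : SPTree α) : SpanProgram.{u} D :=
  τ.graph.compose fun e => P (τ.label e)

theorem pos_one_iff (τ : SPTree α) (B : ℝ) :
    τ.Pos P x 1 B ↔ ∃ w ∈ (τ.program P).posWitnesses x, ‖w‖ ^ 2 = B := by
  rw [pos_iff]
  have hn : ∀ w : PiLp 2 fun e => (P (τ.label e)).H, ‖w‖ ^ 2 = ∑ e, ‖w e‖ ^ 2 :=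
    fun w => PiLp.norm_sq_eq_of_L2 _ w
  constructor
  · rintro ⟨f, hf, w, h1, h2, h3⟩
    exact ⟨(WithLp.toLp 2 w : PiLp 2 fun e => (P (τ.label e)).H),
      (τ.graph.mem_posWitnesses_compose _).2 ⟨h1, f, (mem_unitFlows_graph τ f).2 hf, h2⟩,
      (hn _).trans h3⟩
  · rintro ⟨w, hw, h3⟩
    obtain ⟨h1, f, hf, h2⟩ := (τ.graph.mem_posWitnesses_compose _).1 hw
    exact ⟨f, (mem_unitFlows_graph τ f).1 hf,
      fun e => (show PiLp 2 fun e => (P (τ.label e)).H from w) e, h1, h2, (hn _).symm.trans h3⟩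

theorem neg_one_iff (τ : SPTree α) (B : ℝ) :
    τ.Neg P x 1 B ↔ ∃ w ∈ (τ.program P).negWitnesses x, ‖w‖ ^ 2 = B := by
  rw [neg_iff]
  have hn : ∀ w : PiLp 2 fun e => (P (τ.label e)).H, ‖w‖ ^ 2 = ∑ e, ‖w e‖ ^ 2 :=
    fun w => PiLp.norm_sq_eq_of_L2 _ w
  constructor
  · rintro ⟨w, h1, h2, h3⟩
    refine ⟨(WithLp.toLp 2 w : PiLp 2 fun e => (P (τ.label e)).H),
      (τ.graph.mem_negWitnesses_compose _).2 ⟨h1, fun f hf => ?_, fun f hf => ?_⟩,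
      (hn _).trans h3⟩
    · exact (h2.sum_flow ((mem_ker_netFlow_graph τ f).1 hf)).trans (zero_mul 1)
    · exact (h2.sum_flow ((mem_unitFlows_graph τ f).1 hf)).trans (one_mul 1)
  · rintro ⟨w, hw, h3⟩
    obtain ⟨h1, h2, h4⟩ := (τ.graph.mem_negWitnesses_compose _).1 hw
    refine ⟨fun e => (show PiLp 2 fun e => (P (τ.label e)).H from w) e, h1,
      isPot_of_forall_flow fun c f hf => ?_, (hn _).symm.trans h3⟩
    obtain ⟨g, hg⟩ := τ.exists_isFlow 1
    -- Subtracting `c` times a unit flow turns a flow of value `c` into a circulation, so the two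
    -- conditions on a negative witness cover all flow values.
    have hk : τ.IsFlow 0 (fun e => f e - c * g e) := by
      rw [isFlow_iff] at hf hg ⊢
      intro p q m
      simp only [sub_mul, mul_assoc, Finset.sum_sub_distrib, ← Finset.mul_sum, hf p q m, hg p q m]
      ring
    have e1 := h2 _ ((mem_ker_netFlow_graph τ _).2 hk)
    have e2 := h4 _ ((mem_unitFlows_graph τ _).2 hg)
    simp only [sub_mul, mul_assoc, Finset.sum_sub_distrib, ← Finset.mul_sum] at e1
    rw [mul_one]
    refine (sub_eq_zero.1 e1).trans ?_
    exact (congrArg (c * ·) e2).trans (mul_one c)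

end SPTree

/-! ### Witness bounds and complexity of span programs -/

namespace SpanProgram

variable {D : Type v} (P : SpanProgram.{u} D) {x : D}

theorem isPositive_iff : P.IsPositive x ↔ (P.posWitnesses x).Nonempty := by
  rw [IsPositive, Submodule.mem_sup]
  constructor
  · rintro ⟨k, hk, w, hw, h⟩
    exact ⟨w, hw, by rw [← h, sub_add_cancel_right]; exact P.K.neg_mem hk⟩
  · rintro ⟨w, hw, h⟩
    exact ⟨P.w0 - w, by rw [← neg_sub]; exact P.K.neg_mem h, w, hw, sub_add_cancel _ _⟩

/-- The component of `w0` orthogonal to `K ⊔ sub x` is nonzero on a negative input; rescaled, it is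
a witness. -/
theorem negWitnesses_nonempty (h : ¬ P.IsPositive x) : (P.negWitnesses x).Nonempty := by
  obtain ⟨y, hy, z, hz, h0⟩ := (P.K ⊔ P.sub x).exists_add_mem_mem_orthogonal P.w0
  have hz0 : z ≠ 0 := by
    rintro rfl
    rw [add_zero] at h0
    exact h (by rw [IsPositive, h0]; exact hy)
  have hzz : inner ℂ z P.w0 = ((‖z‖ ^ 2 : ℝ) : ℂ) := by
    rw [h0, inner_add_right, (Submodule.mem_orthogonal' _ _).1 hz _ hy, zero_add,
      inner_self_eq_norm_sq_to_K]
    push_cast; rfl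
  have hne : ((‖z‖ ^ 2 : ℝ) : ℂ) ≠ 0 := by
    exact_mod_cast pow_ne_zero 2 (norm_ne_zero_iff.2 hz0)
  rw [← Submodule.inf_orthogonal] at hz
  refine ⟨(((‖z‖ ^ 2)⁻¹ : ℝ) : ℂ) • z, Submodule.smul_mem _ _ hz.1, Submodule.smul_mem _ _ hz.2, ?_⟩
  rw [inner_smul_left, hzz, Complex.conj_ofReal, Complex.ofReal_inv, inv_mul_cancel₀ hne]

theorem not_isPositive_of_negWitness {w : P.H} (hw : w ∈ P.negWitnesses x) :
    ¬ P.IsPositive x := by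
  rw [isPositive_iff]
  rintro ⟨v, hv, hvK⟩
  have h1 := (Submodule.mem_orthogonal' _ _).1 hw.1 _ hvK
  rw [inner_sub_right, (Submodule.mem_orthogonal' _ _).1 hw.2.1 _ hv, hw.2.2] at h1
  norm_num at h1

theorem exists_norm_min {E : Type*} [NormedAddCommGroup E] [ProperSpace E] {s : Set E}
    (hs : IsClosed s) (hne : s.Nonempty) : ∃ w ∈ s, ∀ v ∈ s, ‖w‖ ≤ ‖v‖ := by
  obtain ⟨w, hw, h⟩ := hs.exists_infDist_eq_dist hne 0
  refine ⟨w, hw, fun v hv => ?_⟩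
  have := Metric.infDist_le_dist_of_mem (x := 0) hv
  rw [h] at this
  simpa using this

theorem isClosed_posWitnesses : IsClosed (P.posWitnesses x) := by
  have h1 : IsClosed (P.sub x : Set P.H) := Submodule.closed_of_finiteDimensional _
  have h2 : IsClosed (P.K : Set P.H) := Submodule.closed_of_finiteDimensional _
  exact h1.inter (h2.preimage (continuous_id.sub continuous_const))

theorem isClosed_negWitnesses : IsClosed (P.negWitnesses x) := by
  have h1 : IsClosed (P.Kᗮ : Set P.H) := Submodule.closed_of_finiteDimensional _
  have h2 : IsClosed ((P.sub x)ᗮ : Set P.H) := Submodule.closed_of_finiteDimensional _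
  exact h1.inter (h2.inter (isClosed_singleton.preimage
    (continuous_id.inner continuous_const : Continuous fun w => inner ℂ w P.w0)))

theorem complexity_sq : P.complexity ^ 2 = P.posComplexity * P.negComplexity := by
  rw [complexity, ← ENNReal.rpow_natCast, ← ENNReal.rpow_mul]
  norm_num

/-- Replaces the extended-real complexities by real witness bounds whose product is exactly the
squared complexity. The minima over the closed witness sets are attained, and finiteness of `D`
makes the maxima finite. -/
theorem exists_bounds [Finite D] : ∃ p q : ℝ, 0 ≤ p ∧ 0 ≤ q ∧
    (∀ x, P.IsPositive x → ∃ w ∈ P.posWitnesses x, ‖w‖ ^ 2 ≤ p) ∧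
    (∀ x, ¬ P.IsPositive x → ∃ w ∈ P.negWitnesses x, ‖w‖ ^ 2 ≤ q) ∧
    P.complexity ^ 2 = ENNReal.ofReal (p * q) := by
  have := FiniteDimensional.proper ℂ P.H
  have key : ∀ s : Set P.H, IsClosed s → s.Nonempty → ∃ w ∈ s,
      ⨅ v ∈ s, ENNReal.ofReal (‖v‖ ^ 2) = ENNReal.ofReal (‖w‖ ^ 2) := by
    intro s hs hne
    obtain ⟨w, hw, h⟩ := exists_norm_min hs hne
    refine ⟨w, hw, le_antisymm (iInf₂_le w hw) (le_iInf₂ fun v hv => ?_)⟩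
    exact ENNReal.ofReal_le_ofReal (pow_le_pow_left₀ (norm_nonneg _) (h v hv) 2)
  have hp : ∀ x, P.IsPositive x → ∃ w ∈ P.posWitnesses x,
      P.posComplexityAt x = ENNReal.ofReal (‖w‖ ^ 2) := fun x hx =>
    key _ P.isClosed_posWitnesses (P.isPositive_iff.1 hx)
  have hn : ∀ x, ¬ P.IsPositive x → ∃ w ∈ P.negWitnesses x,
      P.negComplexityAt x = ENNReal.ofReal (‖w‖ ^ 2) := fun x hx =>
    key _ P.isClosed_negWitnesses (P.negWitnesses_nonempty hx)
  have hfin : ∀ g : D → ℝ≥0∞, (∀ x, g x < ⊤) → ⨆ x, g x < ⊤ := by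
    intro g hg
    have := Fintype.ofFinite D
    rw [← Finset.sup_univ_eq_iSup, Finset.sup_lt_iff ENNReal.zero_lt_top]
    exact fun x _ => hg x
  have hpt : P.posComplexity ≠ ⊤ := by
    refine (hfin _ fun x => ?_).ne
    refine iSup_lt_iff.2 ?_
    by_cases hx : P.IsPositive x
    · obtain ⟨w, -, h⟩ := hp x hx
      exact ⟨_, by rw [h]; exact ENNReal.ofReal_lt_top, fun _ => le_rfl⟩
    · exact ⟨0, ENNReal.zero_lt_top, fun h => (hx h).elim⟩
  have hnt : P.negComplexity ≠ ⊤ := by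
    refine (hfin _ fun x => ?_).ne
    refine iSup_lt_iff.2 ?_
    by_cases hx : ¬ P.IsPositive x
    · obtain ⟨w, -, h⟩ := hn x hx
      exact ⟨_, by rw [h]; exact ENNReal.ofReal_lt_top, fun _ => le_rfl⟩
    · exact ⟨0, ENNReal.zero_lt_top, fun h => (hx h).elim⟩
  refine ⟨P.posComplexity.toReal, P.negComplexity.toReal, ENNReal.toReal_nonneg,
    ENNReal.toReal_nonneg, fun x hx => ?_, fun x hx => ?_, ?_⟩
  · obtain ⟨w, hw, h⟩ := hp x hx
    refine ⟨w, hw, (ENNReal.ofReal_le_iff_le_toReal hpt).1 ?_⟩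
    rw [← h]
    exact le_iSup₂ (f := fun x (_ : P.IsPositive x) => P.posComplexityAt x) x hx
  · obtain ⟨w, hw, h⟩ := hn x hx
    refine ⟨w, hw, (ENNReal.ofReal_le_iff_le_toReal hnt).1 ?_⟩
    rw [← h]
    exact le_iSup₂ (f := fun x (_ : ¬ P.IsPositive x) => P.negComplexityAt x) x hx
  · rw [complexity_sq, ENNReal.ofReal_mul ENNReal.toReal_nonneg, ENNReal.ofReal_toReal hpt,
      ENNReal.ofReal_toReal hnt]

/-- A negative witness excludes positivity, so exhibiting witnesses on both sides already proves
correctness as well as the bound. -/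
theorem computes_and_complexity_le {f : D → Bool} {p q : ℝ} (hp0 : 0 ≤ p)
    (hp : ∀ x, f x = true → ∃ w ∈ P.posWitnesses x, ‖w‖ ^ 2 ≤ p)
    (hq : ∀ x, f x = false → ∃ w ∈ P.negWitnesses x, ‖w‖ ^ 2 ≤ q) :
    P.Computes f ∧ P.complexity ^ 2 ≤ ENNReal.ofReal (p * q) := by
  have hc : P.Computes f := by
    intro x
    constructor
    · intro hx
      obtain ⟨w, hw, -⟩ := hp x hx
      exact P.isPositive_iff.2 ⟨w, hw⟩
    · intro hx
      by_contra hf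
      obtain ⟨w, hw, -⟩ := hq x (by simpa using hf)
      exact P.not_isPositive_of_negWitness hw hx
  refine ⟨hc, ?_⟩
  rw [complexity_sq, ENNReal.ofReal_mul hp0]
  refine mul_le_mul' (iSup₂_le fun x hx => ?_) (iSup₂_le fun x hx => ?_)
  · obtain ⟨w, hw, h⟩ := hp x ((hc x).2 hx)
    exact (iInf₂_le w hw).trans (ENNReal.ofReal_le_ofReal h)
  · obtain ⟨w, hw, h⟩ := hq x (by simpa using fun h => hx ((hc x).1 h))
    exact (iInf₂_le w hw).trans (ENNReal.ofReal_le_ofReal h)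

/-! ### Duality and scaling of witnesses -/

/-- There is a positive witness for `c` times the initial vector, of norm squared `B`. -/
def PosAt (x : D) (c : ℂ) (B : ℝ) : Prop :=
  ∃ w ∈ P.sub x, w - c • P.w0 ∈ P.K ∧ ‖w‖ ^ 2 = B

/-- There is a vector of norm squared `B` that is a negative witness but for having inner product
`c` with the initial vector. -/
def NegAt (x : D) (c : ℂ) (B : ℝ) : Prop :=
  ∃ w ∈ P.Kᗮ, w ∈ (P.sub x)ᗮ ∧ inner ℂ w P.w0 = c ∧ ‖w‖ ^ 2 = B

variable {P} {c : ℂ} {B α : ℝ}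

theorem PosAt.smul (h : P.PosAt x c B) (r : ℝ) : P.PosAt x (r * c) (r ^ 2 * B) := by
  obtain ⟨w, h1, h2, rfl⟩ := h
  refine ⟨(r : ℂ) • w, Submodule.smul_mem _ _ h1, ?_, ?_⟩
  · rw [mul_smul, ← smul_sub]
    exact Submodule.smul_mem _ _ h2
  · rw [norm_smul, mul_pow, Complex.norm_real, Real.norm_eq_abs, sq_abs]

theorem NegAt.smul (h : P.NegAt x c B) (r : ℝ) : P.NegAt x (r * c) (r ^ 2 * B) := by
  obtain ⟨w, h1, h2, rfl, rfl⟩ := h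
  refine ⟨(r : ℂ) • w, Submodule.smul_mem _ _ h1, Submodule.smul_mem _ _ h2, ?_, ?_⟩
  · rw [inner_smul_left, Complex.conj_ofReal]
  · rw [norm_smul, mul_pow, Complex.norm_real, Real.norm_eq_abs, sq_abs]

theorem posAt_scale (hα : 0 < α) :
    (P.scale α hα).PosAt x c B ↔ P.PosAt x (Real.sqrt α * c) B := by
  have key : ∀ w : P.H, w - c • (((Real.sqrt α : ℝ) : ℂ) • P.w0) ∈ P.K ↔
      w - ((Real.sqrt α : ℝ) * c) • P.w0 ∈ P.K := by
    intro w
    rw [smul_smul, mul_comm]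
  exact exists_congr fun w => and_congr Iff.rfl (and_congr (key w) Iff.rfl)

theorem negAt_scale (hα : 0 < α) :
    (P.scale α hα).NegAt x c B ↔ P.NegAt x (((Real.sqrt α : ℝ) : ℂ)⁻¹ * c) B := by
  have h : ((Real.sqrt α : ℝ) : ℂ) ≠ 0 := by exact_mod_cast (Real.sqrt_pos.2 hα).ne'
  have key : ∀ w : P.H, inner ℂ w (((Real.sqrt α : ℝ) : ℂ) • P.w0) = c ↔
      inner ℂ w P.w0 = ((Real.sqrt α : ℝ) : ℂ)⁻¹ * c := by
    intro w
    rw [inner_smul_right, eq_inv_mul_iff_mul_eq₀ h]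
  exact exists_congr fun w =>
    and_congr Iff.rfl (and_congr Iff.rfl (and_congr (key w) Iff.rfl))

/-- The same vector serves on both sides. Being orthogonal to `K` of the negation means lying in `K
⊔ span {w0}`, and the inner product with `w0 / ‖w0‖ ^ 2` reads off the coefficient of `w0`,
conjugated because `inner` is antilinear in its first argument. -/
theorem negAt_neg : P.neg.NegAt x (starRingEnd ℂ c) B ↔ P.PosAt x c B := by
  have hne : ((‖P.w0‖ : ℝ) : ℂ) ≠ 0 := by exact_mod_cast norm_ne_zero_iff.2 P.w0_ne
  have key : ∀ w : P.H, (w ∈ (P.K ⊔ Submodule.span ℂ {P.w0})ᗮᗮ ∧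
      inner ℂ w ((((‖P.w0‖ ^ 2)⁻¹ : ℝ) : ℂ) • P.w0) = starRingEnd ℂ c) ↔
      w - c • P.w0 ∈ P.K := by
    intro w
    rw [Submodule.orthogonal_orthogonal]
    have hin : ∀ k ∈ P.K, ∀ a : ℂ, inner ℂ (k + a • P.w0)
        ((((‖P.w0‖ ^ 2)⁻¹ : ℝ) : ℂ) • P.w0) = starRingEnd ℂ a := by
      intro k hk a
      rw [inner_smul_right, inner_add_left, (Submodule.mem_orthogonal _ _).1 P.w0_mem _ hk,
        inner_smul_left, inner_self_eq_norm_sq_to_K]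
      push_cast
      simp only [Complex.coe_algebraMap]
      field_simp
      ring
    constructor
    · rintro ⟨h1, h2⟩
      obtain ⟨k, hk, z, hz, rfl⟩ := Submodule.mem_sup.1 h1
      obtain ⟨a, rfl⟩ := Submodule.mem_span_singleton.1 hz
      rw [hin k hk] at h2
      have : a = c := star_injective h2
      rw [this, add_sub_cancel_right]
      exact hk
    · intro h
      have h2 := hin _ h c
      rw [sub_add_cancel] at h2
      refine ⟨?_, h2⟩
      rw [← sub_add_cancel w (c • P.w0)]
      exact Submodule.add_mem_sup h (Submodule.smul_mem _ _ (Submodule.mem_span_singleton_self _))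
  constructor
  · rintro ⟨w, h1, h2, h3, h4⟩
    refine ⟨w, ?_, (key w).1 ⟨h1, h3⟩, h4⟩
    exact (Submodule.orthogonal_orthogonal (P.sub x)).le h2
  · rintro ⟨w, h1, h2, h4⟩
    exact ⟨w, ((key w).2 h2).1, Submodule.le_orthogonal_orthogonal (P.sub x) h1,
      ((key w).2 h2).2, h4⟩

theorem posAt_neg : P.neg.PosAt x (starRingEnd ℂ c) B ↔ P.NegAt x c B := by
  have hne : ((‖P.w0‖ : ℝ) : ℂ) ≠ 0 := by exact_mod_cast norm_ne_zero_iff.2 P.w0_ne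
  have key : ∀ w : P.H, w - (starRingEnd ℂ c) • ((((‖P.w0‖ ^ 2)⁻¹ : ℝ) : ℂ) • P.w0) ∈
      (P.K ⊔ Submodule.span ℂ {P.w0})ᗮ ↔ w ∈ P.Kᗮ ∧ inner ℂ w P.w0 = c := by
    intro w
    rw [← Submodule.inf_orthogonal, Submodule.mem_inf, Submodule.mem_orthogonal_singleton_iff_inner_left]
    refine and_congr ?_ ?_
    · exact Submodule.sub_mem_iff_left _
        (Submodule.smul_mem _ _ (Submodule.smul_mem _ _ P.w0_mem))
    · rw [inner_sub_left, inner_smul_left, inner_smul_left, Complex.conj_conj,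
        inner_self_eq_norm_sq_to_K, Complex.conj_ofReal, sub_eq_zero]
      have : c * ((((‖P.w0‖ ^ 2)⁻¹ : ℝ) : ℂ) * (algebraMap ℝ ℂ ‖P.w0‖) ^ 2) = c := by
        push_cast
        simp only [Complex.coe_algebraMap]
        field_simp
      exact this.symm ▸ Iff.rfl
  constructor
  · rintro ⟨w, h1, h2, h4⟩
    exact ⟨w, ((key w).1 h2).1, h1, ((key w).1 h2).2, h4⟩
  · rintro ⟨w, h1, h2, h3, h4⟩
    exact ⟨w, h2, (key w).2 ⟨h1, h3⟩, h4⟩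

end SpanProgram

/-! ### Negations and positive scalar multiples at the leaves -/

/-- A positive scalar multiple of a given object, or of its negation. -/
structure Lab (ℓ : Type*) where
  leaf : ℓ
  factor : ℝ
  factor_pos : 0 < factor
  negated : Bool

namespace Lab

variable {ℓ : Type*} {D : Type v}

def program (P : ℓ → SpanProgram.{u} D) (L : Lab ℓ) : SpanProgram.{u} D :=
  match L.negated with
  | false => (P L.leaf).scale L.factor L.factor_pos
  | true => (P L.leaf).neg.scale L.factor L.factor_pos

/-- The factor is inverted because the vector `w0 / ‖w0‖ ^ 2` is multiplied by `(√α)⁻¹` when `w0` is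
multiplied by `√α`. -/
def neg (L : Lab ℓ) : Lab ℓ := ⟨L.leaf, L.factor⁻¹, inv_pos.2 L.factor_pos, !L.negated⟩

def scale (β : ℝ) (hβ : 0 < β) (L : Lab ℓ) : Lab ℓ :=
  ⟨L.leaf, β * L.factor, mul_pos hβ L.factor_pos, L.negated⟩

def map {ℓ' : Type*} (g : ℓ → ℓ') (L : Lab ℓ) : Lab ℓ' :=
  ⟨g L.leaf, L.factor, L.factor_pos, L.negated⟩

theorem program_eq_or (P : ℓ → SpanProgram.{u} D) (L : Lab ℓ) :
    L.program P = (P L.leaf).scale L.factor L.factor_pos ∨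
      L.program P = (P L.leaf).neg.scale L.factor L.factor_pos := by
  obtain ⟨l, α, h, s⟩ := L
  cases s
  exacts [Or.inl rfl, Or.inr rfl]

theorem program_map {ℓ' : Type*} {g : ℓ → ℓ'} {P : ℓ → SpanProgram.{u} D}
    {P' : ℓ' → SpanProgram.{u} D} (h : ∀ l, P' (g l) = P l) (L : Lab ℓ) :
    (L.map g).program P' = L.program P := by
  obtain ⟨l, α, hα, s⟩ := L
  cases s
  · change (P' (g l)).scale α hα = (P l).scale α hα
    rw [h]
  · change (P' (g l)).neg.scale α hα = (P l).neg.scale α hα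
    rw [h]

variable {P : ℓ → SpanProgram.{u} D} {L : Lab ℓ} {x : D} {c : ℂ} {B : ℝ}

theorem negAt_neg : (L.neg.program P).NegAt x (starRingEnd ℂ c) B ↔ (L.program P).PosAt x c B := by
  obtain ⟨l, α, h, s⟩ := L
  cases s
  · change ((P l).neg.scale α⁻¹ (inv_pos.2 h)).NegAt x _ B ↔ ((P l).scale α h).PosAt x c B
    rw [SpanProgram.negAt_scale, SpanProgram.posAt_scale, ← SpanProgram.negAt_neg]
    simp
  · change ((P l).scale α⁻¹ (inv_pos.2 h)).NegAt x _ B ↔ ((P l).neg.scale α h).PosAt x c B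
    rw [SpanProgram.negAt_scale, SpanProgram.posAt_scale, ← SpanProgram.posAt_neg]
    simp

theorem posAt_neg : (L.neg.program P).PosAt x (starRingEnd ℂ c) B ↔ (L.program P).NegAt x c B := by
  obtain ⟨l, α, h, s⟩ := L
  cases s
  · change ((P l).neg.scale α⁻¹ (inv_pos.2 h)).PosAt x _ B ↔ ((P l).scale α h).NegAt x c B
    rw [SpanProgram.negAt_scale, SpanProgram.posAt_scale, ← SpanProgram.posAt_neg]
    simp
  · change ((P l).scale α⁻¹ (inv_pos.2 h)).PosAt x _ B ↔ ((P l).neg.scale α h).NegAt x c B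
    rw [SpanProgram.negAt_scale, SpanProgram.posAt_scale, ← SpanProgram.negAt_neg]
    simp

theorem posAt_scale {β : ℝ} (hβ : 0 < β) (h : (L.program P).PosAt x c B) :
    ((L.scale β hβ).program P).PosAt x c (β * B) := by
  have key : ∀ (R : SpanProgram.{u} D) (α : ℝ) (hα : 0 < α), (R.scale α hα).PosAt x c B →
      (R.scale (β * α) (mul_pos hβ hα)).PosAt x c (β * B) := by
    intro R α hα h
    rw [SpanProgram.posAt_scale] at h ⊢
    have := h.smul (Real.sqrt β)
    rw [Real.sq_sqrt hβ.le, ← mul_assoc] at this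
    rwa [Real.sqrt_mul hβ.le, Complex.ofReal_mul]
  obtain ⟨l, α, hα, s⟩ := L
  cases s
  exacts [key _ _ hα h, key _ _ hα h]

theorem negAt_scale {β : ℝ} (hβ : 0 < β) (h : (L.program P).NegAt x c B) :
    ((L.scale β hβ).program P).NegAt x c (B / β) := by
  have key : ∀ (R : SpanProgram.{u} D) (α : ℝ) (hα : 0 < α), (R.scale α hα).NegAt x c B →
      (R.scale (β * α) (mul_pos hβ hα)).NegAt x c (B / β) := by
    intro R α hα h
    rw [SpanProgram.negAt_scale] at h ⊢
    have := h.smul (Real.sqrt β)⁻¹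
    rw [inv_pow, Real.sq_sqrt hβ.le, ← mul_assoc, inv_mul_eq_div] at this
    rwa [Real.sqrt_mul hβ.le, Complex.ofReal_mul, mul_inv, ← Complex.ofReal_inv (Real.sqrt β)]
  obtain ⟨l, α, hα, s⟩ := L
  cases s
  exacts [key _ _ hα h, key _ _ hα h]

end Lab

/-! ### Dual, rescaled and relabelled trees -/

namespace SPTree

variable {α : Type*} {ℓ : Type*} {D : Type v}

/-- The labels of the leaves. -/
def leaves : SPTree α → List α
  | leaf a => [a]
  | par l r => leaves l ++ leaves r
  | ser l r => leaves l ++ leaves r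

def depth : SPTree α → ℕ
  | leaf _ => 0
  | par l r => max (depth l) (depth r) + 1
  | ser l r => max (depth l) (depth r) + 1

def map {α' : Type*} (g : α → α') : SPTree α → SPTree α'
  | leaf a => leaf (g a)
  | par l r => par (map g l) (map g r)
  | ser l r => ser (map g l) (map g r)

/-- The dual tree, with negated labels. -/
def dual : SPTree (Lab ℓ) → SPTree (Lab ℓ)
  | leaf a => leaf a.neg
  | par l r => ser (dual l) (dual r)
  | ser l r => par (dual l) (dual r)

/-- The leaves without negations and scalars. -/
def support (τ : SPTree (Lab ℓ)) : List ℓ := τ.leaves.map Lab.leaf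

theorem support_par (l r : SPTree (Lab ℓ)) : (par l r).support = l.support ++ r.support :=
  List.map_append

theorem support_ser (l r : SPTree (Lab ℓ)) : (ser l r).support = l.support ++ r.support :=
  List.map_append

theorem leaves_map {α' : Type*} (g : α → α') (τ : SPTree α) :
    (τ.map g).leaves = τ.leaves.map g := by
  induction τ with
  | leaf a => rfl
  | par l r hl hr => simp [map, leaves, hl, hr]
  | ser l r hl hr => simp [map, leaves, hl, hr]

theorem depth_map {α' : Type*} (g : α → α') (τ : SPTree α) : (τ.map g).depth = τ.depth := by
  induction τ with
  | leaf a => rfl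
  | par l r hl hr => simp [map, depth, hl, hr]
  | ser l r hl hr => simp [map, depth, hl, hr]

theorem depth_dual (τ : SPTree (Lab ℓ)) : τ.dual.depth = τ.depth := by
  induction τ with
  | leaf a => rfl
  | par l r hl hr => simp [dual, depth, hl, hr]
  | ser l r hl hr => simp [dual, depth, hl, hr]

theorem support_dual (τ : SPTree (Lab ℓ)) : τ.dual.support = τ.support := by
  induction τ with
  | leaf a => rfl
  | par l r hl hr => rw [dual, support_ser, hl, hr, support_par]
  | ser l r hl hr => rw [dual, support_par, hl, hr, support_ser]

theorem support_map_scale {β : ℝ} (hβ : 0 < β) (τ : SPTree (Lab ℓ)) :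
    (τ.map (Lab.scale β hβ)).support = τ.support := by
  simp [support, leaves_map, Function.comp_def, Lab.scale]

theorem label_mem_leaves (τ : SPTree α) (e : τ.Edge) : τ.label e ∈ τ.leaves := by
  induction τ with
  | leaf a => exact List.mem_singleton_self _
  | par l r hl hr =>
    refine List.mem_append.2 ?_
    cases e with
    | inl e => exact Or.inl (hl e)
    | inr e => exact Or.inr (hr e)
  | ser l r hl hr =>
    refine List.mem_append.2 ?_
    cases e with
    | inl e => exact Or.inl (hl e)
    | inr e => exact Or.inr (hr e)

/-- Turns the list statement that no leaf is repeated into the injectivity of the map from edges to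
leaves that the main theorem asks for. -/
theorem label_leaf_injective (τ : SPTree (Lab ℓ)) (h : τ.support.Nodup) :
    Function.Injective fun e => (τ.label e).leaf := by
  have hmem : ∀ (τ : SPTree (Lab ℓ)) e, (τ.label e).leaf ∈ τ.support :=
    fun τ e => List.mem_map_of_mem (τ.label_mem_leaves e)
  have key : ∀ l r : SPTree (Lab ℓ), (l.support ++ r.support).Nodup →
      Function.Injective (fun e => (l.label e).leaf) →
      Function.Injective (fun e => (r.label e).leaf) →
      Function.Injective fun e : l.Edge ⊕ r.Edge => (Sum.elim l.label r.label e).leaf := by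
    intro l r h hl hr
    have hd := (List.nodup_append'.1 h).2.2
    rintro (e | e) (e' | e') he
    · exact congrArg _ (hl he)
    · refine (hd (hmem l e) ?_).elim
      rw [show (l.label e).leaf = _ from he]
      exact hmem r e'
    · refine (hd (hmem l e') ?_).elim
      rw [← show (r.label e).leaf = (l.label e').leaf from he]
      exact hmem r e
    · exact congrArg _ (hr he)
  induction τ with
  | leaf a => exact fun _ _ _ => rfl
  | par l r hl hr =>
    rw [support_par] at h
    have h' := List.nodup_append'.1 h
    exact key l r h (hl h'.1) (hr h'.2.1)
  | ser l r hl hr =>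
    rw [support_ser] at h
    have h' := List.nodup_append'.1 h
    exact key l r h (hl h'.1) (hr h'.2.1)

theorem pos_zero (P : α → SpanProgram.{u} D) (x : D) (τ : SPTree α) : τ.Pos P x 0 0 := by
  induction τ with
  | leaf a => exact ⟨0, Submodule.zero_mem _, by simp, by simp⟩
  | par l r hl hr => exact ⟨0, 0, 0, 0, by simp, by simp, hl, hr⟩
  | ser l r hl hr => exact ⟨0, 0, by simp, hl, hr⟩

/-- The zero vector is not a positive witness, since `w0` is nonzero and orthogonal to `K`. Hence a
bound on positive witnesses that are actually needed is positive and can be inverted. -/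
theorem Pos.one_pos {P : α → SpanProgram.{u} D} {x : D} {τ : SPTree α} {B : ℝ}
    (h : τ.Pos P x 1 B) : 0 < B := by
  obtain ⟨w, hw, rfl⟩ := (pos_one_iff P x τ B).1 h
  refine pow_pos (norm_pos_iff.2 ?_) 2
  rintro rfl
  have h1 := (Submodule.mem_orthogonal _ _).1 (τ.program P).w0_mem _ hw.2
  rw [zero_sub, inner_neg_left, neg_eq_zero, inner_self_eq_zero] at h1
  exact (τ.program P).w0_ne h1

theorem pos_map {α' : Type*} {g : α → α'} {P : α → SpanProgram.{u} D}
    {P' : α' → SpanProgram.{u} D} (h : ∀ a, P' (g a) = P a) (x : D) (τ : SPTree α) :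
    (τ.map g).Pos P' x = τ.Pos P x := by
  induction τ with
  | leaf a =>
    funext c B
    change (P' (g a)).PosAt x c B = (P a).PosAt x c B
    rw [h]
  | par l r hl hr => simp only [map, Pos, hl, hr]
  | ser l r hl hr => simp only [map, Pos, hl, hr]

theorem neg_map {α' : Type*} {g : α → α'} {P : α → SpanProgram.{u} D}
    {P' : α' → SpanProgram.{u} D} (h : ∀ a, P' (g a) = P a) (x : D) (τ : SPTree α) :
    (τ.map g).Neg P' x = τ.Neg P x := by
  induction τ with
  | leaf a =>
    funext c B
    change (P' (g a)).NegAt x c B = (P a).NegAt x c B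
    rw [h]
  | par l r hl hr => simp only [map, Neg, hl, hr]
  | ser l r hl hr => simp only [map, Neg, hl, hr]

variable {P : ℓ → SpanProgram.{u} D} {x : D} {c : ℂ} {B : ℝ}

theorem Pos.dual {τ : SPTree (Lab ℓ)} (h : τ.Pos (Lab.program P) x c B) :
    τ.dual.Neg (Lab.program P) x (starRingEnd ℂ c) B := by
  induction τ generalizing c B with
  | leaf a => exact Lab.negAt_neg.2 h
  | par l r hl hr =>
    obtain ⟨c₁, c₂, B₁, B₂, rfl, rfl, h1, h2⟩ := h
    exact ⟨_, _, B₁, B₂, (map_add _ _ _).symm, rfl, hl h1, hr h2⟩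
  | ser l r hl hr =>
    obtain ⟨B₁, B₂, rfl, h1, h2⟩ := h
    exact ⟨B₁, B₂, rfl, hl h1, hr h2⟩

theorem Neg.dual {τ : SPTree (Lab ℓ)} (h : τ.Neg (Lab.program P) x c B) :
    τ.dual.Pos (Lab.program P) x (starRingEnd ℂ c) B := by
  induction τ generalizing c B with
  | leaf a => exact Lab.posAt_neg.2 h
  | par l r hl hr =>
    obtain ⟨B₁, B₂, rfl, h1, h2⟩ := h
    exact ⟨B₁, B₂, rfl, hl h1, hr h2⟩
  | ser l r hl hr =>
    obtain ⟨c₁, c₂, B₁, B₂, rfl, rfl, h1, h2⟩ := h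
    exact ⟨_, _, B₁, B₂, (map_add _ _ _).symm, rfl, hl h1, hr h2⟩

theorem Pos.scale {β : ℝ} (hβ : 0 < β) {τ : SPTree (Lab ℓ)} (h : τ.Pos (Lab.program P) x c B) :
    (τ.map (Lab.scale β hβ)).Pos (Lab.program P) x c (β * B) := by
  induction τ generalizing c B with
  | leaf a => exact Lab.posAt_scale hβ h
  | par l r hl hr =>
    obtain ⟨c₁, c₂, B₁, B₂, rfl, rfl, h1, h2⟩ := h
    exact ⟨c₁, c₂, _, _, rfl, (mul_add _ _ _).symm, hl h1, hr h2⟩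
  | ser l r hl hr =>
    obtain ⟨B₁, B₂, rfl, h1, h2⟩ := h
    exact ⟨_, _, (mul_add _ _ _).symm, hl h1, hr h2⟩

theorem Neg.scale {β : ℝ} (hβ : 0 < β) {τ : SPTree (Lab ℓ)} (h : τ.Neg (Lab.program P) x c B) :
    (τ.map (Lab.scale β hβ)).Neg (Lab.program P) x c (B / β) := by
  induction τ generalizing c B with
  | leaf a => exact Lab.negAt_scale hβ h
  | par l r hl hr =>
    obtain ⟨B₁, B₂, rfl, h1, h2⟩ := h
    exact ⟨_, _, (add_div _ _ _).symm, hl h1, hr h2⟩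
  | ser l r hl hr =>
    obtain ⟨c₁, c₂, B₁, B₂, rfl, rfl, h1, h2⟩ := h
    exact ⟨c₁, c₂, _, _, rfl, (add_div _ _ _).symm, hl h1, hr h2⟩

end SPTree

/-! ### Series-parallel compositions for boolean formulas -/

namespace SPTree

variable {ℓ : Type*} {D : Type v}

/-- The composition of the tree computes `f` with positive and negative witnesses of size at most
`p` and `q`. -/
def Bounded (P : ℓ → SpanProgram.{u} D) (τ : SPTree (Lab ℓ)) (f : D → Bool) (p q : ℝ) : Prop :=
  (∀ x, f x = true → ∃ B ≤ p, τ.Pos (Lab.program P) x 1 B) ∧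
  (∀ x, f x = false → ∃ B ≤ q, τ.Neg (Lab.program P) x 1 B)

variable {P : ℓ → SpanProgram.{u} D} {τ l r : SPTree (Lab ℓ)} {f f₁ f₂ : D → Bool} {p q : ℝ}

theorem Bounded.dual (h : τ.Bounded P f p q) : τ.dual.Bounded P (fun x => !f x) q p := by
  constructor
  · intro x hx
    obtain ⟨B, hB, h1⟩ := h.2 x (by simpa using hx)
    exact ⟨B, hB, by simpa using h1.dual⟩
  · intro x hx
    obtain ⟨B, hB, h1⟩ := h.1 x (by simpa using hx)
    exact ⟨B, hB, by simpa using h1.dual⟩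

theorem Bounded.scale {β : ℝ} (hβ : 0 < β) (h : τ.Bounded P f p q) :
    (τ.map (Lab.scale β hβ)).Bounded P f (β * p) (q / β) := by
  constructor
  · intro x hx
    obtain ⟨B, hB, h1⟩ := h.1 x hx
    exact ⟨_, mul_le_mul_of_nonneg_left hB hβ.le, h1.scale hβ⟩
  · intro x hx
    obtain ⟨B, hB, h1⟩ := h.2 x hx
    exact ⟨_, div_le_div_of_nonneg_right hB hβ.le, h1.scale hβ⟩

/-- The whole unit flow is sent through a branch whose function is true, and zero flow with zero
witness through the other. The potential drops by one across both branches, so the negative costs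
add. -/
theorem Bounded.par {q₁ q₂ : ℝ} (h₁ : l.Bounded P f₁ p q₁) (h₂ : r.Bounded P f₂ p q₂) :
    (par l r).Bounded P (fun x => f₁ x || f₂ x) p (q₁ + q₂) := by
  constructor
  · intro x hx
    rcases (Bool.or_eq_true _ _).mp hx with hx | hx
    · obtain ⟨B, hB, h⟩ := h₁.1 x hx
      exact ⟨B, hB, 1, 0, B, 0, add_zero 1, add_zero B, h, pos_zero _ _ _⟩
    · obtain ⟨B, hB, h⟩ := h₂.1 x hx
      exact ⟨B, hB, 0, 1, 0, B, zero_add 1, zero_add B, pos_zero _ _ _, h⟩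
  · intro x hx
    rw [Bool.or_eq_false_iff] at hx
    obtain ⟨B₁, hB₁, h1⟩ := h₁.2 x hx.1
    obtain ⟨B₂, hB₂, h2⟩ := h₂.2 x hx.2
    exact ⟨B₁ + B₂, add_le_add hB₁ hB₂, B₁, B₂, rfl, h1, h2⟩

theorem Bounded.program (h : τ.Bounded P f p q) (hp : 0 ≤ p) :
    (τ.program (Lab.program P)).Computes f ∧
      (τ.program (Lab.program P)).complexity ^ 2 ≤ ENNReal.ofReal (p * q) := by
  refine SpanProgram.computes_and_complexity_le _ hp (fun x hx => ?_) (fun x hx => ?_)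
  · obtain ⟨B, hB, h1⟩ := h.1 x hx
    obtain ⟨w, hw, h2⟩ := (pos_one_iff _ _ _ _).1 h1
    exact ⟨w, hw, h2.trans_le hB⟩
  · obtain ⟨B, hB, h1⟩ := h.2 x hx
    obtain ⟨w, hw, h2⟩ := (neg_one_iff _ _ _ _).1 h1
    exact ⟨w, hw, h2.trans_le hB⟩

theorem exists_bounded_of_computes [Finite D]
    (h : (τ.program (Lab.program P)).Computes f) : ∃ p q : ℝ, 0 ≤ p ∧ 0 ≤ q ∧
      τ.Bounded P f p q ∧
      (τ.program (Lab.program P)).complexity ^ 2 = ENNReal.ofReal (p * q) := by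
  obtain ⟨p, q, hp, hq, h1, h2, h3⟩ := (τ.program (Lab.program P)).exists_bounds
  refine ⟨p, q, hp, hq, ⟨fun x hx => ?_, fun x hx => ?_⟩, h3⟩
  · obtain ⟨w, hw, hB⟩ := h1 x ((h x).1 hx)
    exact ⟨_, hB, (pos_one_iff _ _ _ _).2 ⟨w, hw, rfl⟩⟩
  · obtain ⟨w, hw, hB⟩ := h2 x (fun h' => by simp [(h x).2 h'] at hx)
    exact ⟨_, hB, (neg_one_iff _ _ _ _).2 ⟨w, hw, rfl⟩⟩

theorem exists_bounded_leaf [Finite D] (a : ℓ) (h : (P a).Computes f) : ∃ p q : ℝ, 0 ≤ p ∧ 0 ≤ q ∧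
    (leaf ⟨a, 1, one_pos, false⟩ : SPTree (Lab ℓ)).Bounded P f p q ∧
      (P a).complexity ^ 2 = ENNReal.ofReal (p * q) := by
  obtain ⟨p, q, hp, hq, h1, h2, h3⟩ := (P a).exists_bounds
  refine ⟨p, q, hp, hq, ⟨fun x hx => ?_, fun x hx => ?_⟩, h3⟩
  · obtain ⟨w, hw, hB⟩ := h1 x ((h x).1 hx)
    refine ⟨_, hB, (SpanProgram.posAt_scale one_pos).2 ?_⟩
    exact ⟨w, hw.1, by simpa using hw.2, rfl⟩
  · obtain ⟨w, hw, hB⟩ := h2 x (fun h' => by simp [(h x).2 h'] at hx)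
    refine ⟨_, hB, (SpanProgram.negAt_scale one_pos).2 ?_⟩
    exact ⟨w, hw.1, hw.2.1, by simpa using hw.2.2, rfl⟩

/-- Some series-parallel composition of depth at most `d`, that uses each of the programs in `s` at
most once and no others, computes `f` with squared complexity at most `c`. -/
def Achievable (P : ℓ → SpanProgram.{u} D) (f : D → Bool) (c : ℝ) (d : ℕ) (s : Set ℓ) : Prop :=
  ∃ τ : SPTree (Lab ℓ), τ.depth ≤ d ∧ τ.support.Nodup ∧ (∀ a ∈ τ.support, a ∈ s) ∧
    ∃ p q : ℝ, 0 ≤ p ∧ 0 ≤ q ∧ τ.Bounded P f p q ∧ p * q ≤ c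

variable {c c₁ c₂ : ℝ} {d : ℕ} {s s₁ s₂ : Set ℓ}

theorem Achievable.nonneg (h : Achievable P f c d s) : 0 ≤ c := by
  obtain ⟨τ, -, -, -, p, q, hp, hq, -, h⟩ := h
  exact (mul_nonneg hp hq).trans h

theorem Achievable.mono {c' : ℝ} {d' : ℕ} {s' : Set ℓ} (h : Achievable P f c d s) (hc : c ≤ c')
    (hd : d ≤ d') (hs : s ⊆ s') : Achievable P f c' d' s' := by
  obtain ⟨τ, h1, h2, h3, p, q, hp, hq, h4, h5⟩ := h
  exact ⟨τ, h1.trans hd, h2, fun a ha => hs (h3 a ha), p, q, hp, hq, h4, h5.trans hc⟩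

theorem Achievable.congr {f' : D → Bool} (h : Achievable P f c d s) (hf : ∀ x, f x = f' x) :
    Achievable P f' c d s :=
  (funext hf : f = f') ▸ h

theorem Achievable.not (h : Achievable P f c d s) : Achievable P (fun x => !f x) c d s := by
  obtain ⟨τ, h1, h2, h3, p, q, hp, hq, h4, h5⟩ := h
  refine ⟨τ.dual, by rwa [depth_dual], by rwa [support_dual], by rwa [support_dual], q, p, hq, hp,
    h4.dual, by rwa [mul_comm]⟩

/-- Both trees are rescaled so that the positive bound is 1, which turns the negative bounds into
the products `p₁ * q₁` and `p₂ * q₂`; the parallel composition adds these. -/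
theorem Achievable.or (h₁ : Achievable P f₁ c₁ d s₁) (h₂ : Achievable P f₂ c₂ d s₂)
    (hs : Disjoint s₁ s₂) :
    Achievable P (fun x => f₁ x || f₂ x) (c₁ + c₂) (d + 1) (s₁ ∪ s₂) := by
  have hc₁ := h₁.nonneg
  have hc₂ := h₂.nonneg
  -- If a function is constantly false, its positive bound may be 0 and cannot be normalised. In
  -- this case the other tree alone computes the disjunction.
  by_cases hf₁ : ∀ x, f₁ x = false
  · have : (fun x => f₁ x || f₂ x) = f₂ := funext fun x => by simp [hf₁ x]
    rw [this]
    exact h₂.mono (le_add_of_nonneg_left hc₁) d.le_succ Set.subset_union_right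
  by_cases ht₁ : ∀ x, f₁ x = true
  · have : (fun x => f₁ x || f₂ x) = f₁ := funext fun x => by simp [ht₁ x]
    rw [this]
    exact h₁.mono (le_add_of_nonneg_right hc₂) d.le_succ Set.subset_union_left
  by_cases hf₂ : ∀ x, f₂ x = false
  · have : (fun x => f₁ x || f₂ x) = f₁ := funext fun x => by simp [hf₂ x]
    rw [this]
    exact h₁.mono (le_add_of_nonneg_right hc₂) d.le_succ Set.subset_union_left
  obtain ⟨τ₁, hd1, hn1, hs1, p₁, q₁, hp1, hq1, hb1, hc1⟩ := h₁
  obtain ⟨τ₂, hd2, hn2, hs2, p₂, q₂, hp2, hq2, hb2, hc2⟩ := h₂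
  have hp1' : 0 < p₁ := by
    push Not at hf₁
    obtain ⟨x, hx⟩ := hf₁
    obtain ⟨B, hB, h⟩ := hb1.1 x (by simpa using hx)
    exact h.one_pos.trans_le hB
  have hp2' : 0 < p₂ := by
    push Not at hf₂
    obtain ⟨x, hx⟩ := hf₂
    obtain ⟨B, hB, h⟩ := hb2.1 x (by simpa using hx)
    exact h.one_pos.trans_le hB
  have b1 := hb1.scale (inv_pos.2 hp1')
  have b2 := hb2.scale (inv_pos.2 hp2')
  rw [inv_mul_cancel₀ hp1'.ne', div_inv_eq_mul] at b1
  rw [inv_mul_cancel₀ hp2'.ne', div_inv_eq_mul] at b2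
  refine ⟨SPTree.par (τ₁.map _) (τ₂.map _), ?_, ?_, ?_, 1, q₁ * p₁ + q₂ * p₂, zero_le_one,
    by positivity, b1.par b2, ?_⟩
  · simp only [depth, depth_map]
    exact Nat.succ_le_succ (max_le hd1 hd2)
  · rw [support_par, support_map_scale, support_map_scale]
    exact hn1.append hn2 fun a h1 h2 => Set.disjoint_left.1 hs (hs1 a h1) (hs2 a h2)
  · rw [support_par, support_map_scale, support_map_scale]
    intro a ha
    exact (List.mem_append.1 ha).imp (hs1 a) (hs2 a)
  · rw [one_mul, mul_comm q₁, mul_comm q₂]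
    exact add_le_add hc1 hc2

/-- A gate of large fan-in is split into two halves `κ` times, so its depth is logarithmic in the
fan-in. -/
theorem Achievable.exists {J : Type*} (g : J → D → Bool) (c : J → ℝ) (d : ℕ) (s : J → Set ℓ)
    (hs : Pairwise fun i j => Disjoint (s i) (s j)) (κ : ℕ) (t : Finset J) (hne : t.Nonempty)
    (hcard : t.card ≤ 2 ^ κ) (h : ∀ j ∈ t, Achievable P (g j) (c j) d (s j)) :
    Achievable P (fun x => decide (∃ j ∈ t, g j x = true)) (∑ j ∈ t, c j) (d + κ)
      (⋃ j ∈ t, s j) := by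
  classical
  induction κ generalizing t with
  | zero =>
    obtain ⟨j, rfl⟩ := Finset.card_eq_one.1
      (le_antisymm (by simpa using hcard) hne.card_pos)
    simpa using h j (Finset.mem_singleton_self j)
  | succ κ ih =>
    by_cases hk : t.card ≤ 2 ^ κ
    · exact (ih t hne hk h).mono le_rfl (by omega) subset_rfl
    -- A subset of exactly `2 ^ κ` elements; the rest is nonempty and has at most `2 ^ κ` elements
    -- as well.
    obtain ⟨t₁, ht₁, hc₁⟩ := Finset.exists_subset_card_eq (not_le.1 hk).le
    have hc₂ : (t \ t₁).card + t₁.card = t.card := Finset.card_sdiff_add_card_eq_card ht₁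
    have hpos : 0 < 2 ^ κ := by positivity
    rw [pow_succ] at hcard
    have a1 := ih t₁ (Finset.card_pos.1 (by omega)) hc₁.le fun j hj => h j (ht₁ hj)
    have a2 := ih (t \ t₁) (Finset.card_pos.1 (by omega)) (by omega) fun j hj =>
      h j (Finset.sdiff_subset hj)
    have hdisj : Disjoint (⋃ j ∈ t₁, s j) (⋃ j ∈ t \ t₁, s j) := by
      simp only [Set.disjoint_iUnion_left, Set.disjoint_iUnion_right]
      intro i hi j hj
      refine hs ?_
      rintro rfl
      exact (Finset.mem_sdiff.1 hi).2 hj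
    have a3 := a1.or a2 hdisj
    have hor : (fun x => decide (∃ j ∈ t, g j x = true)) = fun x =>
        decide (∃ j ∈ t₁, g j x = true) || decide (∃ j ∈ t \ t₁, g j x = true) := by
      funext x
      rw [← Bool.decide_or]
      refine decide_eq_decide.2 ⟨?_, ?_⟩
      · rintro ⟨j, hj, hx⟩
        by_cases hj₁ : j ∈ t₁
        · exact Or.inl ⟨j, hj₁, hx⟩
        · exact Or.inr ⟨j, Finset.mem_sdiff.2 ⟨hj, hj₁⟩, hx⟩
      · rintro (⟨j, hj, hx⟩ | ⟨j, hj, hx⟩)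
        · exact ⟨j, ht₁ hj, hx⟩
        · exact ⟨j, Finset.sdiff_subset hj, hx⟩
    rw [hor]
    refine a3.mono ?_ (by omega) ?_
    · rw [add_comm, Finset.sum_sdiff ht₁]
    · refine Set.union_subset ?_ ?_
      · exact Set.biUnion_subset_biUnion_left ht₁
      · exact Set.biUnion_subset_biUnion_left Finset.sdiff_subset

theorem Achievable.forall {J : Type*} (g : J → D → Bool) (c : J → ℝ) (d : ℕ) (s : J → Set ℓ)
    (hs : Pairwise fun i j => Disjoint (s i) (s j)) (κ : ℕ) (t : Finset J) (hne : t.Nonempty)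
    (hcard : t.card ≤ 2 ^ κ) (h : ∀ j ∈ t, Achievable P (g j) (c j) d (s j)) :
    Achievable P (fun x => decide (∀ j ∈ t, g j x = true)) (∑ j ∈ t, c j) (d + κ)
      (⋃ j ∈ t, s j) := by
  have h1 := (Achievable.exists (fun j x => !g j x) c d s hs κ t hne hcard
    fun j hj => (h j hj).not).not
  convert h1 using 2 with x
  simp [← decide_not]

/-- Each input of a gate uses up a variable, so in a formula where no variable is repeated the
fan-in is at most the number of variables. -/
theorem one_le_sum_occurrences {ι : Type} [Fintype ι] [DecidableEq ι] (φ : BoolFormula ι) :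
    1 ≤ ∑ i, φ.occurrences i := by
  induction φ with
  | var j => simp [BoolFormula.occurrences]
  | not φ ih => exact ih
  | and k φ ih =>
    simp only [BoolFormula.occurrences]
    rw [Finset.sum_comm]
    exact (ih 0).trans (Finset.single_le_sum (f := fun j => ∑ i, (φ j).occurrences i)
      (fun _ _ => Nat.zero_le _) (Finset.mem_univ 0))
  | or k φ ih =>
    simp only [BoolFormula.occurrences]
    rw [Finset.sum_comm]
    exact (ih 0).trans (Finset.single_le_sum (f := fun j => ∑ i, (φ j).occurrences i)
      (fun _ _ => Nat.zero_le _) (Finset.mem_univ 0))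

/-- The hypothesis is only at most one occurrence per variable, since the subformulas of a read-once
formula miss some variables. Disjointness of the supports is preserved because different inputs of a
gate involve different variables. -/
theorem Achievable.formula {ι : Type} [Fintype ι] [DecidableEq ι] (g : ι → D → Bool) (c : ι → ℝ)
    (d κ : ℕ) (s : ι → Set ℓ) (hs : Pairwise fun i j => Disjoint (s i) (s j))
    (hκ : Fintype.card ι ≤ 2 ^ κ) (h : ∀ i, Achievable P (g i) (c i) d (s i))
    (φ : BoolFormula ι) (hφ : ∀ i, φ.occurrences i ≤ 1) :
    Achievable P (fun x => φ.eval fun i => g i x) (∑ i, φ.occurrences i * c i)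
      (d + φ.depth * κ) (⋃ i ∈ {i | φ.occurrences i ≠ 0}, s i) := by
  have gate : ∀ (k : ℕ) (ψ : Fin (k + 2) → BoolFormula ι),
      (∀ i, ∑ j, (ψ j).occurrences i ≤ 1) →
      (Finset.univ : Finset (Fin (k + 2))).card ≤ 2 ^ κ ∧
      (Pairwise fun j j' => Disjoint (⋃ i ∈ {i | (ψ j).occurrences i ≠ 0}, s i)
        (⋃ i ∈ {i | (ψ j').occurrences i ≠ 0}, s i)) ∧
      (∑ j, ∑ i, (ψ j).occurrences i * c i = ∑ i, ((∑ j, (ψ j).occurrences i : ℕ) : ℝ) * c i) ∧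
      (⋃ j ∈ (Finset.univ : Finset (Fin (k + 2))), ⋃ i ∈ {i | (ψ j).occurrences i ≠ 0}, s i) ⊆
        ⋃ i ∈ {i | ∑ j, (ψ j).occurrences i ≠ 0}, s i := by
    intro k ψ hψ
    refine ⟨?_, fun j j' hj => ?_, ?_, ?_⟩
    · refine le_trans ?_ hκ
      calc (Finset.univ : Finset (Fin (k + 2))).card = ∑ j : Fin (k + 2), 1 := by simp
        _ ≤ ∑ j, ∑ i, (ψ j).occurrences i :=
          Finset.sum_le_sum fun j _ => one_le_sum_occurrences _
        _ = ∑ i, ∑ j, (ψ j).occurrences i := Finset.sum_comm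
        _ ≤ ∑ i : ι, 1 := Finset.sum_le_sum fun i _ => hψ i
        _ = Fintype.card ι := by simp
    · simp only [Set.disjoint_iUnion_left, Set.disjoint_iUnion_right]
      intro i hi i' hi'
      refine hs ?_
      rintro rfl
      have h2 : (ψ j).occurrences i' + (ψ j').occurrences i' ≤ 1 := by
        rw [← Finset.sum_pair hj (f := fun j => (ψ j).occurrences i')]
        exact (Finset.sum_le_sum_of_subset (Finset.subset_univ _)).trans (hψ i')
      have h3 : (ψ j).occurrences i' ≠ 0 := hi'
      have h4 : (ψ j').occurrences i' ≠ 0 := hi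
      omega
    · rw [Finset.sum_comm]
      refine Finset.sum_congr rfl fun i _ => ?_
      rw [Nat.cast_sum, Finset.sum_mul]
    · refine Set.iUnion₂_subset fun j _ => Set.biUnion_subset_biUnion_left fun i hi => ?_
      have h1 : (ψ j).occurrences i ≤ ∑ j, (ψ j).occurrences i :=
        Finset.single_le_sum (f := fun j => (ψ j).occurrences i)
          (fun _ _ => Nat.zero_le _) (Finset.mem_univ j)
      have h3 : (ψ j).occurrences i ≠ 0 := hi
      change ∑ j, (ψ j).occurrences i ≠ 0
      omega
  have sub : ∀ (k : ℕ) (ψ : Fin (k + 2) → BoolFormula ι),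
      (∀ i, ∑ j, (ψ j).occurrences i ≤ 1) → ∀ j i, (ψ j).occurrences i ≤ 1 := by
    intro k ψ hψ j i
    exact (Finset.single_le_sum (f := fun j => (ψ j).occurrences i)
        (fun _ _ => Nat.zero_le _) (Finset.mem_univ j)).trans (hψ i)
  have dep : ∀ (k : ℕ) (ψ : Fin (k + 2) → BoolFormula ι) j, d + (ψ j).depth * κ ≤
      d + (Finset.univ.sup fun j => (ψ j).depth) * κ := by
    intro k ψ j
    gcongr
    exact Finset.le_sup (f := fun j => (ψ j).depth) (Finset.mem_univ j)
  induction φ with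
  | var j =>
    simp only [BoolFormula.occurrences, BoolFormula.depth, BoolFormula.eval, zero_mul, add_zero]
    refine (h j).mono (by simp) le_rfl ?_
    exact Set.subset_biUnion_of_mem (u := s) (by simp)
  | not φ ih => exact (ih hφ).not
  | and k ψ ih =>
    obtain ⟨h1, h2, h3, h4⟩ := gate k ψ hφ
    have := Achievable.forall _ _ _ _ h2 κ Finset.univ Finset.univ_nonempty h1
      fun j _ => (ih j (sub k ψ hφ j)).mono le_rfl (dep k ψ j) subset_rfl
    have e : d + (Finset.univ.sup fun j => (ψ j).depth) * κ + κ ≤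
        d + (1 + Finset.univ.sup fun j => (ψ j).depth) * κ := by
      rw [add_mul, one_mul]; omega
    exact (this.mono h3.le e h4).congr fun x => by simp [BoolFormula.eval]
  | or k ψ ih =>
    obtain ⟨h1, h2, h3, h4⟩ := gate k ψ hφ
    have := Achievable.exists _ _ _ _ h2 κ Finset.univ Finset.univ_nonempty h1
      fun j _ => (ih j (sub k ψ hφ j)).mono le_rfl (dep k ψ j) subset_rfl
    have e : d + (Finset.univ.sup fun j => (ψ j).depth) * κ + κ ≤
        d + (1 + Finset.univ.sup fun j => (ψ j).depth) * κ := by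
      rw [add_mul, one_mul]; omega
    exact (this.mono h3.le e h4).congr fun x => by simp [BoolFormula.eval]

end SPTree

/-! ### Compositions for a divide and conquer strategy -/

namespace SPTree

variable {ℓ ℓ' : Type*} {D : Type v} {P : ℓ → SpanProgram.{u} D} {P' : ℓ' → SpanProgram.{u} D}

theorem Bounded.map_leaf {g : ℓ → ℓ'} (h : ∀ a, P' (g a) = P a) {τ : SPTree (Lab ℓ)}
    {f : D → Bool} {p q : ℝ} (hb : τ.Bounded P f p q) :
    (τ.map (Lab.map g)).Bounded P' f p q := by
  simp only [Bounded, pos_map (Lab.program_map h), neg_map (Lab.program_map h)]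
  exact hb

theorem support_map_leaf (g : ℓ → ℓ') (τ : SPTree (Lab ℓ)) :
    (τ.map (Lab.map g)).support = τ.support.map g := by
  simp [support, leaves_map, Function.comp_def, Lab.map]

end SPTree

namespace DivideAndConquer

open SPTree

variable {a n : ℕ} {A : Type v} {Λ : Type*} (S : DivideAndConquer a n A Λ)
  (P₀ Paux : ℕ → Λ → SpanProgram.{u} (Fin n → A))

/-- The program for `f m p` that belongs to a tree over the leaves of the recursion. -/
def treeProgram (m : ℕ) (p : Λ) (τ : SPTree (Lab (S.Leaf m p))) : SpanProgram.{u} (Fin n → A) :=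
  if m < S.m₀ then P₀ m p else τ.program (Lab.program (Leaf.program S P₀ Paux))

/-- One step of the recursion. -/
def IsStep (δ m : ℕ) (p : Λ)
    (T : ∀ j, SPTree (Lab (S.Leaf (S.size m p j) (S.param m p j))))
    (τ : SPTree (Lab (S.Leaf m p))) : Prop :=
  τ.support.Nodup ∧
  (τ.program (Lab.program (Leaf.program S P₀ Paux))).Computes (S.f m p) ∧
  (τ.program (Lab.program (Leaf.program S P₀ Paux))).complexity ^ 2 ≤
    (∑ j, (S.treeProgram P₀ Paux _ _ (T j)).complexity ^ 2) + (Paux m p).complexity ^ 2 ∧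
  τ.depth ≤ (Finset.univ.sup fun j => (T j).depth) + δ * Nat.clog 2 (a + 1)

-- The formula is applied to the trees of the subproblems and to a single leaf for the auxiliary
-- program. Leaves remember the index `j` of the subproblem that they come from, so the supports are
-- disjoint even if two subproblems coincide.
variable {P₀ Paux} in
theorem exists_isStep [Finite A] {δ m : ℕ} {p : Λ} (h : S.m₀ ≤ m)
    (hδ : (S.φ m p).depth ≤ δ) (haux : (Paux m p).Computes (S.faux m p))
    (T : ∀ j, SPTree (Lab (S.Leaf (S.size m p j) (S.param m p j))))
    (hnd : ∀ j, (T j).support.Nodup)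
    (hT : ∀ j, ∃ p' q' : ℝ, 0 ≤ p' ∧ 0 ≤ q' ∧ (T j).Bounded (Leaf.program S P₀ Paux)
      (S.f (S.size m p j) (S.param m p j)) p' q' ∧
      (S.treeProgram P₀ Paux _ _ (T j)).complexity ^ 2 = ENNReal.ofReal (p' * q')) :
    ∃ τ, S.IsStep P₀ Paux δ m p T τ := by
  choose p' q' hp' hq' hb hC using hT
  obtain ⟨p₁, q₁, hp₁, hq₁, hb₁, hC₁⟩ := exists_bounded_leaf (P := Leaf.program S P₀ Paux)
    (Leaf.aux (S := S) (p := p) h) haux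
  set d := Finset.univ.sup fun j => (T j).depth with hd
  let g : Fin (a + 1) → (Fin n → A) → Bool := fun i x => Fin.snoc (α := fun _ => Bool)
    (fun j => S.f (S.size m p j) (S.param m p j) x) (S.faux m p x) i
  let c : Fin (a + 1) → ℝ := Fin.snoc (α := fun _ => ℝ) (fun j => p' j * q' j) (p₁ * q₁)
  let s : Fin (a + 1) → Set (S.Leaf m p) := Fin.snoc (α := fun _ => Set (S.Leaf m p))
    (fun j => Set.range (Leaf.step h j)) {Leaf.aux h}
  have hs : Pairwise fun i j => Disjoint (s i) (s j) := by
    have h1 : ∀ j, Disjoint (s (Fin.castSucc j)) (s (Fin.last a)) := by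
      intro j
      simp only [s, Fin.snoc_castSucc, Fin.snoc_last, Set.disjoint_singleton_right]
      rintro ⟨l, hl⟩
      cases hl
    intro i
    refine Fin.lastCases ?_ (fun i => ?_) i
    · intro j
      refine Fin.lastCases (fun hj => (hj rfl).elim) (fun j _ => (h1 j).symm) j
    · intro j
      refine Fin.lastCases (fun _ => h1 i) (fun j hj => ?_) j
      simp only [s, Fin.snoc_castSucc]
      rw [Set.disjoint_left]
      rintro _ ⟨l, rfl⟩ ⟨l', hl'⟩
      refine hj (congrArg _ ?_)
      cases hl'
      rfl
  have hach : ∀ i, Achievable (Leaf.program S P₀ Paux) (g i) (c i) d (s i) := by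
    intro i
    refine Fin.lastCases ?_ (fun j => ?_) i
    · simp only [g, c, s, Fin.snoc_last]
      exact ⟨leaf ⟨Leaf.aux h, 1, one_pos, false⟩, Nat.zero_le _, List.nodup_singleton _,
        fun b hb => List.mem_singleton.1 hb, p₁, q₁, hp₁, hq₁, hb₁, le_rfl⟩
    · simp only [g, c, s, Fin.snoc_castSucc]
      refine ⟨(T j).map (Lab.map (Leaf.step h j)), ?_, ?_, ?_, p' j, q' j, hp' j, hq' j,
        Bounded.map_leaf (g := Leaf.step h j) (P' := Leaf.program S P₀ Paux) (fun _ => rfl)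
          (hb j), le_rfl⟩
      · rw [depth_map]
        exact Finset.le_sup (f := fun j => (T j).depth) (Finset.mem_univ j)
      · rw [support_map_leaf]
        refine (hnd j).map ?_
        intro l l' hl
        cases hl
        rfl
      · rw [support_map_leaf]
        intro b hb
        obtain ⟨l, -, rfl⟩ := List.mem_map.1 hb
        exact ⟨l, rfl⟩
  obtain ⟨τ, h1, h2, -, P, Q, hP, hQ, h4, h5⟩ := Achievable.formula g c d (Nat.clog 2 (a + 1)) s hs
    (by simpa using Nat.le_pow_clog one_lt_two (a + 1)) hach (S.φ m p)
    fun i => (S.readOnce m p i).le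
  have hf : (fun x => (S.φ m p).eval fun i => g i x) = S.f m p :=
    funext fun x => (S.f_eq m h p x).symm
  rw [hf] at h4
  obtain ⟨h6, h7⟩ := h4.program hP
  refine ⟨τ, h2, h6, h7.trans ((ENNReal.ofReal_le_ofReal h5).trans_eq ?_), h1.trans ?_⟩
  · simp only [show ∀ i, (S.φ m p).occurrences i = 1 from S.readOnce m p, Nat.cast_one, one_mul,
      Fin.sum_univ_castSucc, c, Fin.snoc_castSucc, Fin.snoc_last, hC]
    rw [ENNReal.ofReal_add (Finset.sum_nonneg fun j _ => mul_nonneg (hp' j) (hq' j))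
      (mul_nonneg hp₁ hq₁), ENNReal.ofReal_sum_of_nonneg fun j _ => mul_nonneg (hp' j) (hq' j),
      ← hC₁]
    rfl
  · gcongr

open Classical in
/-- The trees of the compositions. -/
def trees (δ : ℕ) (m : ℕ) (p : Λ) : SPTree (Lab (S.Leaf m p)) :=
  if h : S.m₀ ≤ m then
    -- The choice is made inside the recursion, so that the complexity bound of each tree refers to
    -- the very trees chosen for its subproblems. The default is never reached, by `isStep_trees`.
    if h' : ∃ τ, S.IsStep P₀ Paux δ m p (fun j => trees δ (S.size m p j) (S.param m p j)) τ then
      h'.choose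
    else leaf ⟨Leaf.aux h, 1, one_pos, false⟩
  else leaf ⟨Leaf.base (not_le.1 h), 1, one_pos, false⟩
termination_by m
decreasing_by all_goals exact S.size_lt m h p j

theorem trees_of_lt (δ : ℕ) {m : ℕ} (p : Λ) (h : m < S.m₀) :
    S.trees P₀ Paux δ m p = leaf ⟨Leaf.base h, 1, one_pos, false⟩ := by
  rw [trees, dif_neg (not_le.2 h)]

variable {P₀ Paux} in
theorem isStep_trees [Finite A] {δ : ℕ} (hδ : ∀ m p, (S.φ m p).depth ≤ δ)
    (haux : ∀ m p, (Paux m p).Computes (S.faux m p))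
    (h₀ : ∀ m, m < S.m₀ → ∀ p, (P₀ m p).Computes (S.f m p)) (m : ℕ) (h : S.m₀ ≤ m) (p : Λ) :
    S.IsStep P₀ Paux δ m p (fun j => S.trees P₀ Paux δ (S.size m p j) (S.param m p j))
      (S.trees P₀ Paux δ m p) := by
  induction m using Nat.strong_induction_on generalizing p with
  | _ m ih =>
    have hex : ∃ τ, S.IsStep P₀ Paux δ m p
        (fun j => S.trees P₀ Paux δ (S.size m p j) (S.param m p j)) τ := by
      refine S.exists_isStep h (hδ m p) (haux m p) _ (fun j => ?_) (fun j => ?_)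
      · by_cases hj : S.m₀ ≤ S.size m p j
        · exact (ih _ (S.size_lt m h p j) hj _).1
        · rw [S.trees_of_lt P₀ Paux δ _ (not_le.1 hj)]
          exact List.nodup_singleton _
      · by_cases hj : S.m₀ ≤ S.size m p j
        · rw [treeProgram, if_neg (not_lt.2 hj)]
          exact exists_bounded_of_computes (ih _ (S.size_lt m h p j) hj _).2.1
        · rw [treeProgram, if_pos (not_le.1 hj), S.trees_of_lt P₀ Paux δ _ (not_le.1 hj)]
          exact exists_bounded_leaf (P := Leaf.program S P₀ Paux) (Leaf.base (not_le.1 hj))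
            (h₀ _ (not_le.1 hj) _)
    rw [trees, dif_pos h, dif_pos hex]
    exact hex.choose_spec

end DivideAndConquer

/-! ### Controlled rotations and their action on flow states -/

namespace QROM

variable {T : ℕ}

/-- Bit `t` of a bit string, `false` outside the string. -/
def bit (z : Basis T) (t : ℕ) : Bool := if h : t < T then z ⟨t, h⟩ else false

/-- The bit string with bit `t` flipped. -/
def flipBit (t : ℕ) (z : Basis T) : Basis T := fun i => if i.val = t then !z i else z i

theorem flip_flip (t : ℕ) (z : Basis T) : flipBit t (flipBit t z) = z := by
  funext i
  simp only [flipBit]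
  split_ifs <;> simp

theorem bit_flip_self {t : ℕ} (h : t < T) (z : Basis T) : bit (flipBit t z) t = !bit z t := by
  simp [bit, flipBit, h]

theorem bit_flip_of_ne {s t : ℕ} (h : s ≠ t) (z : Basis T) : bit (flipBit t z) s = bit z s := by
  simp [bit, flipBit, h]

theorem flip_ne {t : ℕ} (h : t < T) (z : Basis T) : flipBit t z ≠ z := by
  intro h'
  have := bit_flip_self h z
  rw [h'] at this
  simp at this

/-- The rotation of qubit `t` by an angle that depends on the other qubits. -/
def rot (t : ℕ) (θ : Basis T → ℝ) : (Basis T → ℂ) →ₗ[ℂ] (Basis T → ℂ) where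
  toFun v z := Real.cos (θ z) * v z +
    ((if bit z t then Real.sin (θ z) else -Real.sin (θ z) : ℝ) : ℂ) * v (flipBit t z)
  map_add' v w := by
    funext z
    simp only [Pi.add_apply]
    ring
  map_smul' c v := by
    funext z
    simp only [Pi.smul_apply, smul_eq_mul, RingHom.id_apply]
    ring

theorem rot_apply (t : ℕ) (θ : Basis T → ℝ) (v : Basis T → ℂ) (z : Basis T) :
    rot t θ v z = Real.cos (θ z) * v z +
      ((if bit z t then Real.sin (θ z) else -Real.sin (θ z) : ℝ) : ℂ) * v (flipBit t z) := rfl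

/-- The product of the rotations of the qubits `t, …, t + n - 1`, applied in this order. -/
def rotSeq (θ : ℕ → Basis T → ℝ) : ℕ → ℕ → (Basis T → ℂ) →ₗ[ℂ] (Basis T → ℂ)
  | _, 0 => LinearMap.id
  | t, n + 1 => rotSeq θ (t + 1) n ∘ₗ rot t (θ t)

theorem rot_single {t : ℕ} (ht : t < T) {θ : Basis T → ℝ} {y : Basis T}
    (hθ : θ (flipBit t y) = θ y) : rot t θ (Pi.single y 1) =
      ((Real.cos (θ y) : ℝ) : ℂ) • Pi.single y (1 : ℂ) +
      ((if bit y t then -Real.sin (θ y) else Real.sin (θ y) : ℝ) : ℂ) •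
        Pi.single (flipBit t y) (1 : ℂ) := by
  funext z
  simp only [rot_apply, Pi.add_apply, Pi.smul_apply, smul_eq_mul]
  have hne := flip_ne ht y
  by_cases h1 : z = y
  · subst h1
    simp [hne, Ne.symm hne]
  by_cases h2 : z = flipBit t y
  · subst h2
    simp [hne, flip_flip, hθ, bit_flip_self ht]
    cases bit y t <;> simp
  · have h3 : flipBit t z ≠ y := fun h => h2 (by rw [← h, flip_flip])
    simp [h1, h2, h3]

/-- Locality: rotations of the qubits from `t` on do not leave a set of strings that is closed under
flipping those bits. It is applied to the two halves given by the value of an earlier bit. -/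
theorem rotSeq_congr {θ θ' : ℕ → Basis T → ℝ} (Z : Set (Basis T)) (t n : ℕ)
    (hZ : ∀ s, t ≤ s → ∀ z ∈ Z, flipBit s z ∈ Z) (hθ : ∀ s, t ≤ s → ∀ z ∈ Z, θ s z = θ' s z)
    {v v' : Basis T → ℂ} (hv : ∀ z ∈ Z, v z = v' z) :
    ∀ z ∈ Z, rotSeq θ t n v z = rotSeq θ' t n v' z := by
  induction n generalizing t v v' with
  | zero => exact hv
  | succ n ih =>
    refine ih (t + 1) (fun s hs => hZ s (by omega)) (fun s hs => hθ s (by omega)) ?_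
    intro z hz
    rw [rot_apply, rot_apply, hθ t le_rfl z hz, hv z hz, hv _ (hZ t le_rfl z hz)]

theorem rotSeq_zero (t n : ℕ) (v : Basis T → ℂ) : rotSeq (fun _ _ => 0) t n v = v := by
  induction n generalizing t v with
  | zero => rfl
  | succ n ih =>
    rw [rotSeq, LinearMap.comp_apply, ih]
    funext z
    simp [rot_apply]

/-- The angles of a node at level `t`: the node itself rotates by `θ`, provided that all later bits
vanish; then bit `t` selects one of the subtrees. -/
def nodeAngle (t : ℕ) (θ : ℝ) (θ₁ θ₂ : ℕ → Basis T → ℝ) (s : ℕ) (z : Basis T) : ℝ :=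
  open Classical in
  if s = t then (if ∀ j, t < j → bit z j = false then θ else 0)
  else if bit z t then θ₂ s z else θ₁ s z

section nodeAngle

variable {t n : ℕ} {θ : ℝ} {θ₁ θ₂ : ℕ → Basis T → ℝ}

theorem nodeAngle_flip (h₁ : ∀ s z, θ₁ s (flipBit s z) = θ₁ s z)
    (h₂ : ∀ s z, θ₂ s (flipBit s z) = θ₂ s z) (s : ℕ) (z : Basis T) :
    nodeAngle t θ θ₁ θ₂ s (flipBit s z) = nodeAngle t θ θ₁ θ₂ s z := by
  unfold nodeAngle
  by_cases h : s = t
  · subst h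
    have : ∀ j, s < j → bit (flipBit s z) j = bit z j := fun j hj => bit_flip_of_ne hj.ne' z
    rw [if_pos rfl, if_pos rfl]
    congr 1
    exact propext (forall₂_congr fun j hj => by rw [this j hj])
  · rw [if_neg h, if_neg h, bit_flip_of_ne (Ne.symm h), h₁, h₂]

theorem abs_nodeAngle_le (hθ : |θ| ≤ 2) (h₁ : ∀ s z, |θ₁ s z| ≤ 2) (h₂ : ∀ s z, |θ₂ s z| ≤ 2)
    (s : ℕ) (z : Basis T) : |nodeAngle t θ θ₁ θ₂ s z| ≤ 2 := by
  unfold nodeAngle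
  split_ifs
  · exact hθ
  · simp
  · exact h₂ s z
  · exact h₁ s z

theorem rotSeq_nodeAngle_single (y : Basis T) :
    rotSeq (nodeAngle t θ θ₁ θ₂) (t + 1) n (Pi.single y 1) =
      rotSeq (if bit y t then θ₂ else θ₁) (t + 1) n (Pi.single y 1) := by
  have hflip : ∀ b : Bool, ∀ s, t + 1 ≤ s → ∀ z ∈ {z : Basis T | bit z t = b},
      flipBit s z ∈ {z : Basis T | bit z t = b} := fun b s hs z hz =>
    (bit_flip_of_ne (by omega) z).trans hz
  funext z
  by_cases hz : bit z t = bit y t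
  · refine rotSeq_congr {z | bit z t = bit y t} (t + 1) n (hflip _) ?_ (fun _ _ => rfl) z hz
    intro s hs z hz
    have hz' : bit z t = bit y t := hz
    rw [nodeAngle, if_neg (by omega), hz']
    cases bit y t <;> rfl
  · have hz' : bit z t = !bit y t := by
      revert hz
      cases bit z t <;> cases bit y t <;> simp
    have hv : ∀ z ∈ {z : Basis T | bit z t = !bit y t}, (Pi.single y 1 : Basis T → ℂ) z =
        (0 : Basis T → ℂ) z := by
      intro z hz
      refine Pi.single_eq_of_ne ?_ _
      rintro rfl
      have hz' : bit z t = !bit z t := hz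
      simp at hz'
    rw [rotSeq_congr (θ' := nodeAngle t θ θ₁ θ₂) _ (t + 1) n (hflip (!bit y t))
        (fun _ _ _ _ => rfl) hv z hz',
      rotSeq_congr (θ' := if bit y t then θ₂ else θ₁) _ (t + 1) n (hflip (!bit y t))
        (fun _ _ _ _ => rfl) hv z hz', map_zero, map_zero]

/-- The first rotation is idle here, so the vectors produced inside a subtree by nonzero strings are
inherited unchanged by the larger tree. -/
theorem rotSeq_nodeAngle_of_later (ht : t < T) {y : Basis T} (hy : ∃ s, t < s ∧ bit y s = true) :
    rotSeq (nodeAngle t θ θ₁ θ₂) t (n + 1) (Pi.single y 1) =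
      rotSeq (if bit y t then θ₂ else θ₁) (t + 1) n (Pi.single y 1) := by
  obtain ⟨s, hs, hs'⟩ := hy
  have h0 : ∀ z : Basis T, bit z s = true → nodeAngle t θ θ₁ θ₂ t z = 0 := by
    intro z hz
    rw [nodeAngle, if_pos rfl, if_neg]
    intro h
    rw [h s hs] at hz
    exact Bool.false_ne_true hz
  have h1 : nodeAngle t θ θ₁ θ₂ t (flipBit t y) = nodeAngle t θ θ₁ θ₂ t y := by
    rw [h0 y hs', h0 _ ((bit_flip_of_ne hs.ne' y).trans hs')]
  rw [rotSeq, LinearMap.comp_apply, rot_single ht h1, h0 y hs', ← rotSeq_nodeAngle_single (θ := θ)]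
  simp

/-- The two strings that vanish after bit `t` are the only ones mixed by the new rotation: they give
the flow state of the node and the one new vector orthogonal to it. -/
theorem rotSeq_nodeAngle_of_zero (ht : t < T) {β : Basis T} (hβ : ∀ s, t ≤ s → bit β s = false) :
    rotSeq (nodeAngle t θ θ₁ θ₂) t (n + 1) (Pi.single β 1) =
      ((Real.cos θ : ℝ) : ℂ) • rotSeq θ₁ (t + 1) n (Pi.single β 1) +
      ((Real.sin θ : ℝ) : ℂ) • rotSeq θ₂ (t + 1) n (Pi.single (flipBit t β) 1) ∧
    rotSeq (nodeAngle t θ θ₁ θ₂) t (n + 1) (Pi.single (flipBit t β) 1) =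
      ((-Real.sin θ : ℝ) : ℂ) • rotSeq θ₁ (t + 1) n (Pi.single β 1) +
      ((Real.cos θ : ℝ) : ℂ) • rotSeq θ₂ (t + 1) n (Pi.single (flipBit t β) 1) := by
  have a1 : nodeAngle t θ θ₁ θ₂ t β = θ := by
    rw [nodeAngle, if_pos rfl, if_pos fun j hj => hβ j hj.le]
  have a2 : nodeAngle t θ θ₁ θ₂ t (flipBit t β) = θ := by
    rw [nodeAngle, if_pos rfl, if_pos fun j hj => (bit_flip_of_ne hj.ne' β).trans (hβ j hj.le)]
  have b1 : bit β t = false := hβ t le_rfl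
  have b2 : bit (flipBit t β) t = true := by rw [bit_flip_self ht, b1]; rfl
  constructor
  · rw [rotSeq, LinearMap.comp_apply, rot_single ht (a2.trans a1.symm), map_add, map_smul,
      map_smul, rotSeq_nodeAngle_single, rotSeq_nodeAngle_single, a1, b1, b2]
    simp
  · rw [rotSeq, LinearMap.comp_apply, rot_single ht (by rw [flip_flip, a1, a2]), map_add, map_smul,
      map_smul, flip_flip, rotSeq_nodeAngle_single, rotSeq_nodeAngle_single, a2, b1, b2,
      add_comm]
    simp

end nodeAngle

/-- The state on `T` qubits that encodes `ψ`, if the basis states are encoded by `pl`. -/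
def spread {E : Type} [Fintype E] (pl : E → Basis T) : (E → ℂ) →ₗ[ℂ] (Basis T → ℂ) :=
  Fintype.linearCombination ℂ fun e => Pi.single (pl e) 1

/-- The weighted vector of a circulation. -/
def IsCirc {E : Type} (F : ℂ → (E → ℂ) → Prop) (w : E → ℝ) (ψ : E → ℂ) : Prop :=
  ∃ f, F 0 f ∧ ∀ e, ψ e = f e * w e

/-- Orthogonality to the weighted vectors of all flows. -/
def IsFlowOrth {E : Type} [Fintype E] (F : ℂ → (E → ℂ) → Prop) (w : E → ℝ) (ψ : E → ℂ) : Prop :=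
  ∀ c f, F c f → ∑ e, starRingEnd ℂ (ψ e) * (f e * w e) = 0

/-- Rotations of the qubits `t, …, t + n - 1` that generate the weighted vectors of the flows `F`
from basis states. Here `φ` is the normalised minimal flow and `ρ ^ 2` the effective resistance. -/
structure FlowCircuit (T : ℕ) {E : Type} [Fintype E] (F : ℂ → (E → ℂ) → Prop) (w : E → ℝ)
    (pl : Basis T → E → Basis T) (t n : ℕ) where
  ρ : ℝ
  φ : E → ℂ
  ang : ℕ → Basis T → ℝ
  ρ_pos : 0 < ρ
  abs_ang_le : ∀ s z, |ang s z| ≤ 2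
  ang_flip : ∀ s z, ang s (flipBit s z) = ang s z
  flow_smul : ∀ k c f, F c f → F (k * c) fun e => k * f e
  φ_flow : ∃ f, F ((ρ⁻¹ : ℝ) : ℂ) f ∧ ∀ e, φ e = f e * w e
  φ_inner : ∀ c f, F c f → ∑ e, starRingEnd ℂ (φ e) * (f e * w e) = c * ρ
  zero_state : ∀ β, (∀ s, t ≤ s → bit β s = false) →
    rotSeq ang t n (Pi.single β 1) = spread (pl β) φ
  span_eq : ∀ β, (∀ s, t ≤ s → bit β s = false) →
    Submodule.span ℂ ({φ} ∪ {ψ | (IsCirc F w ψ ∨ IsFlowOrth F w ψ) ∧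
      ∃ z, (∀ s, s < t → bit z s = bit β s) ∧ (∃ s, t ≤ s ∧ bit z s = true) ∧
        rotSeq ang t n (Pi.single z 1) = spread (pl β) ψ}) = ⊤

end QROM

/-! ### Combining the circuits of two subgraphs -/

namespace QROM

variable {T : ℕ} {E₁ E₂ : Type} [Fintype E₁] [Fintype E₂]

theorem spread_apply {E : Type} [Fintype E] (pl : E → Basis T) (ψ : E → ℂ) :
    spread pl ψ = ∑ e, ψ e • (Pi.single (pl e) 1 : Basis T → ℂ) := rfl

theorem spread_sumElim (p₁ : E₁ → Basis T) (p₂ : E₂ → Basis T) (ψ₁ : E₁ → ℂ) (ψ₂ : E₂ → ℂ) :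
    spread (Sum.elim p₁ p₂) (Sum.elim ψ₁ ψ₂) = spread p₁ ψ₁ + spread p₂ ψ₂ := by
  simp [spread_apply, Fintype.sum_sum_type]

theorem exists_angle {a b : ℝ} (ha : 0 < a) (hb : 0 < b) :
    ∃ ρ θ : ℝ, 0 < ρ ∧ |θ| ≤ 2 ∧ Real.cos θ * ρ = a ∧ Real.sin θ * ρ = b := by
  have hρ : 0 < Real.sqrt (a ^ 2 + b ^ 2) := Real.sqrt_pos.2 (by positivity)
  have hsq : Real.sqrt (a ^ 2 + b ^ 2) ^ 2 = a ^ 2 + b ^ 2 := Real.sq_sqrt (by positivity)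
  set ρ := Real.sqrt (a ^ 2 + b ^ 2)
  have h0 : 0 ≤ a / ρ := by positivity
  have h1 : a / ρ ≤ 1 := by
    rw [div_le_one hρ]
    exact Real.le_sqrt_of_sq_le (by nlinarith)
  refine ⟨ρ, Real.arccos (a / ρ), hρ, ?_, ?_, ?_⟩
  · rw [abs_of_nonneg (Real.arccos_nonneg _)]
    have := Real.arccos_le_pi_div_two.2 h0
    linarith [Real.pi_le_four]
  · rw [Real.cos_arccos (by linarith) h1]
    field_simp
  · rw [Real.sin_arccos, show 1 - (a / ρ) ^ 2 = (b / ρ) ^ 2 by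
      field_simp
      linarith, Real.sqrt_sq (by positivity)]
    field_simp

namespace FlowCircuit

theorem zero_flow {E : Type} [Fintype E] {F : ℂ → (E → ℂ) → Prop} {w : E → ℝ}
    {pl : Basis T → E → Basis T} {t n : ℕ} (C : FlowCircuit T F w pl t n) : F 0 fun _ => 0 := by
  obtain ⟨f, hf, -⟩ := C.φ_flow
  simpa using C.flow_smul 0 _ _ hf

/-- Two circuits are combined by a rotation of qubit `t` that selects one of them. -/
def node {F₁ : ℂ → (E₁ → ℂ) → Prop} {F₂ : ℂ → (E₂ → ℂ) → Prop} {w : E₁ ⊕ E₂ → ℝ}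
    {p₁ : Basis T → E₁ → Basis T} {p₂ : Basis T → E₂ → Basis T} {t n : ℕ} (ht : t < T)
    (C₁ : FlowCircuit T F₁ (fun e => w (Sum.inl e)) p₁ (t + 1) n)
    (C₂ : FlowCircuit T F₂ (fun e => w (Sum.inr e)) p₂ (t + 1) n)
    (F : ℂ → (E₁ ⊕ E₂ → ℂ) → Prop) (ρ θ : ℝ) (hρ : 0 < ρ) (hθ : |θ| ≤ 2)
    (smul : ∀ k c f, F c f → F (k * c) fun e => k * f e)
    (restrict : ∀ c f, F c f →
      (∃ c₁, F₁ c₁ fun e => f (Sum.inl e)) ∧ ∃ c₂, F₂ c₂ fun e => f (Sum.inr e))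
    (lift : ∀ f₁ f₂, F₁ 0 f₁ → F₂ 0 f₂ → F 0 (Sum.elim f₁ f₂))
    (φ_flow : ∃ f, F ((ρ⁻¹ : ℝ) : ℂ) f ∧ ∀ e, (Sum.elim (((Real.cos θ : ℝ) : ℂ) • C₁.φ)
      (((Real.sin θ : ℝ) : ℂ) • C₂.φ) : E₁ ⊕ E₂ → ℂ) e = f e * w e)
    (φ_inner : ∀ c f, F c f → ∑ e, starRingEnd ℂ ((Sum.elim (((Real.cos θ : ℝ) : ℂ) • C₁.φ)
      (((Real.sin θ : ℝ) : ℂ) • C₂.φ) : E₁ ⊕ E₂ → ℂ) e) * (f e * w e) = c * ρ)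
    (top : IsCirc F w (Sum.elim (((-Real.sin θ : ℝ) : ℂ) • C₁.φ)
        (((Real.cos θ : ℝ) : ℂ) • C₂.φ)) ∨
      IsFlowOrth F w (Sum.elim (((-Real.sin θ : ℝ) : ℂ) • C₁.φ)
        (((Real.cos θ : ℝ) : ℂ) • C₂.φ))) :
    FlowCircuit T F w (fun β => Sum.elim (p₁ β) (p₂ (flipBit t β))) t (n + 1) where
  ρ := ρ
  φ := Sum.elim (((Real.cos θ : ℝ) : ℂ) • C₁.φ) (((Real.sin θ : ℝ) : ℂ) • C₂.φ)
  ang := nodeAngle t θ C₁.ang C₂.ang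
  ρ_pos := hρ
  abs_ang_le := abs_nodeAngle_le hθ C₁.abs_ang_le C₂.abs_ang_le
  ang_flip := nodeAngle_flip C₁.ang_flip C₂.ang_flip
  flow_smul := smul
  φ_flow := φ_flow
  φ_inner := φ_inner
  zero_state β hβ := by
    have hβ' : ∀ s, t + 1 ≤ s → bit (flipBit t β) s = false := fun s hs =>
      (bit_flip_of_ne (by omega) β).trans (hβ s (by omega))
    rw [(rotSeq_nodeAngle_of_zero ht hβ).1, C₁.zero_state β fun s hs => hβ s (by omega),
      C₂.zero_state _ hβ', spread_sumElim, map_smul, map_smul]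
  span_eq β hβ := by
    have hβ₁ : ∀ s, t + 1 ≤ s → bit β s = false := fun s hs => hβ s (by omega)
    have hβ₂ : ∀ s, t + 1 ≤ s → bit (flipBit t β) s = false := fun s hs =>
      (bit_flip_of_ne (by omega) β).trans (hβ s (by omega))
    have b1 : bit β t = false := hβ t le_rfl
    have b2 : bit (flipBit t β) t = true := by rw [bit_flip_self ht, b1]; rfl
    set M := Submodule.span ℂ ({Sum.elim (((Real.cos θ : ℝ) : ℂ) • C₁.φ)
      (((Real.sin θ : ℝ) : ℂ) • C₂.φ)} ∪ {ψ | (IsCirc F w ψ ∨ IsFlowOrth F w ψ) ∧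
        ∃ z, (∀ s, s < t → bit z s = bit β s) ∧ (∃ s, t ≤ s ∧ bit z s = true) ∧
          rotSeq (nodeAngle t θ C₁.ang C₂.ang) t (n + 1) (Pi.single z 1) =
            spread (Sum.elim (p₁ β) (p₂ (flipBit t β))) ψ}) with hM
    have m1 : (Sum.elim (((Real.cos θ : ℝ) : ℂ) • C₁.φ)
        (((Real.sin θ : ℝ) : ℂ) • C₂.φ) : E₁ ⊕ E₂ → ℂ) ∈ M :=
      Submodule.subset_span (Or.inl rfl)
    have m2 : (Sum.elim (((-Real.sin θ : ℝ) : ℂ) • C₁.φ)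
        (((Real.cos θ : ℝ) : ℂ) • C₂.φ) : E₁ ⊕ E₂ → ℂ) ∈ M := by
      refine Submodule.subset_span (Or.inr ⟨top, flipBit t β, ?_, ⟨t, le_rfl, b2⟩, ?_⟩)
      · exact fun s hs => bit_flip_of_ne hs.ne β
      · rw [(rotSeq_nodeAngle_of_zero ht hβ).2, C₁.zero_state β hβ₁, C₂.zero_state _ hβ₂,
          spread_sumElim, map_smul, map_smul]
    have hcs : ((Real.cos θ : ℝ) : ℂ) * (Real.cos θ : ℝ) +
        ((Real.sin θ : ℝ) : ℂ) * (Real.sin θ : ℝ) = 1 := by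
      exact_mod_cast (by nlinarith [Real.sin_sq_add_cos_sq θ] :
        Real.cos θ * Real.cos θ + Real.sin θ * Real.sin θ = 1)
    -- Undoing the rotation by `θ` recovers the flow states of the two children from the two vectors
    -- `m1` and `m2`.
    have l1 : (Sum.elim C₁.φ 0 : E₁ ⊕ E₂ → ℂ) ∈ M := by
      convert M.sub_mem (M.smul_mem ((Real.cos θ : ℝ) : ℂ) m1)
        (M.smul_mem ((Real.sin θ : ℝ) : ℂ) m2) using 1
      funext e
      rcases e with e | e
      · simp only [Sum.elim_inl, Pi.sub_apply, Pi.smul_apply, smul_eq_mul, Complex.ofReal_neg]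
        linear_combination -(C₁.φ e) * hcs
      · simp only [Sum.elim_inr, Pi.sub_apply, Pi.smul_apply, smul_eq_mul, Pi.zero_apply]
        ring
    have l2 : (Sum.elim 0 C₂.φ : E₁ ⊕ E₂ → ℂ) ∈ M := by
      convert M.add_mem (M.smul_mem ((Real.sin θ : ℝ) : ℂ) m1)
        (M.smul_mem ((Real.cos θ : ℝ) : ℂ) m2) using 1
      funext e
      rcases e with e | e
      · simp only [Sum.elim_inl, Pi.add_apply, Pi.smul_apply, smul_eq_mul, Complex.ofReal_neg,
          Pi.zero_apply]
        ring
      · simp only [Sum.elim_inr, Pi.add_apply, Pi.smul_apply, smul_eq_mul]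
        linear_combination -(C₂.φ e) * hcs
    -- The spanning set of the child, extended by zero, lies in `M`: circulations stay circulations
    -- by `lift`, and vectors orthogonal to flows stay so by `restrict`.
    have k1 : ∀ ψ : E₁ → ℂ, (Sum.elim ψ 0 : E₁ ⊕ E₂ → ℂ) ∈ M := by
      intro ψ
      let L : (E₁ → ℂ) →ₗ[ℂ] (E₁ ⊕ E₂ → ℂ) :=
        { toFun := fun ψ => Sum.elim ψ 0
          map_add' := fun _ _ => by funext e; rcases e with e | e <;> simp
          map_smul' := fun _ _ => by funext e; rcases e with e | e <;> simp }
      have : (⊤ : Submodule ℂ (E₁ → ℂ)) ≤ M.comap L := by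
        rw [← C₁.span_eq β hβ₁, Submodule.span_le]
        rintro ψ (rfl | ⟨h, z, hz1, ⟨s, hs, hs'⟩, hz3⟩)
        · exact l1
        · refine Submodule.subset_span (Or.inr ⟨?_, z, fun s hs => hz1 s (by omega),
            ⟨s, by omega, hs'⟩, ?_⟩)
          · rcases h with ⟨f, hf, hψ⟩ | h
            · refine Or.inl ⟨_, lift f _ hf C₂.zero_flow, ?_⟩
              rintro (e | e)
              exacts [hψ e, (zero_mul _).symm]
            · refine Or.inr fun c f hf => ?_
              obtain ⟨⟨c₁, h₁⟩, -⟩ := restrict c f hf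
              rw [Fintype.sum_sum_type]
              simpa [L] using h c₁ _ h₁
          · have : bit z t = false := (hz1 t (by omega)).trans b1
            rw [rotSeq_nodeAngle_of_later ht ⟨s, by omega, hs'⟩, this]
            refine hz3.trans ?_
            change _ = spread (Sum.elim (p₁ β) (p₂ (flipBit t β))) (Sum.elim ψ 0)
            rw [spread_sumElim, map_zero, add_zero]
      exact this (Submodule.mem_top : ψ ∈ _)
    have k2 : ∀ ψ : E₂ → ℂ, (Sum.elim 0 ψ : E₁ ⊕ E₂ → ℂ) ∈ M := by
      intro ψ
      let L : (E₂ → ℂ) →ₗ[ℂ] (E₁ ⊕ E₂ → ℂ) :=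
        { toFun := fun ψ => Sum.elim 0 ψ
          map_add' := fun _ _ => by funext e; rcases e with e | e <;> simp
          map_smul' := fun _ _ => by funext e; rcases e with e | e <;> simp }
      have : (⊤ : Submodule ℂ (E₂ → ℂ)) ≤ M.comap L := by
        rw [← C₂.span_eq (flipBit t β) hβ₂, Submodule.span_le]
        rintro ψ (rfl | ⟨h, z, hz1, ⟨s, hs, hs'⟩, hz3⟩)
        · exact l2
        · refine Submodule.subset_span (Or.inr ⟨?_, z, fun s hs =>
            (hz1 s (by omega)).trans (bit_flip_of_ne hs.ne β), ⟨s, by omega, hs'⟩, ?_⟩)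
          · rcases h with ⟨f, hf, hψ⟩ | h
            · refine Or.inl ⟨_, lift _ f C₁.zero_flow hf, ?_⟩
              rintro (e | e)
              exacts [(zero_mul _).symm, hψ e]
            · refine Or.inr fun c f hf => ?_
              obtain ⟨-, ⟨c₂, h₂⟩⟩ := restrict c f hf
              rw [Fintype.sum_sum_type]
              simpa [L] using h c₂ _ h₂
          · have : bit z t = true := (hz1 t (by omega)).trans b2
            rw [rotSeq_nodeAngle_of_later ht ⟨s, by omega, hs'⟩, this]
            refine hz3.trans ?_
            change _ = spread (Sum.elim (p₁ β) (p₂ (flipBit t β))) (Sum.elim 0 ψ)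
            rw [spread_sumElim, map_zero, zero_add]
      exact this (Submodule.mem_top : ψ ∈ _)
    rw [eq_top_iff]
    intro ψ _
    convert M.add_mem (k1 fun e => ψ (Sum.inl e)) (k2 fun e => ψ (Sum.inr e)) using 1
    funext e
    rcases e with e | e <;> simp

theorem inner_sumElim (a b : ℝ) (φ₁ : E₁ → ℂ) (φ₂ : E₂ → ℂ) (g : E₁ ⊕ E₂ → ℂ) :
    ∑ e, starRingEnd ℂ ((Sum.elim ((a : ℂ) • φ₁) ((b : ℂ) • φ₂) : E₁ ⊕ E₂ → ℂ) e) * g e =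
      a * ∑ e, starRingEnd ℂ (φ₁ e) * g (Sum.inl e) +
      b * ∑ e, starRingEnd ℂ (φ₂ e) * g (Sum.inr e) := by
  simp [Fintype.sum_sum_type, Finset.mul_sum, mul_assoc]

variable {F₁ : ℂ → (E₁ → ℂ) → Prop} {F₂ : ℂ → (E₂ → ℂ) → Prop} {w : E₁ ⊕ E₂ → ℝ}
  {p₁ : Basis T → E₁ → Basis T} {p₂ : Basis T → E₂ → Basis T} {t n : ℕ}

/-- Conductances add: with `σ = 1 / ρ` one has `σ ^ 2 = ρ₁⁻² + ρ₂⁻²`, `cos θ = ρ₁⁻¹ / σ` and `sin θ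
= ρ₂⁻¹ / σ`. The second combination has flow value `-sin θ / ρ₁ + cos θ / ρ₂ = 0`, so it is a
circulation. -/
theorem par (ht : t < T)
    (h₁ : Nonempty (FlowCircuit T F₁ (fun e => w (Sum.inl e)) p₁ (t + 1) n))
    (h₂ : Nonempty (FlowCircuit T F₂ (fun e => w (Sum.inr e)) p₂ (t + 1) n)) :
    Nonempty (FlowCircuit T (fun c f => ∃ c₁ c₂, c₁ + c₂ = c ∧ F₁ c₁ (fun e => f (Sum.inl e)) ∧
      F₂ c₂ (fun e => f (Sum.inr e))) w (fun β => Sum.elim (p₁ β) (p₂ (flipBit t β))) t (n + 1)) := by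
  obtain ⟨C₁⟩ := h₁
  obtain ⟨C₂⟩ := h₂
  obtain ⟨σ, θ, hσ, hθ, hcos, hsin⟩ := exists_angle (inv_pos.2 C₁.ρ_pos) (inv_pos.2 C₂.ρ_pos)
  have r1 : ((Real.cos θ : ℝ) : ℂ) * C₁.ρ = ((σ⁻¹ : ℝ) : ℂ) := by
    have : Real.cos θ * C₁.ρ = σ⁻¹ := by
      have := C₁.ρ_pos
      field_simp at hcos ⊢
      linarith
    exact_mod_cast this
  have r2 : ((Real.sin θ : ℝ) : ℂ) * C₂.ρ = ((σ⁻¹ : ℝ) : ℂ) := by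
    have : Real.sin θ * C₂.ρ = σ⁻¹ := by
      have := C₂.ρ_pos
      field_simp at hsin ⊢
      linarith
    exact_mod_cast this
  obtain ⟨f₁, hf₁, hφ₁⟩ := C₁.φ_flow
  obtain ⟨f₂, hf₂, hφ₂⟩ := C₂.φ_flow
  refine ⟨node ht C₁ C₂ _ σ⁻¹ θ (inv_pos.2 hσ) hθ ?_ ?_ ?_ ?_ ?_ (Or.inl ?_)⟩
  · rintro k c f ⟨c₁, c₂, rfl, h1, h2⟩
    exact ⟨k * c₁, k * c₂, (mul_add _ _ _).symm, C₁.flow_smul _ _ _ h1, C₂.flow_smul _ _ _ h2⟩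
  · rintro c f ⟨c₁, c₂, -, h1, h2⟩
    exact ⟨⟨c₁, h1⟩, ⟨c₂, h2⟩⟩
  · exact fun g₁ g₂ h1 h2 => ⟨0, 0, zero_add 0, h1, h2⟩
  · refine ⟨Sum.elim (fun e => ((Real.cos θ : ℝ) : ℂ) * f₁ e)
      (fun e => ((Real.sin θ : ℝ) : ℂ) * f₂ e), ⟨_, _, ?_, C₁.flow_smul _ _ _ hf₁,
      C₂.flow_smul _ _ _ hf₂⟩, ?_⟩
    · rw [← hcos, ← hsin, inv_inv]
      have : Real.cos θ * (Real.cos θ * σ) + Real.sin θ * (Real.sin θ * σ) = σ := by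
        linear_combination σ * Real.sin_sq_add_cos_sq θ
      exact_mod_cast this
    · rintro (e | e)
      · simp [hφ₁, mul_assoc]
      · simp [hφ₂, mul_assoc]
  · rintro c f ⟨c₁, c₂, rfl, h1, h2⟩
    rw [inner_sumElim, C₁.φ_inner _ _ h1, C₂.φ_inner _ _ h2]
    linear_combination c₁ * r1 + c₂ * r2
  · refine ⟨Sum.elim (fun e => ((-Real.sin θ : ℝ) : ℂ) * f₁ e)
      (fun e => ((Real.cos θ : ℝ) : ℂ) * f₂ e), ⟨_, _, ?_, C₁.flow_smul _ _ _ hf₁,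
      C₂.flow_smul _ _ _ hf₂⟩, ?_⟩
    · rw [← hcos, ← hsin]
      push_cast
      ring
    · rintro (e | e)
      · simp [hφ₁, mul_assoc]
      · simp [hφ₂, mul_assoc]

/-- Resistances add: `ρ ^ 2 = ρ₁ ^ 2 + ρ₂ ^ 2`, `cos θ = ρ₁ / ρ` and `sin θ = ρ₂ / ρ`, so both parts
carry the flow value `1 / ρ`. The second combination pairs with a flow of value `c` to `c * (-sin θ
* ρ₁ + cos θ * ρ₂) = 0`. -/
theorem ser (ht : t < T)
    (h₁ : Nonempty (FlowCircuit T F₁ (fun e => w (Sum.inl e)) p₁ (t + 1) n))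
    (h₂ : Nonempty (FlowCircuit T F₂ (fun e => w (Sum.inr e)) p₂ (t + 1) n)) :
    Nonempty (FlowCircuit T (fun c f => F₁ c (fun e => f (Sum.inl e)) ∧
      F₂ c (fun e => f (Sum.inr e))) w (fun β => Sum.elim (p₁ β) (p₂ (flipBit t β))) t (n + 1)) := by
  obtain ⟨C₁⟩ := h₁
  obtain ⟨C₂⟩ := h₂
  obtain ⟨ρ, θ, hρ, hθ, hcos, hsin⟩ := exists_angle C₁.ρ_pos C₂.ρ_pos
  have r1 : ((Real.cos θ : ℝ) : ℂ) * ((C₁.ρ⁻¹ : ℝ) : ℂ) = ((ρ⁻¹ : ℝ) : ℂ) := by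
    have : Real.cos θ * C₁.ρ⁻¹ = ρ⁻¹ := by
      have := C₁.ρ_pos
      field_simp
      linarith
    exact_mod_cast this
  have r2 : ((Real.sin θ : ℝ) : ℂ) * ((C₂.ρ⁻¹ : ℝ) : ℂ) = ((ρ⁻¹ : ℝ) : ℂ) := by
    have : Real.sin θ * C₂.ρ⁻¹ = ρ⁻¹ := by
      have := C₂.ρ_pos
      field_simp
      linarith
    exact_mod_cast this
  obtain ⟨f₁, hf₁, hφ₁⟩ := C₁.φ_flow
  obtain ⟨f₂, hf₂, hφ₂⟩ := C₂.φ_flow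
  refine ⟨node ht C₁ C₂ _ ρ θ hρ hθ ?_ ?_ ?_ ?_ ?_ (Or.inr ?_)⟩
  · rintro k c f ⟨h1, h2⟩
    exact ⟨C₁.flow_smul _ _ _ h1, C₂.flow_smul _ _ _ h2⟩
  · rintro c f ⟨h1, h2⟩
    exact ⟨⟨c, h1⟩, ⟨c, h2⟩⟩
  · exact fun g₁ g₂ h1 h2 => ⟨h1, h2⟩
  · refine ⟨Sum.elim (fun e => ((Real.cos θ : ℝ) : ℂ) * f₁ e)
      (fun e => ((Real.sin θ : ℝ) : ℂ) * f₂ e), ⟨?_, ?_⟩, ?_⟩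
    · rw [← r1]
      exact C₁.flow_smul _ _ _ hf₁
    · rw [← r2]
      exact C₂.flow_smul _ _ _ hf₂
    · rintro (e | e)
      · simp [hφ₁, mul_assoc]
      · simp [hφ₂, mul_assoc]
  · rintro c f ⟨h1, h2⟩
    rw [inner_sumElim, C₁.φ_inner _ _ h1, C₂.φ_inner _ _ h2]
    have : Real.cos θ * C₁.ρ + Real.sin θ * C₂.ρ = ρ := by
      rw [← hcos, ← hsin]
      linear_combination ρ * Real.sin_sq_add_cos_sq θ
    rw [← this]
    push_cast
    ring
  · rintro c f ⟨h1, h2⟩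
    rw [inner_sumElim, C₁.φ_inner _ _ h1, C₂.φ_inner _ _ h2, ← hcos, ← hsin]
    push_cast
    ring

end FlowCircuit

end QROM

/-! ### Encoding of edges and the circuit of a tree -/

namespace SPTree

open QROM

variable {α : Type*} {T : ℕ}

/-- The bit string that encodes an edge: the path to its leaf, written from bit `t` on. -/
def place : (τ : SPTree α) → ℕ → Basis T → τ.Edge → Basis T
  | leaf _ => fun _ β _ => β
  | par l r => fun t β => Sum.elim (l.place (t + 1) β) (r.place (t + 1) (flipBit t β))
  | ser l r => fun t β => Sum.elim (l.place (t + 1) β) (r.place (t + 1) (flipBit t β))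

theorem bit_place (τ : SPTree α) {s t : ℕ} (hs : s < t) (β : Basis T) (e : τ.Edge) :
    bit (τ.place t β e) s = bit β s := by
  induction τ generalizing t β with
  | leaf a => rfl
  | par l r hl hr => cases e with
    | inl e => exact hl (by omega) β e
    | inr e => exact (hr (by omega) _ e).trans (bit_flip_of_ne hs.ne β)
  | ser l r hl hr => cases e with
    | inl e => exact hl (by omega) β e
    | inr e => exact (hr (by omega) _ e).trans (bit_flip_of_ne hs.ne β)

theorem place_injective (τ : SPTree α) {t : ℕ} (h : τ.depth + t ≤ T) (β : Basis T)
    : Function.Injective (τ.place t β) := by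
  have key : ∀ (l r : SPTree α) (t : ℕ), t < T → ∀ β : Basis T,
      Function.Injective (l.place (t + 1) β) →
      Function.Injective (r.place (t + 1) (flipBit t β)) →
      Function.Injective (Sum.elim (l.place (t + 1) β) (r.place (t + 1) (flipBit t β))) := by
    intro l r t ht β hl hr
    refine Function.Injective.sumElim hl hr fun e e' he => ?_
    have h1 := congrArg (fun z => bit z t) he
    simp only [bit_place _ (Nat.lt_succ_self t), bit_flip_self ht] at h1
    simp at h1
  induction τ generalizing t β with
  | leaf a => exact fun _ _ _ => rfl
  | par l r hl hr =>
    simp only [depth] at h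
    exact key l r t (by omega) β (hl (by omega) β) (hr (by omega) _)
  | ser l r hl hr =>
    simp only [depth] at h
    exact key l r t (by omega) β (hl (by omega) β) (hr (by omega) _)

/-- Here `n` may exceed the depth: branches may end early, and at a leaf the angles are zero, so the
remaining qubits are left alone. -/
theorem nonempty_flowCircuit (τ : SPTree α) (w : τ.Edge → ℝ) (hw : ∀ e, 0 < w e) (t n : ℕ)
    (hn : τ.depth ≤ n) (hT : t + n = T) :
    Nonempty (FlowCircuit T τ.IsFlow w (τ.place t) t n) := by
  induction τ generalizing t n with
  | leaf a =>
    refine ⟨{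
      ρ := w (), φ := fun _ => 1, ang := fun _ _ => 0, ρ_pos := hw (),
      abs_ang_le := ?_, ang_flip := ?_, flow_smul := ?_, φ_flow := ?_, φ_inner := ?_,
      zero_state := ?_, span_eq := ?_ }⟩
    · simp
    · simp
    · intro k c f hf
      exact congrArg (k * ·) hf
    · refine ⟨fun _ => (((w ())⁻¹ : ℝ) : ℂ), rfl, fun e => ?_⟩
      have h : ((w () : ℝ) : ℂ) ≠ 0 := by exact_mod_cast (hw ()).ne'
      change (1 : ℂ) = (((w ())⁻¹ : ℝ) : ℂ) * w ()
      rw [Complex.ofReal_inv, inv_mul_cancel₀ h]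
    · intro c f hf
      rw [sum_leaf, ← show f () = c from hf, map_one, one_mul]
    · intro β _
      rw [rotSeq_zero, spread_apply, sum_leaf, one_smul]
      rfl
    · intro β _
      rw [eq_top_iff]
      intro ψ _
      have : ψ = ψ () • (fun _ => 1 : (leaf a).Edge → ℂ) := by
        funext e
        exact (mul_one (ψ ())).symm
      rw [this]
      exact Submodule.smul_mem _ _ (Submodule.subset_span (Or.inl rfl))
  | par l r hl hr =>
    simp only [depth] at hn
    obtain ⟨n, rfl⟩ : ∃ k, n = k + 1 := ⟨n - 1, by omega⟩
    exact FlowCircuit.par (E₁ := l.Edge) (E₂ := r.Edge) (by omega)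
      (hl _ (fun e => hw (Sum.inl e)) (t + 1) n (by omega) (by omega))
      (hr _ (fun e => hw (Sum.inr e)) (t + 1) n (by omega) (by omega))
  | ser l r hl hr =>
    simp only [depth] at hn
    obtain ⟨n, rfl⟩ : ∃ k, n = k + 1 := ⟨n - 1, by omega⟩
    exact FlowCircuit.ser (E₁ := l.Edge) (E₂ := r.Edge) (by omega)
      (hl _ (fun e => hw (Sum.inl e)) (t + 1) n (by omega) (by omega))
      (hr _ (fun e => hw (Sum.inr e)) (t + 1) n (by omega) (by omega))

end SPTree

/-! ### Norms, inverses, and the reflection as conjugated signs -/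

namespace QROM

variable {T : ℕ}

/-- The Euclidean norm of a state. -/
def stateNorm (v : Basis T → ℂ) : ℝ := ‖(WithLp.toLp 2 v : EuclideanSpace ℂ (Basis T))‖

theorem stateNorm_sq (v : Basis T → ℂ) : stateNorm v ^ 2 = ∑ z, ‖v z‖ ^ 2 :=
  EuclideanSpace.norm_sq_eq _

theorem stateNorm_nonneg (v : Basis T → ℂ) : 0 ≤ stateNorm v := norm_nonneg _

theorem stateNorm_add_le (v v' : Basis T → ℂ) :
    stateNorm (v + v') ≤ stateNorm v + stateNorm v' :=
  norm_add_le (WithLp.toLp 2 v : EuclideanSpace ℂ (Basis T)) (WithLp.toLp 2 v')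

def flipEquiv (t : ℕ) : Basis T ≃ Basis T := ⟨flipBit t, flipBit t, flip_flip t, flip_flip t⟩

theorem sum_flip (t : ℕ) (g : Basis T → ℝ) : ∑ z, g (flipBit t z) = ∑ z, g z :=
  Equiv.sum_comp (flipEquiv t) g

theorem stateNorm_rot {t : ℕ} (ht : t < T) {θ : Basis T → ℝ} (hθ : ∀ z, θ (flipBit t z) = θ z)
    (v : Basis T → ℂ) : stateNorm (rot t θ v) = stateNorm v := by
  refine (pow_left_inj₀ (stateNorm_nonneg _) (stateNorm_nonneg _) two_ne_zero).1 ?_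
  rw [stateNorm_sq, stateNorm_sq]
  have key : ∀ z, ‖rot t θ v z‖ ^ 2 + ‖rot t θ v (flipBit t z)‖ ^ 2 =
      ‖v z‖ ^ 2 + ‖v (flipBit t z)‖ ^ 2 := by
    intro z
    simp only [rot_apply, hθ, flip_flip, bit_flip_self ht, Complex.sq_norm, Complex.normSq_apply]
    have h := Real.sin_sq_add_cos_sq (θ z)
    cases bit z t <;>
    · simp only [Bool.not_true, Bool.not_false, if_true, Bool.false_eq_true, if_false,
        Complex.add_re, Complex.add_im, Complex.re_ofReal_mul, Complex.im_ofReal_mul]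
      linear_combination ((v z).re ^ 2 + (v z).im ^ 2 + (v (flipBit t z)).re ^ 2 +
        (v (flipBit t z)).im ^ 2) * h
  have h2 := Finset.sum_congr (rfl : (Finset.univ : Finset (Basis T)) = Finset.univ)
    fun z _ => key z
  rw [Finset.sum_add_distrib, Finset.sum_add_distrib, sum_flip t fun z => ‖rot t θ v z‖ ^ 2,
    sum_flip t fun z => ‖v z‖ ^ 2] at h2
  linarith

theorem rot_rot {t : ℕ} (ht : t < T) (θ : Basis T → ℝ) {θ' : Basis T → ℝ}
    (hθ' : ∀ z, θ' (flipBit t z) = θ' z) (v : Basis T → ℂ) :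
    rot t θ (rot t θ' v) = rot t (fun z => θ z + θ' z) v := by
  funext z
  simp only [rot_apply, hθ', flip_flip, bit_flip_self ht, Real.cos_add, Real.sin_add]
  cases bit z t <;> simp <;> ring

theorem rot_zero (t : ℕ) (v : Basis T → ℂ) : rot t (fun _ => 0) v = v := by
  funext z
  simp [rot_apply]

/-- The inverse of `rotSeq`. -/
def rotSeqInv (θ : ℕ → Basis T → ℝ) : ℕ → ℕ → (Basis T → ℂ) →ₗ[ℂ] (Basis T → ℂ)
  | _, 0 => LinearMap.id
  | t, n + 1 => rot t (fun z => -θ t z) ∘ₗ rotSeqInv θ (t + 1) n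

theorem rotSeqInv_rotSeq {θ : ℕ → Basis T → ℝ} (hθ : ∀ s z, θ s (flipBit s z) = θ s z) {t n : ℕ}
    (hT : t + n ≤ T) (v : Basis T → ℂ) : rotSeqInv θ t n (rotSeq θ t n v) = v := by
  induction n generalizing t v with
  | zero => rfl
  | succ n ih =>
    simp only [rotSeq, rotSeqInv, LinearMap.comp_apply]
    rw [ih (by omega), rot_rot (by omega) _ (hθ t)]
    simp only [neg_add_cancel]
    exact rot_zero t v

/-- The diagonal operator with signs given by `S`. -/
def signOp (S : Basis T → Bool) : (Basis T → ℂ) →ₗ[ℂ] (Basis T → ℂ) where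
  toFun v z := (if S z = true then -1 else 1) * v z
  map_add' v w := by funext z; simp [mul_add]
  map_smul' c v := by funext z; simp [mul_left_comm]

theorem signOp_apply (S : Basis T → Bool) (v : Basis T → ℂ) (z : Basis T) :
    signOp S v z = (if S z = true then -1 else 1) * v z := rfl

theorem signOp_single (S : Basis T → Bool) (y : Basis T) :
    signOp S (Pi.single y 1) = (if S y = true then (-1 : ℂ) else 1) • Pi.single y (1 : ℂ) := by
  funext z
  rw [signOp_apply, Pi.smul_apply, smul_eq_mul]
  by_cases h : z = y
  · rw [h]
  · simp [h]

theorem stateNorm_signOp (S : Basis T → Bool) (v : Basis T → ℂ) :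
    stateNorm (signOp S v) = stateNorm v := by
  refine (pow_left_inj₀ (stateNorm_nonneg _) (stateNorm_nonneg _) two_ne_zero).1 ?_
  rw [stateNorm_sq, stateNorm_sq]
  refine Finset.sum_congr rfl fun z _ => ?_
  rw [signOp_apply]
  split_ifs <;> simp

theorem spread_of_injective {E : Type} [Fintype E] {pl : E → Basis T}
    (h : Function.Injective pl) (ψ : E → ℂ) (e : E) : spread pl ψ (pl e) = ψ e := by
  classical
  rw [spread_apply, Finset.sum_apply, Finset.sum_eq_single e]
  · simp
  · intro e' _ he
    rw [Pi.smul_apply, Pi.single_eq_of_ne fun h' => he (h h').symm, smul_zero]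
  · simp

/-- The reflection through the circulation space is a product of rotations, signs and inverse
rotations. -/
theorem FlowCircuit.exists_reflection {E : Type} [Fintype E] {F : ℂ → (E → ℂ) → Prop} {w : E → ℝ}
    {pl : Basis T → E → Basis T} (C : FlowCircuit T F w pl 0 T)
    (hpl : Function.Injective (pl fun _ => false)) (K : Submodule ℂ (EuclideanSpace ℂ E))
    (hK : ∀ ψ, ψ ∈ K ↔ IsCirc F w ψ.ofLp) :
    ∃ S : Basis T → Bool, ∀ ψ, rotSeq C.ang 0 T (signOp S (rotSeqInv C.ang 0 T
      (spread (pl fun _ => false) ψ.ofLp))) = spread (pl fun _ => false) (K.reflection ψ).ofLp := by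
  classical
  set β : Basis T := fun _ => false
  have hβ : ∀ s, 0 ≤ s → bit β s = false := fun s _ => by simp [bit, β]
  have hinv := fun v => rotSeqInv_rotSeq C.ang_flip (zero_add T).le v
  refine ⟨fun z => decide (¬ ∃ χ : EuclideanSpace ℂ E, χ ∈ K ∧
    rotSeq C.ang 0 T (Pi.single z 1) = spread (pl β) χ.ofLp), ?_⟩
  set S : Basis T → Bool := fun z => decide (¬ ∃ χ : EuclideanSpace ℂ E, χ ∈ K ∧
    rotSeq C.ang 0 T (Pi.single z 1) = spread (pl β) χ.ofLp) with hS
  have hpos : ∀ (ψ : EuclideanSpace ℂ E) z, ψ ∈ K →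
      rotSeq C.ang 0 T (Pi.single z 1) = spread (pl β) ψ.ofLp →
      rotSeq C.ang 0 T (signOp S (rotSeqInv C.ang 0 T (spread (pl β) ψ.ofLp))) =
        spread (pl β) (K.reflection ψ).ofLp := by
    intro ψ z hψ hz
    have hSz : S z = false := by
      simp only [hS, decide_eq_false_iff_not, not_not]
      exact ⟨ψ, hψ, hz⟩
    rw [← hz, hinv, signOp_single, hSz, Submodule.reflection_mem_subspace_eq_self hψ, ← hz]
    simp
  have hneg : ∀ (ψ : EuclideanSpace ℂ E) z, ψ ∈ Kᗮ →
      rotSeq C.ang 0 T (Pi.single z 1) = spread (pl β) ψ.ofLp →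
      rotSeq C.ang 0 T (signOp S (rotSeqInv C.ang 0 T (spread (pl β) ψ.ofLp))) =
        spread (pl β) (K.reflection ψ).ofLp := by
    intro ψ z hψ hz
    -- If the image of the basis state `z` also lay in the circulation space, it would be orthogonal
    -- to itself, hence zero, contradicting the invertibility of the rotations.
    have hSz : S z = true := by
      simp only [hS, decide_eq_true_eq]
      rintro ⟨χ, hχ, h⟩
      have h1 : ψ = χ := by
        ext e
        have := congrFun (hz.symm.trans h) (pl β e)
        rwa [spread_of_injective hpl, spread_of_injective hpl] at this
      have h2 : ψ = 0 := by
        rw [← inner_self_eq_zero (𝕜 := ℂ)]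
        exact (Submodule.mem_orthogonal _ _).1 hψ _ (h1 ▸ hχ)
      have h3 := hinv (Pi.single z 1)
      rw [hz, h2] at h3
      have h4 := congrFun h3 z
      simp at h4
    rw [← hz, hinv, signOp_single, hSz, Submodule.reflection_mem_subspace_orthogonalComplement_eq_neg hψ]
    simp [hz]
  have horth : ∀ ψ : E → ℂ, (∀ f, F 0 f → ∑ e, starRingEnd ℂ (ψ e) * (f e * w e) = 0) →
      (WithLp.toLp 2 ψ : EuclideanSpace ℂ E) ∈ Kᗮ := by
    intro ψ h
    rw [Submodule.mem_orthogonal']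
    intro χ hχ
    obtain ⟨f, hf, hfe⟩ := (hK χ).1 hχ
    rw [PiLp.inner_apply, ← h f hf]
    refine Finset.sum_congr rfl fun e _ => ?_
    rw [RCLike.inner_apply, mul_comm, hfe e]
  let L₁ : (E → ℂ) →ₗ[ℂ] (Basis T → ℂ) := rotSeq C.ang 0 T ∘ₗ signOp S ∘ₗ rotSeqInv C.ang 0 T ∘ₗ
    spread (pl β)
  let L₂ : (E → ℂ) →ₗ[ℂ] (Basis T → ℂ) := spread (pl β) ∘ₗ
    (WithLp.linearEquiv 2 ℂ (E → ℂ)).toLinearMap ∘ₗ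
    K.reflection.toLinearEquiv.toLinearMap ∘ₗ
    (WithLp.linearEquiv 2 ℂ (E → ℂ)).symm.toLinearMap
  -- By linearity it suffices to compare on the spanning set, whose members are all eigenvectors of
  -- the reflection and images of single basis states.
  have hL : L₁ = L₂ := by
    refine LinearMap.ext_on (C.span_eq β hβ) ?_
    rintro ψ (rfl | ⟨h, z, -, -, hz⟩)
    · refine hneg (WithLp.toLp 2 C.φ) β (horth _ fun f hf => ?_) (C.zero_state β hβ)
      rw [C.φ_inner 0 f hf, zero_mul]
    · rcases h with h | h
      · exact hpos (WithLp.toLp 2 ψ) z ((hK _).2 h) hz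
      · exact hneg (WithLp.toLp 2 ψ) z (horth _ fun f hf => h 0 f hf) hz
  intro ψ
  exact LinearMap.congr_fun hL ψ.ofLp

/-! ### Approximation of the rotation angles -/

/-- Two contractions that differ by at most `η` in operator norm. -/
structure Near (A A' : (Basis T → ℂ) →ₗ[ℂ] (Basis T → ℂ)) (η : ℝ) : Prop where
  le : ∀ v, stateNorm (A v) ≤ stateNorm v
  le' : ∀ v, stateNorm (A' v) ≤ stateNorm v
  near : ∀ v, stateNorm (A v - A' v) ≤ η * stateNorm v

theorem Near.comp {A A' B B' : (Basis T → ℂ) →ₗ[ℂ] (Basis T → ℂ)} {η μ : ℝ} (hA : Near A A' η)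
    (hB : Near B B' μ) (hη : 0 ≤ η) : Near (A ∘ₗ B) (A' ∘ₗ B') (η + μ) := by
  refine ⟨fun v => (hA.le _).trans (hB.le v), fun v => (hA.le' _).trans (hB.le' v), fun v => ?_⟩
  -- Telescoping: errors of products of contractions add.
  have h : (A ∘ₗ B) v - (A' ∘ₗ B') v = A (B v - B' v) + (A (B' v) - A' (B' v)) := by
    simp only [LinearMap.comp_apply, map_sub]
    abel
  rw [h]
  refine (stateNorm_add_le _ _).trans ?_
  have h1 := (hA.le (B v - B' v)).trans (hB.near v)
  have h2 := (hA.near (B' v)).trans (mul_le_mul_of_nonneg_left (hB.le' v) hη)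
  linarith

theorem Near.refl {A : (Basis T → ℂ) →ₗ[ℂ] (Basis T → ℂ)} (h : ∀ v, stateNorm (A v) = stateNorm v) :
    Near A A 0 := by
  refine ⟨fun v => (h v).le, fun v => (h v).le, fun v => ?_⟩
  simp [stateNorm]

theorem stateNorm_mul_le {M : ℝ} (hM : 0 ≤ M) (d : Basis T → ℝ) (hd : ∀ z, |d z| ≤ M)
    (v : Basis T → ℂ) : stateNorm (fun z => (d z : ℂ) * v z) ≤ M * stateNorm v := by
  refine le_of_sq_le_sq ?_ (mul_nonneg hM (stateNorm_nonneg _))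
  rw [mul_pow, stateNorm_sq, stateNorm_sq, Finset.mul_sum]
  refine Finset.sum_le_sum fun z _ => ?_
  rw [norm_mul, mul_pow, Complex.norm_real, Real.norm_eq_abs]
  gcongr
  exact hd z

theorem near_rot {t : ℕ} (ht : t < T) {θ θ' : Basis T → ℝ} (hθ : ∀ z, θ (flipBit t z) = θ z)
    (hθ' : ∀ z, θ' (flipBit t z) = θ' z) {η : ℝ} (h : ∀ z, |θ z - θ' z| ≤ η) :
    Near (rot t θ) (rot t θ') (2 * η) := by
  have hη : 0 ≤ η := (abs_nonneg _).trans (h fun _ => false)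
  refine ⟨fun v => (stateNorm_rot ht hθ v).le, fun v => (stateNorm_rot ht hθ' v).le, fun v => ?_⟩
  have hflip : stateNorm (fun z => v (flipBit t z)) = stateNorm v := by
    refine (pow_left_inj₀ (stateNorm_nonneg _) (stateNorm_nonneg _) two_ne_zero).1 ?_
    rw [stateNorm_sq, stateNorm_sq, sum_flip t fun z => ‖v z‖ ^ 2]
  have hcos : ∀ z, |Real.cos (θ z) - Real.cos (θ' z)| ≤ η := fun z =>
    (Real.abs_cos_sub_cos_le _ _).trans (h z)
  have hsin : ∀ z, |Real.sin (θ z) - Real.sin (θ' z)| ≤ η := fun z =>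
    (Real.abs_sin_sub_sin_le _ _).trans (h z)
  have e : rot t θ v - rot t θ' v =
      (fun z => ((Real.cos (θ z) - Real.cos (θ' z) : ℝ) : ℂ) * v z) +
      fun z => ((if bit z t then Real.sin (θ z) - Real.sin (θ' z)
        else -(Real.sin (θ z) - Real.sin (θ' z)) : ℝ) : ℂ) * v (flipBit t z) := by
    funext z
    simp only [Pi.sub_apply, Pi.add_apply, rot_apply]
    cases bit z t <;> simp <;> ring
  rw [e]
  refine (stateNorm_add_le _ _).trans ?_
  have h1 := stateNorm_mul_le hη _ hcos v
  have h2 := stateNorm_mul_le hη (fun z => if bit z t then Real.sin (θ z) - Real.sin (θ' z)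
        else -(Real.sin (θ z) - Real.sin (θ' z)))
        (fun z => by
          split_ifs
          exacts [hsin z, (abs_neg _).trans_le (hsin z)]) fun z => v (flipBit t z)
  rw [hflip] at h2
  linarith

theorem near_rotSeq {θ θ' : ℕ → Basis T → ℝ} (hθ : ∀ s z, θ s (flipBit s z) = θ s z)
    (hθ' : ∀ s z, θ' s (flipBit s z) = θ' s z) {η : ℝ} (hη : 0 ≤ η)
    (h : ∀ s z, |θ s z - θ' s z| ≤ η) {t n : ℕ} (hT : t + n ≤ T) :
    Near (rotSeq θ t n) (rotSeq θ' t n) (n * (2 * η)) ∧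
      Near (rotSeqInv θ t n) (rotSeqInv θ' t n) (n * (2 * η)) := by
  induction n generalizing t with
  | zero =>
    rw [Nat.cast_zero, zero_mul]
    exact ⟨Near.refl fun _ => rfl, Near.refl fun _ => rfl⟩
  | succ n ih =>
    obtain ⟨h1, h2⟩ := ih (t := t + 1) (by omega)
    have h3 := near_rot (t := t) (by omega) (hθ t) (hθ' t) (h t)
    have h4 := near_rot (t := t) (θ := fun z => -θ t z) (θ' := fun z => -θ' t z) (by omega)
      (fun z => by rw [hθ t]) (fun z => by rw [hθ' t])
      (fun z => by rw [← neg_sub', abs_neg]; exact h t z)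
    have e : ((n + 1 : ℕ) : ℝ) * (2 * η) = n * (2 * η) + 2 * η := by
      push_cast; ring
    rw [e]
    refine ⟨h1.comp h3 (by positivity), ?_⟩
    rw [add_comm (_ * _)]
    exact h4.comp h2 (by positivity)

/-- Greedy approximation of an angle by a signed sum of the first `k` powers of `1 / 2`. -/
def greedy (θ : ℝ) : ℕ → ℝ
  | 0 => 0
  | k + 1 => greedy θ k + if θ < greedy θ k then -(1 / 2) ^ k else (1 / 2) ^ k

/-- Stepping by `2 ^ (-k)` towards a target at distance at most `2 * 2 ^ (-k)` leaves a distance of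
at most `2 ^ (-k)`. -/
theorem abs_sub_greedy_le {θ : ℝ} (hθ : |θ| ≤ 2) (k : ℕ) :
    |θ - greedy θ k| ≤ 2 * (1 / 2) ^ k := by
  induction k with
  | zero => simpa [greedy] using hθ
  | succ k ih =>
    rw [abs_le] at ih ⊢
    simp only [greedy, pow_succ]
    split_ifs with h
    · constructor <;> linarith
    · constructor <;> linarith

end QROM

namespace QROM

/-! ### Elementary rotations -/

/-- The entries of a rotation of one qubit. -/
def rotEntry (φ : ℝ) (b c : Bool) : ℂ :=
  if b = c then Real.cos φ else ((if b then Real.sin φ else -Real.sin φ : ℝ) : ℂ)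

/-- The rotation of one qubit by the angle `φ`. -/
def rotMatrix {w : ℕ} (p : Fin w) (φ : ℝ) : Matrix (Basis w) (Basis w) ℂ :=
  fun y z => if ∀ i, i ≠ p → y i = z i then rotEntry φ (y p) (z p) else 0

theorem rotMatrix_mulVec {w : ℕ} (p : Fin w) (φ : ℝ) (v : Basis w → ℂ) :
    (rotMatrix p φ).mulVec v = rot p (fun _ => φ) v := by
  have hbit : ∀ y : Basis w, bit y p = y p := fun y => by simp [bit]
  have hflip : ∀ y : Basis w, flipBit p y p = !y p := fun y => by simp [flipBit]
  have hoff : ∀ (y : Basis w) i, i ≠ p → flipBit p y i = y i := fun y i hi => by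
    simp [flipBit, Fin.val_ne_of_ne hi]
  have key : ∀ y z : Basis w, rotMatrix p φ y z * v z =
      (if z = y then (Real.cos φ : ℂ) * v z else 0) +
      if z = flipBit p y then ((if y p then Real.sin φ else -Real.sin φ : ℝ) : ℂ) * v z else 0 := by
    intro y z
    have hne := flip_ne p.2 y
    by_cases h1 : z = y
    · subst h1
      simp [rotMatrix, rotEntry, Ne.symm hne]
    by_cases h2 : z = flipBit p y
    · rw [if_neg h1, if_pos h2, zero_add, rotMatrix, if_pos fun i hi => by rw [h2, hoff y i hi],
        rotEntry, h2, hflip, if_neg (by cases y p <;> simp)]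
    · rw [if_neg h1, if_neg h2, rotMatrix, if_neg, zero_mul, add_zero]
      intro h
      by_cases hp : z p = y p
      · refine h1 (funext fun i => ?_)
        by_cases hi : i = p
        · rw [hi, hp]
        · exact (h i hi).symm
      · refine h2 (funext fun i => ?_)
        by_cases hi : i = p
        · rw [hi, hflip]
          revert hp
          cases z p <;> cases y p <;> simp
        · rw [hoff y i hi, h i hi]
  funext y
  rw [Matrix.mulVec, dotProduct, Finset.sum_congr rfl fun z _ => key y z, Finset.sum_add_distrib,
    Finset.sum_ite_eq', Finset.sum_ite_eq', rot_apply, hbit]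
  simp

theorem isElementary_rotMatrix {w : ℕ} (p : Fin w) (φ : ℝ) : IsElementary (rotMatrix p φ) := by
  constructor
  · have hstar : star (rotMatrix p φ) = rotMatrix p (-φ) := by
      funext y z
      rw [Matrix.star_apply, rotMatrix, rotMatrix]
      have : (∀ i, i ≠ p → z i = y i) ↔ ∀ i, i ≠ p → y i = z i :=
        forall₂_congr fun i _ => eq_comm
      simp only [this]
      split_ifs
      · simp only [rotEntry, Real.cos_neg, Real.sin_neg]
        cases y p <;> cases z p <;> simp [← Complex.cos_conj, ← Complex.sin_conj]
      · simp
    rw [Matrix.mem_unitaryGroup_iff, hstar]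
    apply Matrix.toLin'.injective
    refine LinearMap.ext fun v => ?_
    rw [Matrix.toLin'_mul, LinearMap.comp_apply, Matrix.toLin'_apply, Matrix.toLin'_apply,
      rotMatrix_mulVec, rotMatrix_mulVec, rot_rot p.2 _ fun _ => rfl, Matrix.toLin'_one,
      LinearMap.id_apply]
    simp only [add_neg_cancel]
    exact rot_zero _ v
  · refine ⟨{p}, fun y z => rotEntry φ (y ⟨p, by simp⟩) (z ⟨p, by simp⟩), Finset.univ, ?_, ?_, ?_⟩
    · simp
    · intro y z h
      simp at h
    · intro y z
      simp only [Finset.mem_singleton]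
      rfl

/-! ### Realization with a read-only memory -/

section layout

variable (T r : ℕ)

/-- The qubits: `T` address qubits, and `r` pairs of selector qubits. -/
def qubitEquiv : Fin (T + r * 2) ≃ Fin T ⊕ (Fin r × Bool) :=
  Fintype.equivOfCardEq (by simp)

variable {T r}

/-- Every pair of selector qubits is in the state `01`. -/
def memState (y : Basis T) : Basis (T + r * 2) := fun i =>
  Sum.elim y (fun jc => jc.2) (qubitEquiv T r i)

theorem memState_injective : Function.Injective (memState (T := T) (r := r)) := by
  intro y z h
  funext t
  simpa [memState] using congrFun h ((qubitEquiv T r).symm (Sum.inl t))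

/-- A memory that holds one bit string for every state of the first qubits of the pairs. -/
def memory (d : (Fin r → Bool) → Basis T → Bool) (u : Basis (T + r * 2)) : Bool :=
  d (fun j => u ((qubitEquiv T r).symm (Sum.inr (j, false))))
    fun t => u ((qubitEquiv T r).symm (Sum.inl t))

def pairSwap (i : Fin r → Bool) : Fin T ⊕ (Fin r × Bool) → Fin T ⊕ (Fin r × Bool) :=
  Sum.map id fun jc => (jc.1, xor jc.2 (i jc.1))

theorem pairSwap_involutive (i : Fin r → Bool) :
    Function.Involutive (pairSwap (T := T) i) := by
  rintro (t | ⟨j, c⟩)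
  · rfl
  · simp [pairSwap]

/-- The address register with some of the pairs of selector qubits swapped. -/
def address (i : Fin r → Bool) : Fin (T + r * 2) ↪ Fin (T + r * 2) where
  toFun k := (qubitEquiv T r).symm (pairSwap i (qubitEquiv T r k))
  inj' := (qubitEquiv T r).symm.injective.comp
    ((pairSwap_involutive i).injective.comp (qubitEquiv T r).injective)

/-- The choice of the bit string costs no gate. Every pair supplies a constant 0 and a constant 1,
and permuting the wires of the index register decides which of them the memory sees as its selector
bit; the other qubit of the pair is ignored. -/
theorem memory_address (d : (Fin r → Bool) → Basis T → Bool) (i : Fin r → Bool) (y : Basis T) :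
    memory d (fun k => memState y (address i k)) = d i y := by
  simp [memory, memState, address, pairSwap]

/-- The operator `A` is realized by at most `k` gates. -/
def Realizes (d : (Fin r → Bool) → Basis T → Bool) (A : (Basis T → ℂ) →ₗ[ℂ] (Basis T → ℂ))
    (k : ℕ) : Prop :=
  ∃ gates : List (Matrix (Basis (T + r * 2)) (Basis (T + r * 2)) ℂ), gates.length ≤ k ∧
    (∀ U ∈ gates, IsElementary U ∨
      ∃ addr : Fin (T + r * 2) ↪ Fin (T + r * 2), U = readGate (memory d) addr) ∧
    ∀ v, gates.prod.mulVec (spread memState v) = spread memState (A v)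

variable {d : (Fin r → Bool) → Basis T → Bool}

theorem realizes_id : Realizes d LinearMap.id 0 :=
  ⟨[], le_rfl, by simp, fun v => by simp⟩

theorem Realizes.comp {A A' : (Basis T → ℂ) →ₗ[ℂ] (Basis T → ℂ)} {k k' : ℕ}
    (h : Realizes d A k) (h' : Realizes d A' k') : Realizes d (A ∘ₗ A') (k + k') := by
  obtain ⟨g, h1, h2, h3⟩ := h
  obtain ⟨g', h1', h2', h3'⟩ := h'
  refine ⟨g ++ g', by simpa using add_le_add h1 h1', ?_, fun v => ?_⟩
  · intro U hU
    exact (List.mem_append.1 hU).elim (h2 U) (h2' U)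
  · rw [List.prod_append, ← Matrix.mulVec_mulVec, h3', h3, LinearMap.comp_apply]

theorem realizes_of_single {U : Matrix (Basis (T + r * 2)) (Basis (T + r * 2)) ℂ}
    {A : (Basis T → ℂ) →ₗ[ℂ] (Basis T → ℂ)}
    (hU : IsElementary U ∨
      ∃ addr : Fin (T + r * 2) ↪ Fin (T + r * 2), U = readGate (memory d) addr)
    (h : ∀ y, U.mulVec (Pi.single (memState y) 1) = spread memState (A (Pi.single y 1))) :
    Realizes d A 1 := by
  refine ⟨[U], le_rfl, by simpa using hU, fun v => ?_⟩
  have : U.mulVecLin ∘ₗ spread memState = spread memState ∘ₗ A := by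
    refine (Pi.basisFun ℂ (Basis T)).ext fun y => ?_
    rw [Pi.basisFun_apply, LinearMap.comp_apply, LinearMap.comp_apply, ← h y, Matrix.mulVecLin_apply]
    congr 1
    rw [spread_apply, Finset.sum_eq_single y]
    · simp
    · intro z _ hz
      rw [Pi.single_eq_of_ne hz, zero_smul]
    · simp
  simpa using LinearMap.congr_fun this v

theorem spread_single (y : Basis T) :
    spread (memState (r := r)) (Pi.single y 1) = Pi.single (memState y) 1 := by
  rw [spread_apply, Finset.sum_eq_single y]
  · simp
  · intro z _ hz
    rw [Pi.single_eq_of_ne hz, zero_smul]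
  · simp

theorem realizes_signOp (i : Fin r → Bool) : Realizes d (signOp (d i)) 1 := by
  refine realizes_of_single (Or.inr ⟨address i, rfl⟩) fun y => ?_
  rw [signOp_single, map_smul, spread_single]
  funext z
  rw [readGate, Matrix.mulVec_diagonal, Pi.smul_apply, smul_eq_mul]
  by_cases h : z = memState y
  · rw [h, memory_address]
  · simp [h]

theorem realizes_rot_const {t : ℕ} (ht : t < T) (φ : ℝ) : Realizes d (rot t fun _ => φ) 1 := by
  set p : Fin (T + r * 2) := (qubitEquiv T r).symm (Sum.inl ⟨t, ht⟩) with hp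
  refine realizes_of_single (Or.inl (isElementary_rotMatrix p φ)) fun y => ?_
  have hbit : bit (memState (r := r) y) p = bit y t := by
    simp [bit, ht, memState, hp]
  have hflip : flipBit p (memState (r := r) y) = memState (flipBit t y) := by
    funext i
    obtain ⟨x, rfl⟩ := (qubitEquiv T r).symm.surjective i
    have h1 : ((qubitEquiv T r).symm x).val = p.val ↔ x = Sum.inl ⟨t, ht⟩ := by
      rw [Fin.val_inj, hp, (qubitEquiv T r).symm.injective.eq_iff]
    simp only [flipBit, h1, memState, Equiv.apply_symm_apply]
    rcases x with x | x
    · by_cases hx : x = ⟨t, ht⟩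
      · subst hx; simp [flipBit]
      · have : x.val ≠ t := fun h => hx (Fin.ext h)
        simp [hx, flipBit, this]
    · simp
  rw [rotMatrix_mulVec, rot_single p.2 rfl, rot_single ht rfl, map_add, map_smul, map_smul,
    spread_single, spread_single, hbit, hflip]

/-- Conjugation with a sign that is controlled by the rotated qubit inverts the rotation. -/
theorem rot_sign {t : ℕ} (ht : t < T) (φ : ℝ) {S : Basis T → Bool}
    (hS : ∀ z, S (flipBit t z) = S z) :
    rot t (fun z => if S z then -φ else φ) =
      signOp (fun z => bit z t && S z) ∘ₗ rot t (fun _ => φ) ∘ₗ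
        signOp (fun z => bit z t && S z) := by
  refine LinearMap.ext fun v => funext fun z => ?_
  simp only [LinearMap.comp_apply, signOp_apply, rot_apply, bit_flip_self ht, hS]
  cases bit z t <;> cases S z <;> simp [add_comm]

/-- Rotations of the same qubit compose by adding angles. Each binary digit costs three gates: a
fixed rotation between two readings of the sign of that digit. -/
theorem realizes_rot_greedy {t : ℕ} (ht : t < T) {θ : Basis T → ℝ}
    (hθ : ∀ z, θ (flipBit t z) = θ z) (B : ℕ)
    (h : ∀ k < B, Realizes d (signOp fun z => bit z t && decide (θ z < greedy (θ z) k)) 1) :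
    Realizes d (rot t fun z => greedy (θ z) B) (3 * B) ∧
      Realizes d (rot t fun z => -greedy (θ z) B) (3 * B) := by
  induction B with
  | zero =>
    have e : rot t (fun _ : Basis T => (0 : ℝ)) = LinearMap.id :=
      LinearMap.ext fun v => rot_zero t v
    simp only [greedy, neg_zero]
    rw [e]
    exact ⟨realizes_id, realizes_id⟩
  | succ B ih =>
    obtain ⟨h1, h2⟩ := ih fun k hk => h k (by omega)
    have hB := h B (by omega)
    have hS : ∀ z, (fun z => decide (θ z < greedy (θ z) B)) (flipBit t z) =
        (fun z => decide (θ z < greedy (θ z) B)) z := fun z => by simp only [hθ]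
    have key : ∀ φ : ℝ, Realizes d
        (rot t fun z => if decide (θ z < greedy (θ z) B) then -φ else φ) 3 := by
      intro φ
      rw [rot_sign ht φ hS]
      exact hB.comp ((realizes_rot_const ht φ).comp hB)
    have comp : ∀ (f g : Basis T → ℝ), (∀ z, g (flipBit t z) = g z) →
        rot t (fun z => f z + g z) = rot t f ∘ₗ rot t g := fun f g hg =>
      LinearMap.ext fun v => (rot_rot ht f hg v).symm
    constructor
    · have e : (fun z => greedy (θ z) (B + 1)) = fun z => greedy (θ z) B +
          if decide (θ z < greedy (θ z) B) then -(1 / 2) ^ B else (1 / 2) ^ B := by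
        funext z
        simp [greedy]
      rw [e, comp _ _ fun z => by simp only [hθ]]
      exact h1.comp (key _)
    · have e : (fun z => -greedy (θ z) (B + 1)) = fun z => -greedy (θ z) B +
          if decide (θ z < greedy (θ z) B) then - -(1 / 2) ^ B else -(1 / 2) ^ B := by
        funext z
        simp only [greedy, decide_eq_true_eq]
        split_ifs <;> ring
      rw [e, comp _ _ fun z => by simp only [hθ]]
      exact h2.comp (key _)

theorem realizes_rotSeq {θ : ℕ → Basis T → ℝ} (hθ : ∀ s z, θ s (flipBit s z) = θ s z) (B : ℕ)
    (h : ∀ s < T, ∀ k < B,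
      Realizes d (signOp fun z => bit z s && decide (θ s z < greedy (θ s z) k)) 1)
    {t n : ℕ} (hT : t + n ≤ T) :
    Realizes d (rotSeq (fun s z => greedy (θ s z) B) t n) (3 * n * B) ∧
      Realizes d (rotSeqInv (fun s z => greedy (θ s z) B) t n) (3 * n * B) := by
  induction n generalizing t with
  | zero => simpa [rotSeq, rotSeqInv] using realizes_id
  | succ n ih =>
    obtain ⟨h1, h2⟩ := ih (t := t + 1) (by omega)
    obtain ⟨h3, h4⟩ := realizes_rot_greedy (t := t) (by omega) (hθ t) B (h t (by omega))
    rw [show 3 * (n + 1) * B = 3 * n * B + 3 * B by ring]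
    refine ⟨h1.comp h3, ?_⟩
    rw [add_comm (3 * n * B)]
    exact h4.comp h2

end layout

theorem norm_spread {E : Type} [Fintype E] {w : ℕ} {pl : E → Basis w} (h : Function.Injective pl)
    (ψ : E → ℂ) : ‖(WithLp.toLp 2 (spread pl ψ) : EuclideanSpace ℂ (Basis w))‖ =
      ‖(WithLp.toLp 2 ψ : EuclideanSpace ℂ E)‖ := by
  refine (pow_left_inj₀ (norm_nonneg _) (norm_nonneg _) two_ne_zero).1 ?_
  rw [EuclideanSpace.norm_sq_eq, EuclideanSpace.norm_sq_eq]
  refine (Fintype.sum_of_injective pl h _ _ (fun z hz => ?_) fun e => ?_).symm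
  · have : spread pl ψ z = 0 := by
      rw [spread_apply, Finset.sum_apply]
      refine Finset.sum_eq_zero fun e _ => ?_
      rw [Pi.smul_apply, Pi.single_eq_of_ne fun h' => hz ⟨e, h'.symm⟩, smul_zero]
    simp [this]
  · exact congrArg (‖·‖ ^ 2) (spread_of_injective h ψ e).symm

theorem encode_eq_spread {E : Type} [Fintype E] {w : ℕ} (enc : E ↪ Basis w)
    (ψ : EuclideanSpace ℂ E) : encode enc ψ = WithLp.toLp 2 (spread enc ψ.ofLp) := by
  ext z
  simp [encode, spread_apply, Finset.sum_apply, Pi.single_apply, eq_comm]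

theorem spread_spread {E : Type} [Fintype E] {T r : ℕ} (pl : E → Basis T) (ψ : E → ℂ) :
    spread (memState (r := r)) (spread pl ψ) = spread (fun e => memState (pl e)) ψ := by
  rw [spread_apply pl, map_sum, spread_apply]
  refine Finset.sum_congr rfl fun e _ => ?_
  rw [map_smul, spread_single]

theorem FlowCircuit.implementable_reflection {E : Type} [Fintype E] {T : ℕ}
    {F : ℂ → (E → ℂ) → Prop} {w : E → ℝ} {pl : Basis T → E → Basis T}
    (C : FlowCircuit T F w pl 0 T) (hpl : Function.Injective (pl fun _ => false))
    (K : Submodule ℂ (EuclideanSpace ℂ E)) (hK : ∀ ψ, ψ ∈ K ↔ IsCirc F w ψ.ofLp) (B r : ℕ)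
    (hr : T * B + 1 ≤ 2 ^ r) (ε : ℝ) (hε : 8 * T * (1 / 2) ^ B ≤ ε) :
    Implementable K.reflection ε (2 ^ (T + r * 2)) ((6 * T * B + 1 : ℕ) : ℝ) := by
  classical
  obtain ⟨S, hS⟩ := C.exists_reflection hpl K hK
  -- One string per digit of each angle, and one more, at `none`, for the diagonal of the
  -- reflection.
  obtain ⟨emb⟩ : Nonempty (Option (Fin T × Fin B) ↪ (Fin r → Bool)) := by
    refine Function.Embedding.nonempty_of_card_le ?_
    simpa using hr
  let dd : Option (Fin T × Fin B) → Basis T → Bool := fun j z =>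
    j.elim (S z) fun tk => bit z tk.1 && decide (C.ang tk.1 z < greedy (C.ang tk.1 z) tk.2)
  let d : (Fin r → Bool) → Basis T → Bool := Function.extend emb dd fun _ _ => false
  have hd : ∀ j, Realizes d (signOp (dd j)) 1 := by
    intro j
    have h := realizes_signOp (d := d) (emb j)
    rwa [show d (emb j) = dd j from emb.injective.extend_apply _ _ _] at h
  obtain ⟨h1, h2⟩ := realizes_rotSeq (d := d) C.ang_flip B
    (fun s hs k hk => hd (some (⟨s, hs⟩, ⟨k, hk⟩))) (t := 0) (n := T) (zero_add T).le
  obtain ⟨gates, hlen, hgates, hprod⟩ := (h1.comp (hd none)).comp h2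
  refine ⟨T + r * 2, T + r * 2, memory d,
    ⟨fun e => memState (pl (fun _ => false) e), memState_injective.comp hpl⟩, gates,
    le_rfl, ?_, hgates, fun ψ => ?_⟩
  · have : 3 * T * B + 1 + 3 * T * B = 6 * T * B + 1 := by ring
    exact_mod_cast hlen.trans this.le
  have hflip : ∀ s z, greedy (C.ang s (flipBit s z)) B = greedy (C.ang s z) B := fun s z => by
    rw [C.ang_flip]
  have hdist : ∀ s z, |greedy (C.ang s z) B - C.ang s z| ≤ 2 * (1 / 2) ^ B := fun s z => by
    rw [abs_sub_comm]
    exact abs_sub_greedy_le (C.abs_ang_le s z) B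
  obtain ⟨n1, n2⟩ := near_rotSeq (θ := fun s z => greedy (C.ang s z) B) (θ' := C.ang) hflip
    C.ang_flip (by positivity) hdist (t := 0) (n := T) (zero_add T).le
  -- With angles off by at most `2 * (1 / 2) ^ B`, each of the two sequences has error `T * (2 * (2
  -- * (1 / 2) ^ B))`; the signs are exact. This gives `8 * T * (1 / 2) ^ B`.
  have n3 := (n1.comp (Near.refl (stateNorm_signOp S)) (by positivity)).comp n2 (by positivity)
  rw [encode_eq_spread, encode_eq_spread, Matrix.toLpLin_toLp, Function.Embedding.coeFn_mk,
    ← spread_spread (pl fun _ => false), ← spread_spread (pl fun _ => false)]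
  change ‖WithLp.toLp 2 (gates.prod.mulVec (spread memState _)) - _‖ ≤ _
  rw [hprod, ← hS ψ, ← WithLp.toLp_sub, ← map_sub, norm_spread memState_injective]
  refine (n3.near _).trans ?_
  have hn : stateNorm (spread (pl fun _ => false) ψ.ofLp) = ‖ψ‖ :=
    norm_spread hpl ψ.ofLp
  rw [hn]
  refine mul_le_mul_of_nonneg_right (le_trans (le_of_eq ?_) hε) (norm_nonneg _)
  ring

end QROM

/-! ### The circulation space of a tree and its reflection -/

namespace SPTree

open QROM

theorem mem_circulationSpace_iff {α : Type*} (τ : SPTree α) (r : τ.graph.E → ℝ)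
    (ψ : EuclideanSpace ℂ τ.graph.E) :
    ψ ∈ τ.graph.circulationSpace r ↔ IsCirc τ.IsFlow (fun e => Real.sqrt (r e)) ψ.ofLp := by
  constructor
  · rintro ⟨f, hf, rfl⟩
    exact ⟨f, (mem_ker_netFlow_graph τ f).1 hf, fun e => rfl⟩
  · rintro ⟨f, hf, h⟩
    refine ⟨f, (mem_ker_netFlow_graph τ f).2 hf, ?_⟩
    ext e
    exact (h e).symm

theorem implementable_reflection {α : Type*} (τ : SPTree α) (ρ : τ.graph.E → ℝ)
    (hρ : ∀ e, 0 < ρ e) (T B r : ℕ) (hT : τ.depth ≤ T) (hr : T * B + 1 ≤ 2 ^ r) (ε : ℝ)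
    (hε : 8 * T * (1 / 2) ^ B ≤ ε) :
    Implementable (τ.graph.circulationSpace ρ).reflection ε (2 ^ (T + r * 2))
      ((6 * T * B + 1 : ℕ) : ℝ) := by
  obtain ⟨C⟩ := τ.nonempty_flowCircuit (T := T) (fun e => Real.sqrt (ρ e))
    (fun e => Real.sqrt_pos.2 (hρ e)) 0 T hT (zero_add T)
  exact C.implementable_reflection (τ.place_injective (by simpa using hT) _) _
    (τ.mem_circulationSpace_iff ρ) B r hr ε hε

end SPTree

/-! ### Depth of the recursion -/

namespace DivideAndConquer

variable {a n : ℕ} {A Λ : Type*} (S : DivideAndConquer a n A Λ) {dep : ℕ → Λ → ℕ} {D : ℕ}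

/-- Sizes drop by at least one in each step. This crude bound serves below `M`, where the sizes need
not shrink geometrically. -/
theorem depth_le_mul (ha : 0 < a) (h₀ : ∀ m p, m < S.m₀ → dep m p = 0)
    (h : ∀ m p, S.m₀ ≤ m →
      dep m p ≤ (Finset.univ.sup fun j => dep (S.size m p j) (S.param m p j)) + D)
    (m : ℕ) (p : Λ) : dep m p ≤ D * m := by
  induction m using Nat.strong_induction_on generalizing p with
  | _ m ih =>
    rcases lt_or_ge m S.m₀ with hm | hm
    · simp [h₀ m p hm]
    · have hpos : 1 ≤ m := (Nat.zero_le _).trans_lt (S.size_lt m hm p ⟨0, ha⟩)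
      obtain ⟨m', rfl⟩ := Nat.exists_eq_add_of_le' hpos
      refine (h _ p hm).trans ?_
      rw [mul_add, mul_one]
      gcongr
      refine Finset.sup_le fun j _ => ?_
      have hj := S.size_lt _ hm p j
      exact (ih _ hj _).trans (Nat.mul_le_mul_left _ (Nat.lt_succ_iff.1 hj))

/-- While the size is at least `M`, a step lowers `log m / log (b / c₂)` by at least one; once the
size is below `M`, at most `M` further steps follow. -/
theorem depth_le_log (ha : 0 < a) (h₀ : ∀ m p, m < S.m₀ → dep m p = 0)
    (h : ∀ m p, S.m₀ ≤ m →
      dep m p ≤ (Finset.univ.sup fun j => dep (S.size m p j) (S.param m p j)) + D)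
    {b : ℕ} {c₁ c₂ : ℝ} {M : ℕ} (hc₂ : 0 < c₂) (hb : c₂ < b) (hS : S.SizeTheta b c₁ c₂ M)
    (m : ℕ) (hm : M ≤ m) (hm1 : 1 ≤ m) (p : Λ) :
    (dep m p : ℝ) ≤ D * (M + 1 + Real.log m / Real.log (b / c₂)) := by
  have hL : 0 < Real.log (b / c₂) := Real.log_pos ((one_lt_div hc₂).2 hb)
  have hb0 : (0 : ℝ) < b := hc₂.trans hb
  induction m using Nat.strong_induction_on generalizing p with
  | _ m ih =>
    have hlog : 0 ≤ Real.log m / Real.log (b / c₂) :=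
      div_nonneg (Real.log_nonneg (by exact_mod_cast hm1)) hL.le
    rcases lt_or_ge m S.m₀ with hm₀ | hm₀
    · rw [h₀ m p hm₀, Nat.cast_zero]
      positivity
    · obtain ⟨j, -, hj⟩ := Finset.exists_mem_eq_sup (Finset.univ : Finset (Fin a))
        ⟨⟨0, ha⟩, Finset.mem_univ _⟩ fun j => dep (S.size m p j) (S.param m p j)
      have h1 : (dep m p : ℝ) ≤ dep (S.size m p j) (S.param m p j) + D := by
        exact_mod_cast (hj ▸ h m p hm₀ :)
      have h2 : (dep (S.size m p j) (S.param m p j) : ℝ) ≤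
          D * (M + Real.log m / Real.log (b / c₂)) := by
        have h3 : (dep (S.size m p j) (S.param m p j) : ℝ) ≤ D * S.size m p j := by
          exact_mod_cast S.depth_le_mul ha h₀ h _ _
        rcases lt_or_ge (S.size m p j) M with hs | hs
        · refine h3.trans (mul_le_mul_of_nonneg_left ?_ (Nat.cast_nonneg _))
          have : (S.size m p j : ℝ) ≤ M := by exact_mod_cast hs.le
          linarith
        -- Size zero is handled apart, as the induction hypothesis needs a size of at least 1.
        rcases Nat.eq_zero_or_pos (S.size m p j) with hz | hz
        · rw [hz, Nat.cast_zero, mul_zero] at h3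
          rw [hz]
          exact h3.trans (by positivity)
        · refine (ih _ (S.size_lt m hm₀ p j) hs hz _).trans ?_
          refine mul_le_mul_of_nonneg_left ?_ (Nat.cast_nonneg _)
          have h4 : Real.log (S.size m p j) ≤ Real.log m - Real.log (b / c₂) := by
            have hm' : (m : ℝ) ≠ 0 := by positivity
            rw [← Real.log_div hm' (by positivity)]
            refine Real.log_le_log (by exact_mod_cast hz) ((hS m hm hm₀ p j).2.trans_eq ?_)
            field_simp
          have h5 : Real.log (S.size m p j) / Real.log (b / c₂) ≤
              Real.log m / Real.log (b / c₂) - 1 := by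
            rw [div_sub_one hL.ne']
            gcongr
          linarith
      linarith

end DivideAndConquer

/-! ### Numerical estimates -/

/-- Makes the constants independent of `b`. For `c > 1` an integer `b > c` is at least `q = ⌊c⌋ + 1
> c`, so `log c` is at most the fraction `log c / log q < 1` of `log b`. -/
theorem exists_mul_log_le_log_div (c : ℝ) : ∃ κ : ℝ, 0 < κ ∧ ∀ b : ℕ, 2 ≤ b → c < b → 0 < c →
    κ * Real.log b ≤ Real.log (b / c) := by
  rcases le_or_gt c 1 with hc | hc
  · refine ⟨1, one_pos, fun b hb _ hc' => ?_⟩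
    rw [one_mul]
    have : (0 : ℝ) < b := by positivity
    exact Real.log_le_log this (by rw [le_div_iff₀ hc']; nlinarith)
  · have hc0 : 0 < c := one_pos.trans hc
    set q : ℝ := ⌊c⌋₊ + 1 with hq
    have hcq : c < q := Nat.lt_floor_add_one c
    have hlq : 0 < Real.log q := Real.log_pos (hc.trans hcq)
    have hlc : 0 < Real.log c := Real.log_pos hc
    refine ⟨1 - Real.log c / Real.log q, ?_, fun b hb hcb _ => ?_⟩
    · rw [sub_pos, div_lt_one hlq]
      exact Real.log_lt_log hc0 hcq
    · have hqb : q ≤ b := by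
        have : ⌊c⌋₊ + 1 ≤ b := (Nat.floor_lt hc0.le).2 hcb
        rw [hq]
        exact_mod_cast this
      have hlb : Real.log q ≤ Real.log b := Real.log_le_log (hc0.trans hcq) hqb
      rw [Real.log_div (by positivity) hc0.ne', sub_mul, one_mul]
      have : Real.log c ≤ Real.log c / Real.log q * Real.log b := by
        rw [div_mul_eq_mul_div, le_div_iff₀ hlq]
        gcongr
      linarith

theorem half_le_log_two : (1 / 2 : ℝ) ≤ Real.log 2 := by
  linarith [Real.log_two_gt_d9]

theorem clog_two_le {x : ℕ} (hx : 1 ≤ x) : (Nat.clog 2 x : ℝ) ≤ 1 + 2 * Real.log x := by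
  have hlog : 0 ≤ Real.log x := Real.log_nonneg (by exact_mod_cast hx)
  rcases Nat.lt_or_ge 1 x with h | h
  · have h1 : (2 : ℝ) ^ (Nat.clog 2 x).pred < x := by
      exact_mod_cast Nat.pow_pred_clog_lt_self one_lt_two h
    have h2 : ((Nat.clog 2 x).pred : ℝ) * Real.log 2 ≤ Real.log x := by
      rw [← Real.log_pow]
      exact Real.log_le_log (by positivity) h1.le
    have h3 : Nat.clog 2 x ≤ (Nat.clog 2 x).pred + 1 := by rw [Nat.pred_eq_sub_one]; omega
    have h4 : (Nat.clog 2 x : ℝ) ≤ (Nat.clog 2 x).pred + 1 := by exact_mod_cast h3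
    have h5 : (0 : ℝ) ≤ (Nat.clog 2 x).pred := Nat.cast_nonneg _
    nlinarith [half_le_log_two]
  · rw [Nat.clog_of_right_le_one h, Nat.cast_zero]
    positivity

/-- The resources that suffice at depth `T`, if `T` is bounded by a multiple of `s * l`. -/
theorem exists_resource_bound (K κ : ℝ) (hK : 0 ≤ K) (hκ : 0 < κ) :
    ∃ (C : ℝ → ℝ) (k : ℕ), ∀ (T : ℕ) (s l : ℝ), κ ≤ s → 1 / 2 ≤ l → (T : ℝ) ≤ K * (s * l) →
      ∀ ε : ℝ, 0 < ε → ∃ B r : ℕ, T * B + 1 ≤ 2 ^ r ∧ 8 * T * (1 / 2) ^ B ≤ ε ∧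
        (2 : ℝ) ^ (T + r * 2) ≤ C ε * Real.exp (s * l) ^ k ∧
        ((6 * T * B + 1 : ℕ) : ℝ) ≤ C ε * (s ^ 2 * l) * Real.log (2 + s ^ 2 * l) ^ k := by
  -- The memory turns out to have at most a constant times `(2 ^ T) ^ 5` bits, whence the 5; the
  -- summand 1 ensures that `k` is positive.
  set k : ℕ := ⌈5 * K⌉₊ + 1 with hk
  set N : ℝ → ℕ := fun ε => Nat.clog 2 ⌈8 / ε⌉₊ with hN
  set J : ℝ := K / κ with hJ
  have hJ0 : 0 ≤ J := div_nonneg hK hκ.le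
  have hlJ : 0 ≤ Real.log (1 + J) := Real.log_nonneg (by linarith)
  set E : ℝ → ℝ := fun ε => 2 * N ε + 4 + 4 * Real.log (1 + J) with hE
  have hE0 : ∀ ε, 0 ≤ E ε := fun ε => by positivity
  -- The first summand of the constant pays for the memory, the second for the gates; `2 ^ k` is
  -- needed because the logarithm is only known to be at least `1 / 2`.
  refine ⟨fun ε => 4 * (N ε + 1) ^ 2 + 2 ^ k * (6 * J * E ε + 4 / κ ^ 2), k,
    fun T s l hs hl hT ε hε => ?_⟩
  have hs0 : 0 < s := hκ.trans_le hs
  have hl0 : 0 < l := lt_of_lt_of_le (by norm_num) hl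
  -- Chosen so that `2 ^ B ≥ 8 * (T + 1) / ε`.
  set B := N ε + Nat.clog 2 (T + 1) with hB
  have hTB : T + 1 ≤ 2 ^ T := Nat.lt_two_pow_self
  have h2B : 8 / ε * (T + 1) ≤ (2 : ℝ) ^ B := by
    have h1 : 8 / ε ≤ (2 : ℝ) ^ N ε := (Nat.le_ceil _).trans
      (by exact_mod_cast Nat.le_pow_clog one_lt_two _)
    have h2 : ((T : ℝ) + 1) ≤ 2 ^ Nat.clog 2 (T + 1) := by
      exact_mod_cast Nat.le_pow_clog one_lt_two (T + 1)
    rw [hB, pow_add]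
    gcongr
  refine ⟨B, Nat.clog 2 (T * B + 1), Nat.le_pow_clog one_lt_two _, ?_, ?_, ?_⟩
  · rw [one_div, inv_pow, ← div_eq_mul_inv, div_le_iff₀ (by positivity)]
    have : 8 * ((T : ℝ) + 1) ≤ ε * 2 ^ B := by
      rw [div_mul_eq_mul_div, div_le_iff₀ hε] at h2B
      linarith
    linarith
  · have hr : 2 ^ Nat.clog 2 (T * B + 1) ≤ 2 * (T * B + 1) := by
      rcases Nat.eq_zero_or_pos (Nat.clog 2 (T * B + 1)) with h | h
      · rw [h]; omega
      · have h1 : 1 < T * B + 1 := by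
          by_contra h'
          rw [Nat.clog_of_right_le_one (not_lt.1 h')] at h
          exact h.false
        have h2 := Nat.pow_pred_clog_lt_self one_lt_two h1
        calc 2 ^ Nat.clog 2 (T * B + 1) = 2 * 2 ^ (Nat.clog 2 (T * B + 1)).pred := by
              rw [← pow_succ', Nat.pred_eq_sub_one, Nat.sub_add_cancel h]
          _ ≤ _ := by omega
    have hclog : Nat.clog 2 (T + 1) ≤ T := Nat.clog_le_of_le_pow hTB
    have hTB' : T * B + 1 ≤ (N ε + 1) * (2 ^ T) ^ 2 := by
      calc T * B + 1 ≤ (T + 1) * (N ε + T + 1) := by rw [hB]; nlinarith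
        _ ≤ (T + 1) * ((N ε + 1) * (T + 1)) := by gcongr; nlinarith
        _ = (N ε + 1) * (T + 1) ^ 2 := by ring
        _ ≤ _ := by gcongr
    have h1 : 2 ^ (T + Nat.clog 2 (T * B + 1) * 2) ≤ 4 * (N ε + 1) ^ 2 * (2 ^ T) ^ 5 := by
      calc 2 ^ (T + Nat.clog 2 (T * B + 1) * 2) = 2 ^ T * (2 ^ Nat.clog 2 (T * B + 1)) ^ 2 := by
            rw [pow_add, pow_mul]
        _ ≤ 2 ^ T * (2 * ((N ε + 1) * (2 ^ T) ^ 2)) ^ 2 := by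
            gcongr
            exact hr.trans (by gcongr)
        _ = _ := by ring
    have h2 : ((2 : ℝ) ^ T) ^ 5 ≤ Real.exp (s * l) ^ k := by
      calc ((2 : ℝ) ^ T) ^ 5 ≤ (Real.exp 1 ^ T) ^ 5 := by
            gcongr
            linarith [Real.add_one_le_exp (1 : ℝ)]
        _ = Real.exp (5 * T) := by
            rw [← pow_mul, ← Real.exp_nat_mul]
            congr 1
            push_cast
            ring
        _ ≤ Real.exp (k * (s * l)) := by
            refine Real.exp_le_exp.2 ?_
            have : 5 * K ≤ k := by
              rw [hk, Nat.cast_add, Nat.cast_one]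
              linarith [Nat.le_ceil (5 * K)]
            calc 5 * (T : ℝ) ≤ 5 * K * (s * l) := by linarith
              _ ≤ _ := by gcongr
        _ = _ := Real.exp_nat_mul _ _
    have h3 : (2 : ℝ) ^ (T + Nat.clog 2 (T * B + 1) * 2) ≤
        4 * (N ε + 1) ^ 2 * ((2 : ℝ) ^ T) ^ 5 := by exact_mod_cast h1
    refine h3.trans (mul_le_mul ?_ h2 (by positivity) (by have := hE0 ε; positivity))
    have := hE0 ε
    exact le_add_of_nonneg_right (by positivity)
  · set g := s ^ 2 * l with hg
    set L := Real.log (2 + g) with hL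
    have hg0 : 0 < g := by positivity
    have hκg : κ ^ 2 / 2 ≤ g := by
      have : κ ^ 2 * (1 / 2) ≤ s ^ 2 * l := by gcongr
      linarith
    have hL2 : 1 / 2 ≤ L := half_le_log_two.trans (Real.log_le_log two_pos (by linarith))
    -- As `s ≥ κ`, one factor `s / κ ≥ 1` may be inserted; this is how `s ^ 2` enters the gate
    -- count.
    have hTg : (T : ℝ) ≤ J * g := by
      refine hT.trans ?_
      rw [hJ, hg, div_mul_eq_mul_div, le_div_iff₀ hκ]
      have : K * (s * l) * κ ≤ K * (s * l) * s := by gcongr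
      linarith
    have hBL : (B : ℝ) ≤ L * E ε := by
      have h1 : (Nat.clog 2 (T + 1) : ℝ) ≤ 1 + 2 * (Real.log (1 + J) + L) := by
        refine (clog_two_le (Nat.le_add_left 1 T)).trans ?_
        rw [hL, ← Real.log_mul (by positivity) (by positivity)]
        gcongr
        push_cast
        nlinarith
      have h2 : (B : ℝ) ≤ N ε + (1 + 2 * (Real.log (1 + J) + L)) := by
        rw [hB, Nat.cast_add]
        linarith
      have h3 : (0 : ℝ) ≤ N ε := Nat.cast_nonneg _
      simp only [hE]
      nlinarith
    have hLk : L ≤ 2 ^ k * L ^ k := by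
      rw [← mul_pow]
      exact (by linarith : L ≤ 2 * L).trans (le_self_pow₀ (by linarith) (by omega))
    -- Absorbs the single gate of the diagonal, using `g ≥ κ ^ 2 / 2` and `L ≥ 1 / 2`.
    have h1 : (1 : ℝ) ≤ 4 / κ ^ 2 * g * L := by
      rw [div_mul_eq_mul_div, div_mul_eq_mul_div, le_div_iff₀ (by positivity)]
      nlinarith
    have hE' := hE0 ε
    calc ((6 * T * B + 1 : ℕ) : ℝ) = 6 * T * B + 1 := by push_cast; ring
      _ ≤ 6 * (J * g) * (L * E ε) + 4 / κ ^ 2 * g * L := by gcongr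
      _ = (6 * J * E ε + 4 / κ ^ 2) * g * L := by ring
      _ ≤ (6 * J * E ε + 4 / κ ^ 2) * g * (2 ^ k * L ^ k) := by gcongr
      _ = (2 ^ k * (6 * J * E ε + 4 / κ ^ 2)) * g * L ^ k := by ring
      _ ≤ _ := by
        gcongr
        exact le_add_of_nonneg_left (by positivity)

theorem QROM.Implementable.mono {E : Type} [Fintype E]
    {R : EuclideanSpace ℂ E → EuclideanSpace ℂ E} {ε N T N' T' : ℝ} (h : Implementable R ε N T)
    (hN : N ≤ N') (hT : T ≤ T') : Implementable R ε N' T' := by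
  obtain ⟨w, q, x, enc, gates, h1, h2, h3⟩ := h
  exact ⟨w, q, x, enc, gates, h1.trans hN, h2.trans hT, h3⟩

namespace DivideAndConquer

variable {a n : ℕ} {A Λ : Type*} (S : DivideAndConquer a n A Λ)

/-- In a nondegenerate recursion, `c₂` is positive and `m` is at least `b / c₂`. -/
theorem SizeTheta.pos_and_le (ha : 0 < a) {b : ℕ} (hb : 2 ≤ b) {c₁ c₂ : ℝ} (hc₁ : 0 < c₁) {M : ℕ}
    (hS : S.SizeTheta b c₁ c₂ M) {m : ℕ} (hM : M ≤ m) (hm : S.m₀ ≤ m) (p : Λ) :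
    1 ≤ m ∧ 0 < c₂ ∧ b / c₂ ≤ m := by
  have hpos : 1 ≤ m := (Nat.zero_le _).trans_lt (S.size_lt m hm p ⟨0, ha⟩)
  obtain ⟨h1, h2⟩ := hS m hM hm p ⟨0, ha⟩
  have hb0 : (0 : ℝ) < b := by positivity
  have hq : 0 < (m : ℝ) / b := div_pos (by exact_mod_cast hpos) hb0
  have hc₂ : 0 < c₂ := pos_of_mul_pos_left (((mul_pos hc₁ hq).trans_le h1).trans_le h2) hq.le
  refine ⟨hpos, hc₂, ?_⟩
  have h3 : 0 < S.size m p ⟨0, ha⟩ := by exact_mod_cast (mul_pos hc₁ hq).trans_le h1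
  have h4 : (1 : ℝ) ≤ S.size m p ⟨0, ha⟩ := by exact_mod_cast h3
  have h5 := h4.trans h2
  rw [← mul_div_assoc, le_div_iff₀ hb0, one_mul] at h5
  rwa [div_le_iff₀ hc₂, mul_comm]

end DivideAndConquer

end

/-! ### The main theorem -/

theorem mainTheorem8 (δ : ℕ) (c₁ c₂ : ℝ) (hc₁ : 0 < c₁) (M : ℕ) :
    ∃ (C : ℝ → ℝ) (k : ℕ), ∀ (a b n : ℕ) (A Λ : Type*) [Finite A] [Finite Λ]
      (S : DivideAndConquer a n A Λ),
      2 ≤ b → c₂ < b → S.SizeTheta b c₁ c₂ M → (∀ m p, (S.φ m p).depth ≤ δ) →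
      ∀ Paux P₀ : ℕ → Λ → SpanProgram.{u} (Fin n → A),
        (∀ m p, (Paux m p).Computes (S.faux m p)) →
        (∀ m, m < S.m₀ → ∀ p, (P₀ m p).Computes (S.f m p)) →
        ∃ P : ℕ → Λ → SpanProgram.{u} (Fin n → A),
          (∀ m, m < S.m₀ → ∀ p, P m p = P₀ m p) ∧
          ∀ m, S.m₀ ≤ m → ∀ p,
            (P m p).Computes (S.f m p) ∧
            (P m p).complexity ^ 2 ≤
              (∑ j, (P (S.size m p j) (S.param m p j)).complexity ^ 2) +
                (Paux m p).complexity ^ 2 ∧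
            ∃ (G : STGraph) (Q : G.E → SpanProgram.{u} (Fin n → A)) (leaf : G.E ↪ S.Leaf m p),
              (∀ e, ∃ (α : ℝ) (hα : 0 < α),
                Q e = ((leaf e).program S P₀ Paux).scale α hα ∨
                Q e = ((leaf e).program S P₀ Paux).neg.scale α hα) ∧
              P m p = G.compose Q ∧
              (2 ≤ a → M ≤ m → ∀ ε : ℝ, 0 < ε →
                QROM.Implementable (G.circulationSpace (G.resistance Q)).reflection ε
                  (C ε * ((a : ℝ) ^ (Real.log m / Real.log b)) ^ k)
                  (C ε * ((Real.log m / Real.log b) ^ 2 * Real.log a) *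
                    Real.log (2 + (Real.log m / Real.log b) ^ 2 * Real.log a) ^ k)) := by
  obtain ⟨κ, hκ, hlog⟩ := exists_mul_log_le_log_div c₂
  -- The constant of the depth bound `hT`: the 6 comes from `Nat.clog 2 (a + 1) ≤ 6 * log a`, and `M
  -- + 2` from bounding `M + 1` and the logarithmic term by multiples of `s / κ ≥ 1`.
  obtain ⟨C, k, hC⟩ := exists_resource_bound (6 * δ * (M + 2) / κ) κ (by positivity) hκ
  refine ⟨C, k, fun a b n A Λ _ _ S hb hc₂b hS hδ Paux P₀ haux h₀ =>
    ⟨fun m p => S.treeProgram P₀ Paux m p (S.trees P₀ Paux δ m p),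
      fun m hm p => if_pos hm, fun m hm p => ?_⟩⟩
  have hstep := S.isStep_trees hδ haux h₀
  have heq : S.treeProgram P₀ Paux m p (S.trees P₀ Paux δ m p) =
      (S.trees P₀ Paux δ m p).program (Lab.program (DivideAndConquer.Leaf.program S P₀ Paux)) :=
    if_neg (not_lt.2 hm)
  obtain ⟨hnd, hcomp, hcompl, -⟩ := hstep m hm p
  set τ := S.trees P₀ Paux δ m p with hτ
  refine ⟨(congrArg (fun P => P.Computes (S.f m p)) heq).mpr hcomp, (congrArg (fun P => P.complexity ^ 2) heq).trans_le hcompl, τ.graph,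
    fun e => Lab.program (DivideAndConquer.Leaf.program S P₀ Paux) (τ.label e),
    ⟨fun e => (τ.label e).leaf, τ.label_leaf_injective hnd⟩,
    fun e => ⟨_, (τ.label e).factor_pos, Lab.program_eq_or _ _⟩, heq, fun ha hM ε hε => ?_⟩
  obtain ⟨hm1, hc₂, hbm⟩ := hS.pos_and_le S (by omega) hb hc₁ hM hm p
  have hdep := S.depth_le_log (dep := fun m p => (S.trees P₀ Paux δ m p).depth)
    (D := δ * Nat.clog 2 (a + 1)) (by omega)
    (fun m p h => by simp only [S.trees_of_lt P₀ Paux δ p h]; rfl)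
    (fun m p h => (hstep m h p).2.2.2) hc₂ hc₂b hS m hM hm1 p
  have hlogb : 0 < Real.log b := Real.log_pos (by exact_mod_cast hb)
  have hL : 0 < Real.log (b / c₂) := Real.log_pos ((one_lt_div hc₂).2 hc₂b)
  have hκb := hlog b hb hc₂b hc₂
  have hLm : Real.log (b / c₂) ≤ Real.log m :=
    Real.log_le_log (div_pos (hc₂.trans hc₂b) hc₂) hbm
  set s := Real.log m / Real.log b with hs
  -- A subproblem has positive size, as `c₁ > 0`, so `m ≥ b / c₂`; this bounds `s` below uniformly
  -- in `b`.
  have hκs : κ ≤ s := (le_div_iff₀ hlogb).2 (hκb.trans hLm)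
  have hloga : 1 / 2 ≤ Real.log a :=
    half_le_log_two.trans (Real.log_le_log two_pos (by exact_mod_cast ha))
  have hclog : (Nat.clog 2 (a + 1) : ℝ) ≤ 6 * Real.log a := by
    have h1 : Real.log ((a + 1 : ℕ) : ℝ) ≤ 2 * Real.log a := by
      rw [← Nat.cast_two, ← Real.log_pow]
      refine Real.log_le_log (by positivity) ?_
      exact_mod_cast (by nlinarith : a + 1 ≤ a ^ 2)
    linarith [clog_two_le (Nat.le_add_left 1 a)]
  have hT : (τ.depth : ℝ) ≤ 6 * δ * (M + 2) / κ * (s * Real.log a) := by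
    have h1 : Real.log m / Real.log (b / c₂) ≤ s / κ := by
      rw [hs, div_div]
      exact div_le_div_of_nonneg_left (hL.le.trans hLm) (by positivity) (by linarith)
    have h2 : 1 ≤ s / κ := (one_le_div hκ).2 hκs
    calc (τ.depth : ℝ) ≤ (δ * Nat.clog 2 (a + 1) : ℕ) *
          (M + 1 + Real.log m / Real.log (b / c₂)) := hdep
      _ ≤ δ * (6 * Real.log a) * ((M + 1) * (s / κ) + s / κ) := by
        rw [Nat.cast_mul]
        gcongr
        exact le_mul_of_one_le_right (by positivity) h2
      _ = _ := by ring
  obtain ⟨B, r, hr, hB, h1, h2⟩ := hC τ.depth s (Real.log a) hκs hloga hT ε hε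
  refine (τ.implementable_reflection _ (fun e => pow_pos (norm_pos_iff.2
    (SpanProgram.w0_ne _)) 2) τ.depth B r le_rfl hr ε hB).mono (h1.trans_eq ?_) h2
  -- The power `a ^ s` is `exp (s * log a)`, the form used in the resource bound.
  rw [Real.rpow_def_of_pos (by positivity), mul_comm s]
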